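/- A multilabel temporal graph $\mathcal G=(G,\lambda)$ is a finite simple graph $G=(V,E)$ with a non-empty set $\lambda(e)\subseteq\mathbb N$ of time-labels on every edge $e$; put $n=|V|$, $m=|E|$. For $S,T\subseteq\mathbb N$ write $S\preceq T$ (resp. $S\prec T$) if $x\le y$ (resp. $x<y$) for some $x\in S$, $y\in T$; for finite non-empty sets this says $\min S\le\max T$ (resp. $\min S<\max T$). An orientation $O$ of $G$ consists of exactly one of the arcs $(a,b),(b,a)$ for each edge $ab\in E$. It is a multilabel temporal transitive orientation (MTTO) if whenever $(a,b),(b,c)\in O$ and $\lambda(ab)\preceq\lambda(bc)$, then $(a,c)\in O$ and $\lambda(ac)\not\prec\lambda(bc)$. $\mathcal G$ is a $T$-comparability multilabel temporal graph if it admits an MTTO. A quadruple $(a,b,c,d)$ of vertices is a correlated monolabel triangle if $abc$ is a triangle of $G$ whose three edges have the same singleton label set $T=\{t\}$, $bd\in E$ with $\lambda(bd)\preceq T$, $cd\in E$ with $\lambda(cd)\not\preceq T$, and, if $ad\in E$, $\lambda(ad)\prec T$. The digraph $\mathrm{Aug}(\mathcal G)$ has as vertices all pairs $(u,v)$ with $uv\in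 E$. For all $ab,bc\in E$ such that $\lambda(ab)\preceq\lambda(bc)$ and ($ac\notin E$ or $\lambda(ac)\prec\lambda(bc)$), it has an arc from $(a,b)$ to $(c,b)$ and one from $(b,c)$ to $(b,a)$; for every correlated monolabel triangle $(a,b,c,d)$, it has an arc from $(b,c)$ to $(a,c)$ and one from $(c,a)$ to $(c,b)$; there are no other arcs. A pair $x$ forces a pair $y$ if there is a directed path, possibly of length $0$, from $x$ to $y$ in $\mathrm{Aug}(\mathcal G)$; $O^+$ is the set of all pairs forced by some element of $O$. An orientation $O$ is an almost-MTTO (AMTTO) if $O\cap O^R=\emptyset$, where $O^R=\{(v,u):(u,v)\in O\}$, and $O^+=O$. $\mathrm{Ness}(\mathcal G)$ is the set of all pairs $(x,y)$ with $xy\in E$ such that $(y,x)$ forces $(x,y)$. **Theorem.** Let $\mathcal G$ be a multilabel temporal graph. The following are equivalent: 1. $\mathcal G$ is a $T$-comparability multilabel temporal graph; 2. $\mathcal G$ admits an AMTTO; 3. $\mathrm{Ness}(\mathcal G)$ induces an acyclic digraph (no directed cycle, a pair of opposite arcs counting as a cycle). Furthermore, there is an algorithm that decides whether a multilabel temporal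 graph with finite label sets is a $T$-comparability multilabel temporal graph, and constructs an MTTO if it is, in time $O\bigl(\max\{nm,\min\{kn,m^2\}\}+1\bigr)$, where $k$ is the number of triangles of $G$ whose three edges have the same singleton label set. Here the vertices are $0,\dots,n-1$, the algorithm is a program for a unit-cost random access machine on natural numbers with addition, truncated subtraction and comparison as its operations, with all memory cells initially $0$ except for the input, and the input in memory consists of $n$, $m$, an arbitrary list of the edges and, for each edge, the increasing list of its labels together with its position in memory. -/

import Mathlib

/-- `S ⪯ T`: some element of `S` is at most some element of `T`
(for finite non-empty sets, `min S ≤ max T`). -/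
def LabelLE (S T : Set ℕ) : Prop := ∃ x ∈ S, ∃ y ∈ T, x ≤ y

/-- `S ≺ T`: some element of `S` is smaller than some element of `T`
(for finite non-empty sets, `min S < max T`). -/
def LabelLT (S T : Set ℕ) : Prop := ∃ x ∈ S, ∃ y ∈ T, x < y

/-- A multilabel temporal graph: a static graph together with a non-empty set of time-labels on
every edge. The values of `label` outside the edge set are never used. -/
structure MultilabelTemporalGraph (V : Type*) where
  graph : SimpleGraph V
  label : Sym2 V → Set ℕ
  label_nonempty : ∀ e ∈ graph.edgeSet, (label e).Nonempty

namespace MultilabelTemporalGraph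

variable {V : Type*} (G : MultilabelTemporalGraph V)

/-- `O` consists of exactly one of the arcs `(a, b)`, `(b, a)` for each edge `ab`. -/
structure IsOrientation (O : Set (V × V)) : Prop where
  adj : ∀ a b, (a, b) ∈ O → G.graph.Adj a b
  exactly_one : ∀ a b, G.graph.Adj a b → Xor ((a, b) ∈ O) ((b, a) ∈ O)

/-- Multilabel temporal transitive orientations. -/
structure IsMTTO (O : Set (V × V)) : Prop where
  orientation : G.IsOrientation O
  transitive : ∀ a b c, (a, b) ∈ O → (b, c) ∈ O → LabelLE (G.label s(a, b)) (G.label s(b, c)) →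
    (a, c) ∈ O ∧ ¬ LabelLT (G.label s(a, c)) (G.label s(b, c))

/-- `G` is a `T`-comparability multilabel temporal graph. -/
def IsTComparability : Prop := ∃ O : Set (V × V), G.IsMTTO O

/-- `abc` is a triangle whose three edges all carry the label set `{t}`. -/
structure IsMonolabelTriangle (t : ℕ) (a b c : V) : Prop where
  adj_ab : G.graph.Adj a b
  adj_bc : G.graph.Adj b c
  adj_ac : G.graph.Adj a c
  label_ab : G.label s(a, b) = {t}
  label_bc : G.label s(b, c) = {t}
  label_ac : G.label s(a, c) = {t}

/-- `(a, b, c, d)` is a correlated monolabel triangle. -/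
def IsCorrelated (a b c d : V) : Prop :=
  ∃ t : ℕ, G.IsMonolabelTriangle t a b c ∧
    (G.graph.Adj b d ∧ LabelLE (G.label s(b, d)) {t}) ∧
    (G.graph.Adj c d ∧ ¬ LabelLE (G.label s(c, d)) {t}) ∧
    (G.graph.Adj a d → LabelLT (G.label s(a, d)) {t})

/-- The premise under which the path `abc` produces two arcs of the implication digraph. -/
def Conflict (a b c : V) : Prop :=
  G.graph.Adj a b ∧ G.graph.Adj b c ∧ LabelLE (G.label s(a, b)) (G.label s(b, c)) ∧
    (¬ G.graph.Adj a c ∨ LabelLT (G.label s(a, c)) (G.label s(b, c)))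

/-- The arcs of the implication digraph `Imp(G)`, whose vertices are the pairs `(u, v)` with `uv`
an edge. -/
inductive Imp : V × V → V × V → Prop
  | left {a b c : V} (h : G.Conflict a b c) : Imp (a, b) (c, b)
  | right {a b c : V} (h : G.Conflict a b c) : Imp (b, c) (b, a)

/-- The arcs of the augmented implication digraph `Aug(G)`. -/
inductive Aug : V × V → V × V → Prop
  | imp {x y : V × V} (h : G.Imp x y) : Aug x y
  | left {a b c d : V} (h : G.IsCorrelated a b c d) : Aug (b, c) (a, c)
  | right {a b c d : V} (h : G.IsCorrelated a b c d) : Aug (c, a) (c, b)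

/-- `x` forces `y`: there is a directed path (possibly of length zero) from `x` to `y`
in `Aug(G)`. -/
def Forces (x y : V × V) : Prop := Relation.ReflTransGen G.Aug x y

/-- `O⁺`, the set of all arcs that are forced by some arc in `O`. -/
def forcedBy (O : Set (V × V)) : Set (V × V) := {y | ∃ x ∈ O, G.Forces x y}

/-- Almost-multilabel temporal transitive orientations: orientations `O` such that
`O` is disjoint from its reverse and `O⁺ = O`. -/
structure IsAMTTO (O : Set (V × V)) : Prop where
  orientation : G.IsOrientation O
  inter_reverse : O ∩ Prod.swap '' O = ∅
  forcedBy_eq : G.forcedBy O = O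

/-- `Ness(G)`, the set of necessary arcs `(x, y)`: those with `(y, x)` forcing `(x, y)`. -/
def ness : Set (V × V) := {p | G.graph.Adj p.1 p.2 ∧ G.Forces p.swap p}

/-- `Ness(G)` induces a digraph without directed cycles (a pair of opposite arcs is a cycle). -/
def NessAcyclic : Prop := ∀ v : V, ¬ Relation.TransGen (fun x y => (x, y) ∈ G.ness) v v

/-- The number of edges. -/
noncomputable def numEdges : ℕ := G.graph.edgeSet.ncard

/-- The number of (unordered) monolabel triangles with a singleton label set. -/
noncomputable def numMonolabelTriangles : ℕ :=
  {T : Set V | ∃ t a b c, G.IsMonolabelTriangle t a b c ∧ T = {a, b, c}}.ncard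

end MultilabelTemporalGraph

/-! ### Unit-cost random access programs

A program has registers `0, 1, 2, …` and arrays `0, 1, 2, …`, all of whose cells hold natural
numbers. The arithmetic operations are addition and truncated subtraction. Every register access,
array access, constant, arithmetic operation, comparison, assignment and branching costs one step.
-/

namespace RAM

/-- The contents of the registers and of the arrays. -/
structure State where
  reg : ℕ → ℕ
  mem : ℕ → ℕ → ℕ

inductive Expr
  | lit (c : ℕ)
  | reg (x : ℕ)
  | load (a : ℕ) (i : Expr)
  | add (e f : Expr)
  | sub (e f : Expr)

def Expr.eval (s : State) : Expr → ℕ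
  | .lit c => c
  | .reg x => s.reg x
  | .load a i => s.mem a (i.eval s)
  | .add e f => e.eval s + f.eval s
  | .sub e f => e.eval s - f.eval s

def Expr.cost : Expr → ℕ
  | .lit _ => 1
  | .reg _ => 1
  | .load _ i => i.cost + 1
  | .add e f => e.cost + f.cost + 1
  | .sub e f => e.cost + f.cost + 1

inductive Test
  | lt (e f : Expr)
  | eq (e f : Expr)
  | not (b : Test)
  | and (b c : Test)

def Test.holds (s : State) : Test → Prop
  | .lt e f => e.eval s < f.eval s
  | .eq e f => e.eval s = f.eval s
  | .not b => ¬ b.holds s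
  | .and b c => b.holds s ∧ c.holds s

def Test.cost : Test → ℕ
  | .lt e f => e.cost + f.cost + 1
  | .eq e f => e.cost + f.cost + 1
  | .not b => b.cost + 1
  | .and b c => b.cost + c.cost + 1

/-- `ite` is branching and `loop b p` is `while b do p`. -/
inductive Program
  | skip
  | assign (x : ℕ) (e : Expr)
  | store (a : ℕ) (i e : Expr)
  | seq (p q : Program)
  | ite (b : Test) (p q : Program)
  | loop (b : Test) (p : Program)

/-- Write `v` into register `x`. -/
def State.setReg (s : State) (x v : ℕ) : State :=
  { s with reg := Function.update s.reg x v }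

/-- Write `v` into cell `i` of array `a`. -/
def State.setMem (s : State) (a i v : ℕ) : State :=
  { s with mem := Function.update s.mem a (Function.update (s.mem a) i v) }

/-- `Exec p s s' t`: started in state `s`, the program `p` halts in state `s'` after `t` steps. -/
inductive Exec : Program → State → State → ℕ → Prop
  | skip {s : State} : Exec .skip s s 1
  | assign {x : ℕ} {e : Expr} {s : State} :
      Exec (.assign x e) s (s.setReg x (e.eval s)) (e.cost + 1)
  | store {a : ℕ} {i e : Expr} {s : State} :
      Exec (.store a i e) s (s.setMem a (i.eval s) (e.eval s)) (i.cost + e.cost + 1)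
  | seq {p q : Program} {s s' s'' : State} {t t' : ℕ} (hp : Exec p s s' t)
      (hq : Exec q s' s'' t') : Exec (.seq p q) s s'' (t + t')
  | ite_true {b : Test} {p q : Program} {s s' : State} {t : ℕ} (hb : b.holds s)
      (hp : Exec p s s' t) : Exec (.ite b p q) s s' (b.cost + 1 + t)
  | ite_false {b : Test} {p q : Program} {s s' : State} {t : ℕ} (hb : ¬ b.holds s)
      (hq : Exec q s s' t) : Exec (.ite b p q) s s' (b.cost + 1 + t)
  | loop_true {b : Test} {p : Program} {s s' s'' : State} {t t' : ℕ} (hb : b.holds s)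
      (hp : Exec p s s' t) (hw : Exec (.loop b p) s' s'' t') :
      Exec (.loop b p) s s'' (b.cost + 1 + t + t')
  | loop_false {b : Test} {p : Program} {s : State} (hb : ¬ b.holds s) :
      Exec (.loop b p) s s (b.cost + 1)

end RAM

namespace MultilabelTemporalGraph

/-- A description of a multilabel temporal graph on the vertices `0, …, n - 1` by the list of its
edges, in any order and with the two endpoints of each edge in any order, and for each edge the
increasing list of its time-labels. -/
structure Description {n : ℕ} (G : MultilabelTemporalGraph (Fin n)) where
  tail : Fin G.numEdges → Fin n
  head : Fin G.numEdges → Fin n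
  injective : Function.Injective fun j => s(tail j, head j)
  range_eq : Set.range (fun j => s(tail j, head j)) = G.graph.edgeSet
  times : Fin G.numEdges → List ℕ
  times_increasing : ∀ j, (times j).Pairwise (· < ·)
  mem_times : ∀ j t, t ∈ times j ↔ t ∈ G.label s(tail j, head j)

namespace Description

variable {n : ℕ} {G : MultilabelTemporalGraph (Fin n)} (D : G.Description)

/-- All lists of time-labels, one after the other. -/
noncomputable def allTimes : List ℕ := (List.ofFn D.times).flatten

/-- The position in `allTimes` where the list of the `j`-th edge starts. -/
noncomputable def start (j : ℕ) : ℕ := ((List.ofFn D.times).take j).flatten.length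

/-- The initial state: registers `0` and `1` hold the numbers of vertices and of edges. Arrays `0`
and `1` hold the endpoints of the edges. The labels of the `j`-th edge are in array `3`, in
increasing order, from position `start j` up to but not including position `start (j + 1)`, and
array `2` holds the numbers `start 0, …, start m`. Everything else is `0`. -/
noncomputable def initialState : RAM.State where
  reg x := if x = 0 then n else if x = 1 then G.numEdges else 0
  mem a i :=
    if a = 0 then (if h : i < G.numEdges then (D.tail ⟨i, h⟩ : ℕ) else 0)
    else if a = 1 then (if h : i < G.numEdges then (D.head ⟨i, h⟩ : ℕ) else 0)
    else if a = 2 then (if i ≤ G.numEdges then D.start i else 0)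
    else if a = 3 then D.allTimes.getD i 0
    else 0

/-- The orientation written in array `4`: the `j`-th edge is oriented from its first to its second
endpoint if cell `j` holds `1`, and the other way otherwise. -/
def outputOrientation (s : RAM.State) : Set (Fin n × Fin n) :=
  {p | ∃ j : Fin G.numEdges,
    p = if s.mem 4 j = 1 then (D.tail j, D.head j) else (D.head j, D.tail j)}

/-- Register `2` holds the answer: `1` for yes, together with a multilabel temporal transitive
orientation in array `4`, and `0` for no. -/
def IsCorrectOutput (s : RAM.State) : Prop :=
  (G.IsTComparability ∧ s.reg 2 = 1 ∧ G.IsMTTO (D.outputOrientation s)) ∨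
    (¬ G.IsTComparability ∧ s.reg 2 = 0)

end Description

end MultilabelTemporalGraph

/-! An AMTTO can fail to be an MTTO only through a cyclic triangle a → b → c → a (`IsAMTTO.isMTTO`):
closure under forcing already supplies the edge `ac` and its label condition, only its direction may
be wrong. Such a triangle carries one and the same single label on all its edges
(`ClosedOrientation.mono`). The key fact is that cyclic triangles can be pulled back along forcing:
if `x ∈ O` forces `y`, and `y` forms a cyclic triangle with a vertex `c`, then so does `x`, with the
same `c` (`IsAMTTO.closes_of_forces`). Correlated monolabel triangles are the configurations that
would block this for the arcs of `Imp`, which is why `Aug` contains arcs for them.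

Two consequences give 1 ⇒ 3. In an AMTTO a necessary arc lies in no cyclic triangle
(`IsAMTTO.not_closes_of_mem_ness`), and the arcs in no cyclic triangle, called steady, form an
acyclic digraph (`IsAMTTO.steady_acyclic`). An MTTO is an AMTTO (`IsMTTO.isAMTTO`), so `Ness` is
acyclic. For 3 ⇒ 2, a maximal consistent set closed under forcing can leave an edge undecided only
if each of its arcs forces the other, which is a cycle of length two in `Ness`. For 2 ⇒ 1, start
with `Ness`, choose vertices `u` one after the other, and orient all undecided edges at `u` away
from `u`, together with everything forced. A cyclic triangle through a new arc would pull back to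
one through `u`, whose arc into `u` is either old or forced by an arc out of `u`; both are
impossible (`IsSolid.round`).

The algorithm avoids computing `Ness`. It first finds an AMTTO `P` by searching from both
orientations of an undecided edge in parallel and keeping the search that ends first. If an AMTTO
exists, this choice is consistent (`Done.not_forces_swap`), and the whole work is proportional to
`n` times the number of arcs kept, hence O(nm) altogether. It then determines the steady arcs of
`P`, a superset of `Ness`, and runs the rounds of 2 ⇒ 1 from the empty set. In each round it chooses
a vertex with undecided edges that no undecided steady arc enters: it exists since steady arcs are
acyclic (`exists_source`), and no undecided arc out of it forces its own reverse, because the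
reverse would be necessary and hence steady. Correlated triangles are tabulated beforehand, by
triangles or by pairs of edges, whichever is cheaper; this gives the term min{kn, m²}. A final check
of transitivity in time O(nm) makes the answer correct without any assumption on the input. -/

/-- A closed orientation of a graph, in terms of the earliest and the latest label of an edge. -/
structure ClosedOrientation {V T : Type*} [LinearOrder T] (E O : V → V → Prop)
    (lo hi : V → V → T) : Prop where
  adj : ∀ {a b}, O a b → E a b
  symm : ∀ {a b}, E a b → E b a
  total : ∀ {a b}, E a b → O a b ∨ O b a
  asymm : ∀ {a b}, O a b → ¬ O b a
  lo_comm : ∀ a b, lo a b = lo b a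
  hi_comm : ∀ a b, hi a b = hi b a
  lo_le_hi : ∀ {a b}, E a b → lo a b ≤ hi a b
  nc : ∀ {a b c}, O a b → O b c → hi b c < lo a b ∨ E a c ∧ hi b c ≤ lo a c
  corr : ∀ {a b c d} (t : T), E a b → E b c → E a c → lo a b = t → hi a b = t → lo b c = t → hi b c = t →
    lo a c = t → hi a c = t → E b d → lo b d ≤ t → E c d → t < lo c d → (¬ E a d ∨ lo a d < t) → O b c → O a c

/-! ### Cyclic triangles of closed orientations -/

namespace ClosedOrientation

variable {V T : Type*} [LinearOrder T] {E O : V → V → Prop} {lo hi : V → V → T}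

/-- By `nc`, the `hi` of each edge is less than the `lo` of the preceding edge or at most the `lo`
of the following one. At an edge of maximal `hi` the first alternative fails, so the following edge
has `lo` and `hi` equal to that maximum; this goes around the triangle. -/
theorem mono (h : ClosedOrientation E O lo hi) {a b c : V} (ab : O a b) (bc : O b c) (ca : O c a) :
    ∃ t, lo a b = t ∧ hi a b = t ∧ lo b c = t ∧ hi b c = t ∧ lo c a = t ∧ hi c a = t := by
  have := h.nc ab bc
  have := h.nc bc ca
  have := h.nc ca ab
  have := h.lo_comm a c
  have := h.lo_comm b a
  have := h.lo_comm c b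
  have := h.lo_le_hi (h.adj ab)
  have := h.lo_le_hi (h.adj bc)
  have := h.lo_le_hi (h.adj ca)
  refine ⟨lo a b, rfl, ?_⟩
  grind

/-- The pull-back along the `Imp` arc from `(d, b)` to `(a, b)`. By `nc` at d → b → c, `c d` is an
edge. If it pointed from `d` to `c`, then `nc` at d → c → a would make its labels later than that of
the triangle, so that `corr` applies to `a, b, c, d` and contradicts `O c a`. -/
theorem back_left (h : ClosedOrientation E O lo hi) {a b c d : V} (ab : O a b) (bc : O b c) (ca : O c a) (db : O d b)
   (h1 : lo d b ≤ hi b a) (h2 : ¬ E d a ∨ lo d a < hi b a) : O c d := by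
  obtain ⟨t, h3⟩ := h.mono ab bc ca
  have := h.nc db bc 
  have := @nc _ _ _ _ _ _ _ h d c a
  have := h.corr (a := a) (b := b) (c := c) (d := d) t
  have := h.lo_comm
  have := h.hi_comm
  have := h.adj ab
  have := h.adj bc
  have := h.adj ca
  have := h.adj db
  have := @h.symm
  have := @h.total
  have := @h.asymm
  grind

/-- The pull-back along the `Imp` arc from `(a, r)` to `(a, b)`. Here `nc` at c → a → r and at b → c
→ r suffices; no correlated triangle arises. -/
theorem back_right (h : ClosedOrientation E O lo hi) {a b c r : V} (ab : O a b) (bc : O b c) (ca : O c a) (ar : O a r)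
   (h1 : lo b a ≤ hi a r) (h2 : ¬ E b r ∨ lo b r < hi a r) : O r c := by
  obtain ⟨t, h3⟩ := h.mono ab bc ca
  have := h.nc ca ar
  have := @nc _ _ _ _ _ _ _ h b c r
  cases h
  grind

/-- If `O r d` held, `nc` would bound `hi b d` by `t`, whichever way the edge `b d` points. -/
theorem not_of_corr (h : ClosedOrientation E O lo hi) {b r d : V} {t : T} (hrb : lo r b = t ∧ hi r b = t)
    (rb : O r b) (rd' : lo r d ≤ t) (bd : E b d) (bd' : t < lo b d) : ¬ O r d := by
  intro rd
  have h0 := h.lo_le_hi bd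
  have h1 := h.lo_comm b d
  have h2 := h.hi_comm b d
  rcases h.total bd with k | k
  · have := h.nc rb k; grind only
  · have := h.nc rd k; grind only

/-- The pull-back along the arc from `(r, b)` to `(a, b)` given by the correlated triangle `(a, r,
b, d)`. If it failed, `c` could take the place of `b`: the triangle `(a, r, c, d)` would be
correlated as well. -/
theorem back_cor_left (h : ClosedOrientation E O lo hi) {a b c r d : V} (ab : O a b) (bc : O b c) (ca : O c a) (t : T)
    (e1 : E a r) (hl : lo a r = t ∧ hi a r = t ∧ lo r b = t ∧ hi r b = t ∧ lo a b = t ∧ hi a b = t)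
    (rb : O r b) (rd : E r d) (rd' : lo r d ≤ t) (bd : E b d) (bd' : t < lo b d)
    (ad : ¬ E a d ∨ lo a d < t) : O c r := by
  obtain ⟨t', h3⟩ := h.mono ab bc ca
  have hE : E r c ∧ hi b c ≤ lo r c := by have := h.nc rb bc; grind only
  have dr : O d r := (h.total rd).resolve_left
    (h.not_of_corr ⟨hl.2.2.1, hl.2.2.2.1⟩ rb rd' bd bd')
  have ar : O a r := by
    refine (h.total e1).resolve_right fun ra => ?_
    have := h.nc dr ra
    have := h.lo_comm r d
    have := h.hi_comm r a
    have := h.lo_comm d a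
    have : E d a → E a d := h.symm
    grind only
  -- With `O r c`, also a → r → c → a is a cyclic triangle, so its labels are all `t`. Then `d`
  -- points to `r`, `b` and `c`, and `c d` turns out to have only labels later than `t`.
  refine (h.total hE.1).resolve_left fun rc => ?_
  obtain ⟨t'', h4⟩ := h.mono ar rc ca
  have db : O d b := by
    refine (h.total bd).resolve_left fun bd => ?_
    obtain ⟨_, h5⟩ := h.mono dr rb bd
    grind only
  have dc := h.nc dr rc
  have := h.lo_comm r d
  have cd : E d c → O d c := fun e => by
    refine (h.total e).resolve_right fun cd => ?_
    obtain ⟨_, h5⟩ := h.mono db bc cd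
    have := h.lo_comm b d
    grind only
  have dc' : O d c := by grind only
  have := h.nc dc' ca
  have := h.lo_comm a c
  have := h.hi_comm a c
  have := h.lo_comm d c
  have := h.lo_comm a d
  have := h.asymm ca
  have hda : E d a → E a d := h.symm
  have hcd : t < lo c d := by grind only
  exact h.asymm ca (h.corr t e1 hE.1 (h.symm (h.adj ca)) hl.1 hl.2.1 (by grind only) (by grind only)
    (by grind only) (by grind only) rd rd' (h.symm (h.adj dc')) hcd ad rc)

/-- The pull-back along the arc from `(a, r)` to `(a, b)` given by the correlated triangle `(r, b,
a, d)`. If it failed, replacing `a` by `c` would give the correlated triangle `(r, b, c, d)`, by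
which `b c` forces `r c`, against `O c r`. -/
theorem back_cor_right (h : ClosedOrientation E O lo hi) {a b c r d : V} (ab : O a b) (bc : O b c) (ca : O c a) (t : T)
    (e1 : E r b)
    (hl : lo r b = t ∧ hi r b = t ∧ lo b a = t ∧ hi b a = t ∧ lo r a = t ∧ hi r a = t)
    (ar : O a r) (bd : E b d) (bd' : lo b d ≤ t) (ad : E a d) (ad' : t < lo a d)
    (rd : ¬ E r d ∨ lo r d < t) : O r c := by
  obtain ⟨t', h3⟩ := h.mono ab bc ca
  have := h.lo_comm b a
  have := h.hi_comm b a
  have := h.lo_comm a r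
  have := h.hi_comm a r
  have hE : E c r ∧ hi a r ≤ lo c r := by have := h.nc ca ar; grind only
  refine (h.total hE.1).resolve_left fun cr => ?_
  have hbr := h.nc bc cr
  have hcr := h.lo_le_hi hE.1
  have := h.lo_comm r b
  have := h.hi_comm r b
  -- If `O b r` held, `nc` would give `O b d` and `O a d`, and then neither direction of `c d` would
  -- be possible.
  have br : ¬ O b r := fun br => by
    have bd1 : O b d := by
      refine (h.total bd).resolve_right fun db => ?_
      have := h.nc db br
      have := h.lo_comm d b
      have := h.lo_comm d r
      have : E d r → E r d := h.symm
      grind only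
    have ad1 : O a d := by
      refine (h.total ad).resolve_right fun da => ?_
      have := h.nc bd1 da
      have := h.lo_le_hi ad
      have := h.hi_comm a d
      grind only
    have h1 := h.nc ca ad1
    have := h.lo_le_hi ad
    have h2 : E c d ∧ hi a d ≤ lo c d := by grind only
    rcases h.total h2.1 with cd | dc
    · have := h.nc bc cd
      have := h.lo_le_hi h2.1
      grind only
    · obtain ⟨_, h5⟩ := h.mono ca ad1 dc
      grind only
  have rb : O r b := (h.total e1).resolve_right br
  have := h.lo_comm b d
  have hdr : E d r → E r d := h.symm
  have := h.lo_comm d r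
  have := h.lo_le_hi ad
  have had := h.lo_comm d a
  have had' := h.hi_comm d a
  have h6 := h.lo_comm c d
  -- The late labels of `a d` are passed on to `c d`, through `nc` at paths through `a` or `b`.
  have key : E c d ∧ t < lo c d := by
    rcases h.total bd with k | k
    · have ad1 : O a d := by
        refine (h.total ad).resolve_right fun da => ?_
        have := h.nc k da
        grind only
      have := h.nc ca ad1
      grind only
    · have h1 := h.nc k bc
      have h2 : E d c ∧ hi b c ≤ lo d c := by grind only
      refine ⟨h.symm h2.1, ?_⟩
      rcases h.total h2.1 with dc | cd
      · have := h.nc dc cr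
        grind only
      · have := h.hi_comm c d
        rcases h.total ad with l | l
        · have := h.nc ca l
          grind only
        · have := h.nc cd l
          grind only
  have h7 := h.lo_comm c r
  have h8 := h.hi_comm c r
  have h9 := h.nc rb bc
  exact h.asymm cr (h.corr t e1 (h.adj bc) (h.symm (h.adj cr)) (by grind only) (by grind only)
    (by grind only) (by grind only) (by grind only) (by grind only) bd bd' key.1 key.2 rd bc)

end ClosedOrientation

/-! ### Label conditions in terms of earliest label and supremum -/

namespace MultilabelTemporalGraph

variable {V : Type*} (G : MultilabelTemporalGraph V)

/-- The earliest label of an edge. -/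
noncomputable def lo (a b : V) : ℕ∞ := ((sInf (G.label s(a, b)) : ℕ) : ℕ∞)

/-- The supremum of the labels of an edge. -/
noncomputable def hi (a b : V) : ℕ∞ := ⨆ x ∈ G.label s(a, b), (x : ℕ∞)

variable {G}

theorem lo_comm (a b : V) : G.lo a b = G.lo b a := by rw [lo, lo, Sym2.eq_swap]

theorem hi_comm (a b : V) : G.hi a b = G.hi b a := by rw [hi, hi, Sym2.eq_swap]

theorem label_nonempty' {a b : V} (h : G.graph.Adj a b) : (G.label s(a, b)).Nonempty :=
  G.label_nonempty _ h

theorem lo_le_hi {a b : V} (h : G.graph.Adj a b) : G.lo a b ≤ G.hi a b :=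
  le_iSup₂_of_le _ (Nat.sInf_mem (label_nonempty' h)) le_rfl

/-- Taking the supremum in `ℕ∞` makes the criterion valid for infinite label sets too, where no
latest label exists. -/
theorem labelLE_iff {a b c d : V} (h : G.graph.Adj a b) (h' : G.graph.Adj c d) :
    LabelLE (G.label s(a, b)) (G.label s(c, d)) ↔ G.lo a b ≤ G.hi c d := by
  constructor
  · rintro ⟨x, hx, y, hy, hxy⟩
    exact (Nat.cast_le.2 ((Nat.sInf_le hx).trans hxy)).trans
      (le_iSup₂_of_le (f := fun (y : ℕ) (_ : y ∈ G.label s(c, d)) => (y : ℕ∞)) y hy le_rfl)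
  · intro hle
    by_contra hcon
    have hlt : ∀ y ∈ G.label s(c, d), y < sInf (G.label s(a, b)) := fun y hy => by
      by_contra hge
      exact hcon ⟨_, Nat.sInf_mem (label_nonempty' h), y, hy, not_lt.1 hge⟩
    obtain ⟨y, hy⟩ := label_nonempty' h'
    -- The subtraction is not truncated, since the label `y` lies strictly below this infimum.
    have hsup : G.hi c d ≤ ((sInf (G.label s(a, b)) - 1 : ℕ) : ℕ∞) :=
      iSup₂_le fun z hz => Nat.cast_le.2 (Nat.le_sub_one_of_lt (hlt z hz))
    have := Nat.cast_le.1 (hle.trans hsup)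
    have := hlt y hy
    omega

theorem labelLT_iff {a b c d : V} (h : G.graph.Adj a b) :
    LabelLT (G.label s(a, b)) (G.label s(c, d)) ↔ G.lo a b < G.hi c d := by
  rw [hi]
  simp only [lt_iSup_iff]
  constructor
  · rintro ⟨x, hx, y, hy, hxy⟩
    exact ⟨y, hy, Nat.cast_lt.2 ((Nat.sInf_le hx).trans_lt hxy)⟩
  · rintro ⟨y, hy, hxy⟩
    exact ⟨_, Nat.sInf_mem (label_nonempty' h), y, hy, Nat.cast_lt.1 hxy⟩

theorem label_eq_singleton_iff {a b : V} (h : G.graph.Adj a b) (t : ℕ) :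
    G.label s(a, b) = {t} ↔ G.lo a b = t ∧ G.hi a b = t := by
  constructor
  · intro he
    simp [lo, hi, he]
  · rintro ⟨h1, h2⟩
    refine (Set.Nonempty.subset_singleton_iff (label_nonempty' h)).1 fun y hy => ?_
    have h3 : sInf (G.label s(a, b)) ≤ y := Nat.sInf_le hy
    have h4 : (y : ℕ∞) ≤ G.hi a b := le_iSup₂_of_le y hy le_rfl
    rw [h2, Nat.cast_le] at h4
    rw [lo, Nat.cast_inj] at h1
    simp only [Set.mem_singleton_iff]
    omega

theorem conflict_iff {a b c : V} : G.Conflict a b c ↔ G.graph.Adj a b ∧ G.graph.Adj b c ∧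
    G.lo a b ≤ G.hi b c ∧ (¬ G.graph.Adj a c ∨ G.lo a c < G.hi b c) := by
  unfold Conflict
  by_cases h1 : G.graph.Adj a b <;> by_cases h2 : G.graph.Adj b c <;>
    by_cases h3 : G.graph.Adj a c <;>
    simp [h1, h2, h3, labelLE_iff, labelLT_iff]

theorem isCorrelated_iff {a b c d : V} : G.IsCorrelated a b c d ↔ ∃ t : ℕ∞,
    (G.graph.Adj a b ∧ G.graph.Adj b c ∧ G.graph.Adj a c) ∧
    (G.lo a b = t ∧ G.hi a b = t ∧ G.lo b c = t ∧ G.hi b c = t ∧ G.lo a c = t ∧ G.hi a c = t) ∧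
    (G.graph.Adj b d ∧ G.lo b d ≤ t) ∧ (G.graph.Adj c d ∧ t < G.lo c d) ∧
    (¬ G.graph.Adj a d ∨ G.lo a d < t) := by
  constructor
  · rintro ⟨t, ⟨h1, h2, h3, l1, l2, l3⟩, ⟨h4, l4⟩, ⟨h5, l5⟩, h6⟩
    rw [← l1] at l4 l5 h6
    rw [labelLE_iff h4 h1] at l4
    rw [labelLE_iff h5 h1, not_le] at l5
    rw [label_eq_singleton_iff ‹_›] at l1 l2 l3
    refine ⟨t, ⟨h1, h2, h3⟩, ⟨l1.1, l1.2, l2.1, l2.2, l3.1, l3.2⟩, ⟨h4, l1.2 ▸ l4⟩,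
      ⟨h5, l1.2 ▸ l5⟩, ?_⟩
    by_cases h7 : G.graph.Adj a d
    · exact Or.inr (l1.2 ▸ (labelLT_iff h7).1 (h6 h7))
    · exact Or.inl h7
  · rintro ⟨t, ⟨h1, h2, h3⟩, ⟨l1, l2, l3, l4, l5, l6⟩, ⟨h4, l7⟩, ⟨h5, l8⟩, h6⟩
    obtain ⟨k, rfl⟩ : ∃ k : ℕ, t = k := ⟨_, l1.symm⟩
    have hk := (label_eq_singleton_iff h1 k).2 ⟨l1, l2⟩
    refine ⟨k, ⟨h1, h2, h3, hk, (label_eq_singleton_iff h2 k).2 ⟨l3, l4⟩,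
      (label_eq_singleton_iff h3 k).2 ⟨l5, l6⟩⟩, ?_⟩
    rw [← hk]
    refine ⟨⟨h4, (labelLE_iff h4 h1).2 (l2 ▸ l7)⟩, ⟨h5, ?_⟩, fun h7 => (labelLT_iff h7).2 ?_⟩
    · rw [labelLE_iff h5 h1, not_le, l2]
      exact l8
    · rw [l2]
      exact h6.resolve_left (not_not.2 h7)

/-! ### Forcing -/

/-- The two arcs contributed by each path or correlated triangle are contrapositives of each other.
-/
theorem Aug.swap {x y : V × V} (h : G.Aug x y) : G.Aug y.swap x.swap := by
  rcases h with ⟨h | h⟩ | h | h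
  · exact .imp (.right h)
  · exact .imp (.left h)
  · exact .right h
  · exact .left h

theorem Forces.swap {x y : V × V} (h : G.Forces x y) : G.Forces y.swap x.swap := by
  induction h with
  | refl => exact .refl
  | tail _ h ih => exact .head h.swap ih

theorem Aug.adj {x y : V × V} (h : G.Aug x y) : G.graph.Adj x.1 x.2 ∧ G.graph.Adj y.1 y.2 := by
  rcases h with ⟨h | h⟩ | h | h
  · exact ⟨h.1, h.2.1.symm⟩
  · exact ⟨h.2.1, h.1.symm⟩
  all_goals obtain ⟨t, h, -⟩ := h
  · exact ⟨h.adj_bc, h.adj_ac⟩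
  · exact ⟨h.adj_ac.symm, h.adj_bc.symm⟩

theorem Forces.adj {x y : V × V} (h : G.Forces x y) (hx : G.graph.Adj x.1 x.2) :
    G.graph.Adj y.1 y.2 := by
  induction h with
  | refl => exact hx
  | tail _ h _ => exact h.adj.2

theorem Forces.mem {P : Set (V × V)} (hP : ∀ x ∈ P, ∀ y, G.Aug x y → y ∈ P) {x y : V × V}
    (h : G.Forces x y) (hx : x ∈ P) : y ∈ P := by
  induction h with
  | refl => exact hx
  | tail _ h ih => exact hP _ ih _ h

theorem IsAMTTO.asymm {O : Set (V × V)} (h : G.IsAMTTO O) {a b : V} (hab : (a, b) ∈ O) :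
    (b, a) ∉ O := fun hba => by
  have : (a, b) ∈ O ∩ Prod.swap '' O := ⟨hab, (b, a), hba, rfl⟩
  rw [h.inter_reverse] at this
  exact this

theorem IsAMTTO.total {O : Set (V × V)} (h : G.IsAMTTO O) {a b : V} (hab : G.graph.Adj a b) :
    (a, b) ∈ O ∨ (b, a) ∈ O := (h.orientation.exactly_one a b hab).or

theorem IsAMTTO.closed {O : Set (V × V)} (h : G.IsAMTTO O) :
    ∀ x ∈ O, ∀ y, G.Aug x y → y ∈ O := fun x hx y hxy => by
  rw [← h.forcedBy_eq]
  exact ⟨x, hx, .single hxy⟩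

theorem isAMTTO_of_closed {O : Set (V × V)} (adj : ∀ x ∈ O, G.graph.Adj x.1 x.2)
    (asymm : ∀ x ∈ O, x.swap ∉ O) (total : ∀ a b, G.graph.Adj a b → (a, b) ∈ O ∨ (b, a) ∈ O)
    (closed : ∀ x ∈ O, ∀ y, G.Aug x y → y ∈ O) : G.IsAMTTO O where
  orientation := ⟨fun a b h => adj _ h, fun a b h => by
    rcases total a b h with h | h
    · exact Or.inl ⟨h, asymm _ h⟩
    · exact Or.inr ⟨h, asymm _ h⟩⟩
  inter_reverse := by
    ext x
    simp only [Set.mem_inter_iff, Set.mem_empty_iff_false, iff_false]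
    rintro ⟨hx, y, hy, rfl⟩
    exact asymm _ hy hx
  forcedBy_eq := by
    ext y
    constructor
    · rintro ⟨x, hx, hxy⟩
      exact hxy.mem closed hx
    · exact fun hy => ⟨y, hy, .refl⟩

/-- The passage to the order-theoretic setting. A failure of `nc` is a conflict path with both arcs
in `O`, and then the first arc forces the reverse of the second. -/
theorem IsAMTTO.closedOrientation {O : Set (V × V)} (h : G.IsAMTTO O) :
    ClosedOrientation G.graph.Adj (fun a b => (a, b) ∈ O) G.lo G.hi where
  adj := h.orientation.adj _ _
  symm := SimpleGraph.Adj.symm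
  total := h.total
  asymm := h.asymm
  lo_comm := lo_comm
  hi_comm := hi_comm
  lo_le_hi := lo_le_hi
  nc {a b c} hab hbc := by
    by_contra hcon
    simp only [not_or, not_lt, not_and_or, not_le] at hcon
    have : G.Conflict a b c := conflict_iff.2 ⟨h.orientation.adj _ _ hab, h.orientation.adj _ _ hbc, hcon⟩
    exact h.asymm hbc (h.closed _ hab _ (.imp (.left this)))
  corr {a b c d} t h1 h2 h3 l1 l2 l3 l4 l5 l6 h4 l7 h5 l8 h6 hbc :=
    h.closed _ hbc _ (.left (isCorrelated_iff.2
      ⟨t, ⟨h1, h2, h3⟩, ⟨l1, l2, l3, l4, l5, l6⟩, ⟨h4, l7⟩, ⟨h5, l8⟩, h6⟩))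

/-! ### Cyclic triangles -/

/-- The arc `x` and the vertex `c` form a cyclic triangle. -/
def Closes (O : Set (V × V)) (x : V × V) (c : V) : Prop := (x.2, c) ∈ O ∧ (c, x.1) ∈ O

/-- An arc of `Aug` changes one endpoint of `x` in place. The four kinds of arcs are the four
pull-back lemmas, each of which re-orients the one side of the triangle that has changed. -/
theorem IsAMTTO.closes_of_aug {O : Set (V × V)} (h : G.IsAMTTO O) {x y : V × V} (hx : x ∈ O)
    (hxy : G.Aug x y) {z : V} (hz : Closes O y z) : Closes O x z := by
  have hy := h.closed x hx y hxy
  have hc := h.closedOrientation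
  rcases hxy with ⟨hh | hh⟩ | hh | hh
  · have := conflict_iff.1 hh
    exact ⟨hz.1, hc.back_left hy hz.1 hz.2 hx this.2.2.1 this.2.2.2⟩
  · have := conflict_iff.1 hh
    exact ⟨hc.back_right hy hz.1 hz.2 hx this.2.2.1 this.2.2.2, hz.2⟩
  all_goals obtain ⟨t, h1, h2, h3, h4, h5⟩ := isCorrelated_iff.1 hh
  · exact ⟨hz.1, hc.back_cor_left hy hz.1 hz.2 t h1.1 h2 hx h3.1 h3.2 h4.1 h4.2 h5⟩
  · exact ⟨hc.back_cor_right hy hz.1 hz.2 t h1.1 h2 hx h3.1 h3.2 h4.1 h4.2 h5, hz.2⟩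

theorem IsAMTTO.closes_of_forces {O : Set (V × V)} (h : G.IsAMTTO O) {x y : V × V} (hx : x ∈ O)
    (hxy : G.Forces x y) {z : V} (hz : Closes O y z) : Closes O x z := by
  induction hxy with
  | refl => exact hz
  | tail h1 h2 ih => exact ih (h.closes_of_aug (Forces.mem h.closed h1 hx) h2 hz)

/-- The condition `nc` gives the edge `ac` with the required labels, and the absence of cyclic
triangles gives its direction. -/
theorem IsAMTTO.isMTTO {O : Set (V × V)} (h : G.IsAMTTO O)
    (hcyc : ∀ x ∈ O, ∀ c, ¬ Closes O x c) : G.IsMTTO O where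
  orientation := h.orientation
  transitive a b c hab hbc hle := by
    have h1 := h.orientation.adj _ _ hab
    have h2 := h.orientation.adj _ _ hbc
    rw [labelLE_iff h1 h2] at hle
    obtain ⟨h3, h4⟩ := (h.closedOrientation.nc hab hbc).resolve_left (not_lt.2 hle)
    rw [labelLT_iff h3, not_lt]
    exact ⟨(h.total h3).resolve_right fun hca => hcyc _ hab c ⟨hbc, hca⟩, h4⟩

theorem IsMTTO.transitive' {O : Set (V × V)} (h : G.IsMTTO O) {a b c : V} (hab : (a, b) ∈ O)
    (hbc : (b, c) ∈ O) (hle : G.lo a b ≤ G.hi b c) : (a, c) ∈ O ∧ G.hi b c ≤ G.lo a c := by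
  have h1 := h.orientation.adj _ _ hab
  have h2 := h.orientation.adj _ _ hbc
  obtain ⟨h3, h4⟩ := h.transitive a b c hab hbc ((labelLE_iff h1 h2).2 hle)
  rw [labelLT_iff (h.orientation.adj _ _ h3), not_lt] at h4
  exact ⟨h3, h4⟩

theorem IsMTTO.asymm {O : Set (V × V)} (h : G.IsMTTO O) {a b : V} (hab : (a, b) ∈ O) :
    (b, a) ∉ O := fun hba => by
  rcases h.orientation.exactly_one a b (h.orientation.adj _ _ hab) with hx | hx
  · exact hx.2 hba
  · exact hx.2 hab

theorem IsMTTO.total {O : Set (V × V)} (h : G.IsMTTO O) {a b : V} (hab : G.graph.Adj a b) :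
    (a, b) ∈ O ∨ (b, a) ∈ O := (h.orientation.exactly_one a b hab).or

/-- Suppose `c` points to `a`. Then b → c → a gives b → a, and d → b is impossible, since d → b → a
would demand an edge `da` with no early label. So b → d, and both directions of `cd` bound its
labels by `t` through transitivity at a path starting in `b`. -/
theorem IsMTTO.not_correlated {O : Set (V × V)} (h : G.IsMTTO O) {a b c d : V}
    (hc : G.IsCorrelated a b c d) (hbc : (b, c) ∈ O) : (a, c) ∈ O := by
  obtain ⟨t, h1, h2, h3, h4, h5⟩ := isCorrelated_iff.1 hc
  refine (h.total h1.2.2).resolve_right fun hca => ?_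
  have := lo_comm (G := G)
  have := hi_comm (G := G)
  have hba := h.transitive' hbc hca (by grind)
  have := lo_le_hi h4.1
  have hbd : (b, d) ∈ O := by
    refine (h.total h3.1).resolve_right fun hdb => ?_
    obtain ⟨hda, hda'⟩ := h.transitive' hdb hba.1 (by grind)
    have := (h.orientation.adj _ _ hda).symm
    grind
  rcases h.total h4.1 with hcd | hdc
  · obtain ⟨k, k'⟩ := h.transitive' hbc hcd (by grind)
    grind
  · obtain ⟨k, k'⟩ := h.transitive' hbd hdc (by grind)
    grind

theorem IsMTTO.isAMTTO {O : Set (V × V)} (h : G.IsMTTO O) : G.IsAMTTO O := by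
  refine isAMTTO_of_closed (fun x hx => h.orientation.adj _ _ hx) (fun x hx => h.asymm hx)
    (fun a b => h.total) fun x hx y hxy => ?_
  have key {a b c : V} (hc : G.Conflict a b c) (hab : (a, b) ∈ O) (hbc : (b, c) ∈ O) : False := by
    obtain ⟨h1, h2, h3, h4⟩ := conflict_iff.1 hc
    obtain ⟨h5, h6⟩ := h.transitive' hab hbc h3
    exact h4.elim (· (h.orientation.adj _ _ h5)) (not_lt.2 h6)
  rcases hxy with ⟨hh | hh⟩ | hh | hh
  · exact (h.total hh.2.1).resolve_left fun hbc => key hh hx hbc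
  · exact (h.total hh.1).resolve_left fun hab => key hh hab hx
  · exact h.not_correlated hh hx
  · obtain ⟨t, h1, -⟩ := id hh
    exact (h.total h1.adj_bc.symm).resolve_right fun hbc => h.asymm hx (h.not_correlated hh hbc)

/-! ### Necessary arcs -/

/-- By contraposition, the reverse of `y` forces the reverse of `x`, which forces `x`, which forces
`y`. -/
theorem mem_ness_of_forces {x y : V × V} (hx : x ∈ G.ness) (h : G.Forces x y) : y ∈ G.ness :=
  ⟨h.adj hx.1, h.swap.trans (hx.2.trans h)⟩

theorem IsAMTTO.ness_subset {O : Set (V × V)} (h : G.IsAMTTO O) : G.ness ⊆ O := fun _ hx =>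
  (h.total hx.1).elim id fun hs => hx.2.mem h.closed hs

theorem exists_crossing {O : Set (V × V)} {x y : V × V} (h : G.Forces x y) (hx : x ∉ O)
    (hy : y ∈ O) : ∃ p q, G.Forces x p ∧ p ∉ O ∧ G.Aug p q ∧ q ∈ O ∧ G.Forces q y := by
  induction h with
  | refl => exact absurd hy hx
  | @tail b c h1 h2 ih =>
    by_cases hb : b ∈ O
    · obtain ⟨p, q, k1, k2, k3, k4, k5⟩ := ih hb
      exact ⟨p, q, k1, k2, k3, k4, k5.tail h2⟩
    · exact ⟨b, c, h1, hb, h2, hy, .refl⟩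

/-- The path from the reverse of `x` to `x` enters `O` at some arc from `p` to `q`. Both `q` and the
reverse of `p` lie in `O` and force `x`, so a cyclic triangle of `x` pulls back to both with the
same third vertex `c`. But `p` and `q` share an endpoint in the same position, so the edge between
it and `c` would be oriented both ways. -/
theorem IsAMTTO.not_closes_of_mem_ness {O : Set (V × V)} (h : G.IsAMTTO O) {x : V × V}
    (hx : x ∈ G.ness) (c : V) : ¬ Closes O x c := fun hc => by
  have hxO := h.ness_subset hx
  obtain ⟨p, q, k1, k2, k3, k4, k5⟩ := exists_crossing hx.2 (h.asymm hxO) hxO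
  have hp : p.swap ∈ O := (h.total (k1.adj hx.1.symm)).resolve_left k2
  have c1 := h.closes_of_forces k4 k5 hc
  have c2 := h.closes_of_forces hp k1.swap hc
  rcases k3 with ⟨hh | hh⟩ | hh | hh
  · exact h.asymm c1.1 c2.2
  · exact h.asymm c1.2 c2.1
  · exact h.asymm c1.1 c2.2
  · exact h.asymm c1.2 c2.1

/-- The arcs of an orientation that lie in no cyclic triangle. -/
def steady (O : Set (V × V)) : Set (V × V) := {x | x ∈ O ∧ ∀ c, ¬ Closes O x c}

theorem IsAMTTO.ness_subset_steady {O : Set (V × V)} (h : G.IsAMTTO O) : G.ness ⊆ steady O :=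
  fun _ hx => ⟨h.ness_subset hx, h.not_closes_of_mem_ness hx⟩

/-- Take an arc p → q whose `hi` is maximal among the arcs on steady cycles, and follow the cycle
backwards from `p`. Every vertex `x` on the way points to `q` with an edge at least as late, until
`q` would be adjacent to itself. -/
theorem IsAMTTO.steady_acyclic {O : Set (V × V)} (h : G.IsAMTTO O)
    (hfin : {p : V × V | G.graph.Adj p.1 p.2}.Finite) (v : V) :
    ¬ Relation.TransGen (fun x y => (x, y) ∈ steady O) v v := fun hv => by
  have hc := h.closedOrientation
  set R : V → V → Prop := fun x y => (x, y) ∈ steady O with hR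
  let S : Set (V × V) := {p | R p.1 p.2 ∧ Relation.ReflTransGen R p.2 p.1}
  have hS : S.Finite := hfin.subset fun p hp => h.orientation.adj _ _ hp.1.1
  have hne : S.Nonempty := by
    obtain ⟨w, h1, h2⟩ := Relation.TransGen.head'_iff.1 hv
    exact ⟨(v, w), h1, h2⟩
  obtain ⟨⟨p, q⟩, ⟨hpq, hqp⟩, hmax⟩ := hS.exists_maximalFor (fun p => G.hi p.1 p.2) S hne
  have key : ∀ x, Relation.ReflTransGen R x p → Relation.ReflTransGen R q x →
      (x, q) ∈ O ∧ G.hi p q ≤ G.hi x q := by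
    intro x hx
    induction hx using Relation.ReflTransGen.head_induction_on with
    | refl => exact fun _ => ⟨hpq.1, le_rfl⟩
    | @head x y hxy hyp ih =>
      intro hqx
      obtain ⟨k1, k2⟩ := ih (hqx.tail hxy)
      -- Maximality makes `nc` at x → y → q yield an edge `xq`; it points to `q`, as otherwise the
      -- steady arc `xy` would lie in a cyclic triangle.
      have hm : G.hi x y ≤ G.hi p q := by
        by_contra hlt
        exact hlt (hmax (j := (x, y)) ⟨hxy, hyp.trans (.head hpq hqx)⟩ (not_le.1 hlt).le)
      have hlo := lo_le_hi (h.orientation.adj _ _ hxy.1)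
      obtain ⟨k3, k4⟩ := (hc.nc hxy.1 k1).resolve_left (not_lt.2 (hlo.trans (hm.trans k2)))
      exact ⟨(h.total k3).resolve_right fun hqx => hxy.2 q ⟨k1, hqx⟩,
        k2.trans (k4.trans (lo_le_hi k3))⟩
  exact G.graph.loopless.irrefl q (h.orientation.adj _ _ (key q hqp .refl).1)

theorem IsMTTO.nessAcyclic {O : Set (V × V)} (h : G.IsMTTO O)
    (hfin : {p : V × V | G.graph.Adj p.1 p.2}.Finite) : G.NessAcyclic := fun v hv =>
  h.isAMTTO.steady_acyclic hfin v (Relation.TransGen.mono (fun _ _ hx => h.isAMTTO.ness_subset_steady hx) v v hv)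

/-! ### Partial orientations -/

/-- A consistent set of arcs that contains all arcs that it forces. -/
structure IsPartial (G : MultilabelTemporalGraph V) (P : Set (V × V)) : Prop where
  adj : ∀ x ∈ P, G.graph.Adj x.1 x.2
  asymm : ∀ x ∈ P, x.swap ∉ P
  closed : ∀ x ∈ P, ∀ y, G.Aug x y → y ∈ P

/-- A partial orientation none of whose arcs can get into a cyclic triangle. -/
structure IsSolid (G : MultilabelTemporalGraph V) (P : Set (V × V)) : Prop extends
    G.IsPartial P where
  not_closes : ∀ O, G.IsAMTTO O → P ⊆ O → ∀ x ∈ P, ∀ c, ¬ Closes O x c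

theorem IsPartial.isAMTTO {P : Set (V × V)} (h : G.IsPartial P)
    (full : ∀ a b, G.graph.Adj a b → (a, b) ∈ P ∨ (b, a) ∈ P) : G.IsAMTTO P :=
  isAMTTO_of_closed h.adj h.asymm full h.closed

theorem IsSolid.isMTTO {P : Set (V × V)} (h : G.IsSolid P)
    (full : ∀ a b, G.graph.Adj a b → (a, b) ∈ P ∨ (b, a) ∈ P) : G.IsMTTO P :=
  have h' := h.isAMTTO full
  h'.isMTTO (h.not_closes P h' subset_rfl)

/-- If `x` forced the reverse of some `z ∈ P`, then `z` would force the reverse of `x`, which would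
lie in `P`. So conflicts arise only within the arcs forced by `x`, and those amount to `x` forcing
its reverse. -/
theorem IsPartial.extend {P : Set (V × V)} (h : G.IsPartial P) {x : V × V}
    (hx : G.graph.Adj x.1 x.2) (hs : x.swap ∉ P) (hn : ¬ G.Forces x x.swap) :
    G.IsPartial (P ∪ {y | G.Forces x y}) where
  adj y hy := hy.elim (h.adj y) fun hy => Forces.adj hy hx
  asymm y hy := by
    have key : ∀ z ∈ P, ¬ G.Forces x z.swap := fun z hz hxz => by
      have := hxz.swap
      rw [Prod.swap_swap] at this
      exact hs (this.mem h.closed hz)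
    rintro (hy' | hy') <;> rcases hy with hy | hy
    · exact h.asymm y hy hy'
    · exact key _ hy' (by rwa [Prod.swap_swap])
    · exact key y hy hy'
    · have := Forces.swap hy'
      rw [Prod.swap_swap] at this
      exact hn (Relation.ReflTransGen.trans hy this)
  closed y hy z hyz := hy.elim (fun hy => Or.inl (h.closed y hy z hyz)) fun hy =>
    Or.inr (Relation.ReflTransGen.tail hy hyz)

/-- Quantifying over all AMTTOs that contain the set lets solidity be proved for an unfinished
orientation, one vertex at a time. -/
theorem IsSolid.round {P Q : Set (V × V)} (hP : G.IsSolid P) (hQ : G.IsPartial Q) (hPQ : P ⊆ Q)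
    {u : V} (forced : ∀ x ∈ Q, x ∈ P ∨ ∃ v, (u, v) ∈ Q ∧ G.Forces (u, v) x)
    (full : ∀ v, G.graph.Adj u v → (u, v) ∈ Q ∨ (v, u) ∈ Q) : G.IsSolid Q where
  toIsPartial := hQ
  not_closes O hO hQO x hx c hc := by
    rcases forced x hx with hx | ⟨v, hv, hvx⟩
    · exact hP.not_closes O hO (hPQ.trans hQO) x hx c hc
    -- Pulling back moves the cyclic triangle to u → v → c → u.
    have huv := hO.closes_of_forces (hQO hv) hvx hc
    have hcu : (c, u) ∈ Q := (full c (hO.orientation.adj _ _ huv.2).symm).resolve_left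
      fun huc => hO.asymm (hQO huc) huv.2
    have hcyc : Closes O (c, u) v := ⟨hQO hv, huv.1⟩
    rcases forced _ hcu with hcu | ⟨w, hw, hwc⟩
    · exact hP.not_closes O hO (hPQ.trans hQO) _ hcu v hcyc
    -- If `(c, u)` is forced by `(u, w)`, pulling back with third vertex `v` puts `(v, u)` into `O`.
    · exact hO.asymm (hQO hv) (hO.closes_of_forces (hQO hw) hwc hcyc).2

theorem exists_maximal_of_adj (hfin : {p : V × V | G.graph.Adj p.1 p.2}.Finite)
    (F : Set (V × V) → Prop) (hF : ∀ P, F P → ∀ x ∈ P, G.graph.Adj x.1 x.2) {P : Set (V × V)}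
    (hP : F P) : ∃ Q, F Q ∧ ∀ R, F R → Q ⊆ R → R ⊆ Q := by
  have : {P | F P}.Finite := hfin.finite_subsets.subset fun P hP x hx => hF P hP x hx
  obtain ⟨Q, hQ⟩ := this.exists_maximal ⟨P, hP⟩
  exact ⟨Q, hQ.1, fun R hR hQR => hQ.2 hR hQR⟩

/-- Only the absence of cycles of length two is needed: an edge left undecided by a maximal partial
orientation has both of its arcs in `Ness`. -/
theorem NessAcyclic.exists_isAMTTO (h : G.NessAcyclic)
    (hfin : {p : V × V | G.graph.Adj p.1 p.2}.Finite) : ∃ O, G.IsAMTTO O := by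
  obtain ⟨P, hP, hmax⟩ := exists_maximal_of_adj hfin G.IsPartial (fun P hP => hP.adj)
    (P := ∅) ⟨by simp, by simp, by simp⟩
  refine ⟨P, hP.isAMTTO fun a b hab => ?_⟩
  by_contra hcon
  rw [not_or] at hcon
  have key (x : V × V) (hx : G.graph.Adj x.1 x.2) (h1 : x ∉ P) (h2 : x.swap ∉ P) :
      G.Forces x x.swap := by
    by_contra hn
    exact h1 (hmax _ (hP.extend hx h2 hn) Set.subset_union_left (Or.inr .refl))
  have h1 := key (a, b) hab hcon.1 hcon.2
  have h2 := key (b, a) hab.symm hcon.2 hcon.1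
  exact h a (.tail (.single ⟨hab, h2⟩) ⟨hab.symm, h1⟩)

theorem IsAMTTO.isSolid_ness {O : Set (V × V)} (h : G.IsAMTTO O) : G.IsSolid G.ness where
  adj _ hx := hx.1
  asymm _ hx hs := h.asymm (h.ness_subset hx) (h.ness_subset hs)
  closed _ hx _ hxy := mem_ness_of_forces hx (.single hxy)
  not_closes _ hO _ _ hx := hO.not_closes_of_mem_ness hx

/-- Maximality over solid sets replaces the iteration over vertices, and maximality over the sets
`Q` replaces the saturation at one vertex `u`. Keeping `Ness` inside ensures that no undecided arc
forces its reverse. -/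
theorem IsAMTTO.isTComparability {O : Set (V × V)} (h : G.IsAMTTO O)
    (hfin : {p : V × V | G.graph.Adj p.1 p.2}.Finite) : G.IsTComparability := by
  obtain ⟨P, ⟨hP, hness⟩, hmax⟩ := exists_maximal_of_adj hfin
    (fun P => G.IsSolid P ∧ G.ness ⊆ P) (fun P hP => hP.1.adj) ⟨h.isSolid_ness, subset_rfl⟩
  refine ⟨P, hP.isMTTO fun u v huv => ?_⟩
  obtain ⟨Q, ⟨hQ, hPQ, hforced⟩, hQmax⟩ := exists_maximal_of_adj hfin
    (fun Q => G.IsPartial Q ∧ P ⊆ Q ∧ ∀ x ∈ Q, x ∈ P ∨ ∃ v, (u, v) ∈ Q ∧ G.Forces (u, v) x)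
    (fun Q hQ => hQ.1.adj) ⟨hP.toIsPartial, subset_rfl, fun x hx => Or.inl hx⟩
  have full : ∀ w, G.graph.Adj u w → (u, w) ∈ Q ∨ (w, u) ∈ Q := fun w huw => by
    by_contra hcon
    rw [not_or] at hcon
    have hn : ¬ G.Forces (u, w) (w, u) := fun hf =>
      hcon.2 (hPQ (hness ⟨huw.symm, hf⟩))
    refine hcon.1 (hQmax _ ⟨hQ.extend (x := (u, w)) huw hcon.2 hn,
      hPQ.trans Set.subset_union_left, ?_⟩ Set.subset_union_left (Or.inr .refl))
    rintro x (hx | hx)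
    · exact (hforced x hx).imp_right fun ⟨v, h1, h2⟩ => ⟨v, Or.inl h1, h2⟩
    · exact Or.inr ⟨w, Or.inr .refl, hx⟩
  have := hmax Q ⟨hP.round hQ hPQ hforced full, hness.trans hPQ⟩ hPQ
  exact (full v huv).imp (this ·) (this ·)

theorem tfae_isTComparability [Finite V] (G : MultilabelTemporalGraph V) :
    List.TFAE [G.IsTComparability, ∃ O : Set (V × V), G.IsAMTTO O, G.NessAcyclic] := by
  have hfin := Set.toFinite {p : V × V | G.graph.Adj p.1 p.2}
  tfae_have 1 → 3 := fun ⟨O, hO⟩ => hO.nessAcyclic hfin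
  tfae_have 3 → 2 := fun h => h.exists_isAMTTO hfin
  tfae_have 2 → 1 := fun ⟨O, hO⟩ => hO.isTComparability hfin
  tfae_finish

end MultilabelTemporalGraph

namespace RAM

/-! ### Reasoning about random access programs -/

/-- The registers that a program may write. -/
def Program.regs : Program → List ℕ
  | .skip => []
  | .assign x _ => [x]
  | .store _ _ _ => []
  | .seq p q => p.regs ++ q.regs
  | .ite _ p q => p.regs ++ q.regs
  | .loop _ p => p.regs

/-- The arrays that a program may write. -/
def Program.arrs : Program → List ℕ
  | .skip => []
  | .assign _ _ => []
  | .store a _ _ => [a]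
  | .seq p q => p.arrs ++ q.arrs
  | .ite _ p q => p.arrs ++ q.arrs
  | .loop _ p => p.arrs

/-- The states `s` and `s'` differ in the registers `R` and the arrays `A` only. -/
def Frame (R A : List ℕ) (s s' : State) : Prop :=
  (∀ x, x ∉ R → s'.reg x = s.reg x) ∧ ∀ a, a ∉ A → s'.mem a = s.mem a

theorem Frame.refl (R A : List ℕ) (s : State) : Frame R A s s := ⟨fun _ _ => rfl, fun _ _ => rfl⟩

theorem Frame.trans {R A : List ℕ} {s s' s'' : State} (h : Frame R A s s') (h' : Frame R A s' s'') :
    Frame R A s s'' :=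
  ⟨fun x hx => (h'.1 x hx).trans (h.1 x hx), fun a ha => (h'.2 a ha).trans (h.2 a ha)⟩

theorem Frame.mono {R A R' A' : List ℕ} {s s' : State} (h : Frame R A s s') (hR : R ⊆ R')
    (hA : A ⊆ A') : Frame R' A' s s' :=
  ⟨fun x hx => h.1 x fun h => hx (hR h), fun a ha => h.2 a fun h => ha (hA h)⟩

theorem Frame.setReg {R A : List ℕ} {s s' : State} (h : Frame R A s s') {i : ℕ} (hi : i ∈ R)
    (v : ℕ) : Frame R A s (s'.setReg i v) :=
  ⟨fun x hx => by
    have : x ≠ i := fun h => hx (h ▸ hi)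
    simp [State.setReg, this, h.1 x hx], h.2⟩

theorem Exec.frame {p : Program} {s s' : State} {t : ℕ} (h : Exec p s s' t) :
    Frame p.regs p.arrs s s' := by
  induction h with
  | skip => exact .refl _ _ _
  | assign => exact ⟨fun y hy => by simp_all [Program.regs, State.setReg], fun _ _ => rfl⟩
  | store => exact ⟨fun _ _ => rfl, fun b hb => by simp_all [Program.arrs, State.setMem]⟩
  | seq _ _ ih ih' =>
    exact (ih.mono (by simp [Program.regs]) (by simp [Program.arrs])).trans
      (ih'.mono (by simp [Program.regs]) (by simp [Program.arrs]))
  | ite_true _ _ ih => exact ih.mono (by simp [Program.regs]) (by simp [Program.arrs])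
  | ite_false _ _ ih => exact ih.mono (by simp [Program.regs]) (by simp [Program.arrs])
  | loop_true _ _ _ ih ih' => exact Frame.trans ih ih'
  | loop_false => exact .refl _ _ _

/-- Started in `s`, the program halts in a state and after a time that satisfy `Q`. -/
def Run (p : Program) (s : State) (Q : State → ℕ → Prop) : Prop := ∃ s' t, Exec p s s' t ∧ Q s' t

/-- The frame comes for free with every run, so that specifications need to mention only what
changes. -/
theorem Run.mono {p : Program} {s : State} {Q Q' : State → ℕ → Prop} (h : Run p s Q)
    (hQ : ∀ s' t, Frame p.regs p.arrs s s' → Q s' t → Q' s' t) : Run p s Q' :=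
  let ⟨s', t, h1, h2⟩ := h
  ⟨s', t, h1, hQ s' t h1.frame h2⟩

/-- The rules for all constructs but loops are equivalences and serve as rewrite rules. -/
theorem run_skip {s : State} {Q : State → ℕ → Prop} : Run .skip s Q ↔ Q s 1 := by
  constructor
  · rintro ⟨s', t, ⟨⟩, h⟩
    exact h
  · exact fun h => ⟨_, _, .skip, h⟩

theorem run_assign {x : ℕ} {e : Expr} {s : State} {Q : State → ℕ → Prop} :
    Run (.assign x e) s Q ↔ Q (s.setReg x (e.eval s)) (e.cost + 1) := by
  constructor
  · rintro ⟨s', t, ⟨⟩, h⟩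
    exact h
  · exact fun h => ⟨_, _, .assign, h⟩

theorem run_store {a : ℕ} {i e : Expr} {s : State} {Q : State → ℕ → Prop} :
    Run (.store a i e) s Q ↔ Q (s.setMem a (i.eval s) (e.eval s)) (i.cost + e.cost + 1) := by
  constructor
  · rintro ⟨s', t, ⟨⟩, h⟩
    exact h
  · exact fun h => ⟨_, _, .store, h⟩

theorem run_seq {p q : Program} {s : State} {Q : State → ℕ → Prop} :
    Run (.seq p q) s Q ↔ Run p s fun s' t => Run q s' fun s'' t' => Q s'' (t + t') := by
  constructor
  · rintro ⟨s', t, ⟨⟩, h⟩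
    exact ⟨_, _, ‹Exec p _ _ _›, _, _, ‹Exec q _ _ _›, h⟩
  · rintro ⟨s', t, hp, s'', t', hq, h⟩
    exact ⟨_, _, .seq hp hq, h⟩

theorem run_ite {b : Test} {p q : Program} {s : State} {Q : State → ℕ → Prop} :
    Run (.ite b p q) s Q ↔ (b.holds s → Run p s fun s' t => Q s' (b.cost + 1 + t)) ∧
      (¬ b.holds s → Run q s fun s' t => Q s' (b.cost + 1 + t)) := by
  constructor
  · rintro ⟨s', t, hh, h⟩
    cases hh with
    | ite_true hb hp => exact ⟨fun _ => ⟨_, _, hp, h⟩, fun hn => absurd hb hn⟩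
    | ite_false hb hp => exact ⟨fun hn => absurd hn hb, fun _ => ⟨_, _, hp, h⟩⟩
  · rintro ⟨h, h'⟩
    by_cases hb : b.holds s
    · obtain ⟨s', t, hp, hQ⟩ := h hb
      exact ⟨_, _, .ite_true hb hp, hQ⟩
    · obtain ⟨s', t, hp, hQ⟩ := h' hb
      exact ⟨_, _, .ite_false hb hp, hQ⟩

/-- Sequential composition, with the frame of the first program. -/
theorem Run.seq {p q : Program} {s : State} {Q Q' : State → ℕ → Prop} (h : Run p s Q)
    (h' : ∀ s' t, Frame p.regs p.arrs s s' → Q s' t → Run q s' fun s'' t' => Q' s'' (t + t')) :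
    Run (.seq p q) s Q' := run_seq.2 (h.mono h')

/-- The rule for loops; the time that has passed is an argument of the invariant. -/
theorem Run.loop {b : Test} {p : Program} {s₀ : State} (Inv : State → ℕ → Prop) (μ : State → ℕ)
    (h0 : Inv s₀ 0)
    (step : ∀ s T, Frame p.regs p.arrs s₀ s → b.holds s → Inv s T →
      Run p s fun s' t => Inv s' (T + (b.cost + 1 + t)) ∧ μ s' < μ s) :
    Run (.loop b p) s₀ fun s' t => ¬ b.holds s' ∧ ∃ T, Inv s' T ∧ t = T + (b.cost + 1) := by
  suffices H : ∀ k s T, μ s = k → Frame p.regs p.arrs s₀ s → Inv s T →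
      Run (.loop b p) s fun s' t => ¬ b.holds s' ∧ ∃ T', Inv s' T' ∧ T + t = T' + (b.cost + 1) by
    obtain ⟨s', t, h1, h2, T', h3, h4⟩ := H _ s₀ 0 rfl (.refl _ _ _) h0
    exact ⟨s', t, h1, h2, T', h3, by omega⟩
  intro k
  induction k using Nat.strong_induction_on with
  | _ k ih =>
    intro s T hk hf hI
    by_cases hb : b.holds s
    · obtain ⟨s', t, h1, h2, h3⟩ := step s T hf hb hI
      obtain ⟨s'', t', h4, h5, T', h6, h7⟩ := ih _ (hk ▸ h3) s' _ rfl (hf.trans h1.frame) h2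
      exact ⟨s'', _, .loop_true hb h1 h4, h5, T', h6, by omega⟩
    · exact ⟨s, _, .loop_false hb, hb, T, hI, rfl⟩

/-- Execute `p` for `i = 0, …, reg r - 1`. -/
def forLoop (i r : ℕ) (p : Program) : Program :=
  .seq (.assign i (.lit 0))
    (.loop (.lt (.reg i) (.reg r)) (.seq p (.assign i (.add (.reg i) (.lit 1)))))

/-- The rule for counting loops; the time that has passed is an argument of the invariant. -/
theorem Run.forLoop {i r : ℕ} {p : Program} {s₀ : State} {N : ℕ} (Inv : ℕ → State → ℕ → Prop)
    (hN : s₀.reg r = N) (hir : r ≠ i) (hi : i ∉ p.regs) (hr : r ∉ p.regs) (h0 : Inv 0 s₀ 0)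
    (stable : ∀ k s T v, Inv k s T → Inv k (s.setReg i v) T)
    (step : ∀ k s T, k < N → s.reg i = k → Frame (i :: p.regs) p.arrs s₀ s → Inv k s T →
      Run p s fun s' t => Inv (k + 1) s' (T + t + 8)) :
    Run (forLoop i r p) s₀ fun s' t => ∃ T, Inv N s' T ∧ t = T + 6 := by
  unfold RAM.forLoop
  rw [run_seq, run_assign]
  have hloop := Run.loop (b := .lt (.reg i) (.reg r))
    (p := .seq p (.assign i (.add (.reg i) (.lit 1)))) (s₀ := s₀.setReg i ((Expr.lit 0).eval s₀))
    (fun s T => s.reg i ≤ N ∧ s.reg r = N ∧ Frame (i :: p.regs) p.arrs s₀ s ∧ Inv (s.reg i) s T)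
    (fun s => N - s.reg i) ?_ ?_
  · refine hloop.mono fun s t _ ⟨h1, T, ⟨h2, h3, _, h4⟩, h5⟩ => ⟨T, ?_, ?_⟩
    · simp only [Test.holds, Expr.eval, h3] at h1
      rwa [show s.reg i = N by omega] at h4
    · simp only [h5, Expr.cost, Test.cost]
      omega
  · refine ⟨by simp [State.setReg, Expr.eval], by simpa [State.setReg, hir] using hN,
      (Frame.refl _ _ _).setReg (by simp) _, ?_⟩
    simpa [State.setReg, Expr.eval] using stable _ _ _ 0 h0
  · rintro s T - hb ⟨h1, h2, h3, h4⟩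
    simp only [Test.holds, Expr.eval, h2] at hb
    refine (step _ s T hb rfl h3 h4).seq fun s' t hf h => ?_
    have hri : s'.reg i = s.reg i := hf.1 i hi
    have hrr : s'.reg r = s.reg r := hf.1 r hr
    rw [run_assign]
    -- One pass costs 4 for the test and 4 for the increment, besides the body; this is the constant
    -- 8 in the rule.
    simp only [Expr.eval, Test.cost, Expr.cost]
    refine ⟨⟨?_, ?_, ?_, ?_⟩, ?_⟩
    · simp [State.setReg, hri]
      omega
    · simp [State.setReg, hir, hrr, h2]
    · exact (h3.trans (hf.mono (by simp) (by simp))).setReg (by simp) _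
    · have := stable _ _ _ (s'.reg i + 1) h
      rw [hri] at this ⊢
      simpa [State.setReg, add_assoc, add_comm, add_left_comm] using this
    · simp [State.setReg, hri]
      omega

/-- The rule for counting loops all of whose passes take time at most `c`. -/
theorem Run.forLoop_le {i r : ℕ} {p : Program} {s₀ : State} {N : ℕ} (c : ℕ)
    (Inv : ℕ → State → Prop)
    (hN : s₀.reg r = N) (hir : r ≠ i) (hi : i ∉ p.regs) (hr : r ∉ p.regs) (h0 : Inv 0 s₀)
    (stable : ∀ k s v, Inv k s → Inv k (s.setReg i v))
    (step : ∀ k s, k < N → s.reg i = k → Frame (i :: p.regs) p.arrs s₀ s → Inv k s →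
      Run p s fun s' t => Inv (k + 1) s' ∧ t ≤ c) :
    Run (RAM.forLoop i r p) s₀ fun s' t => Inv N s' ∧ t ≤ (c + 8) * N + 6 := by
  refine (Run.forLoop (fun k s T => Inv k s ∧ T ≤ (c + 8) * k) hN hir hi hr ⟨h0, by simp⟩
    (fun k s T v h => ⟨stable k s v h.1, h.2⟩) fun k s T hk hi hf h => ?_).mono ?_
  · refine (step k s hk hi hf h.1).mono fun s' t _ h' => ⟨h'.1, ?_⟩
    have := h.2
    have := h'.2
    rw [mul_add, mul_one]
    omega
  · rintro s' t - ⟨T, ⟨h1, h2⟩, rfl⟩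
    exact ⟨h1, by omega⟩

theorem reg_setReg (s : State) (x v y : ℕ) :
    (s.setReg x v).reg y = if y = x then v else s.reg y := by
  simp [State.setReg, Function.update_apply]

theorem mem_setReg (s : State) (x v : ℕ) : (s.setReg x v).mem = s.mem := rfl

theorem reg_setMem (s : State) (a i v : ℕ) : (s.setMem a i v).reg = s.reg := rfl

theorem mem_setMem (s : State) (a i v b j : ℕ) :
    (s.setMem a i v).mem b j = if b = a ∧ j = i then v else s.mem b j := by
  by_cases h : b = a
  · subst h
    simp [State.setMem, Function.update_apply]
  · simp [State.setMem, h]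

end RAM

namespace MultilabelTemporalGraph

/-! ### Graphs on the natural numbers -/

/-- The graph `H` on natural numbers has the `m` edges `tl j, hd j` between numbers below `n`,
and `lw` and `up` are the earliest and the latest labels of its edges. -/
structure Net (H : MultilabelTemporalGraph ℕ) (n m : ℕ) (tl hd : ℕ → ℕ) (lw up : ℕ → ℕ → ℕ) :
    Prop where
  tl_lt : ∀ j < m, tl j < n
  hd_lt : ∀ j < m, hd j < n
  adj_iff : ∀ a b, H.graph.Adj a b ↔ ∃ j < m, tl j = a ∧ hd j = b ∨ tl j = b ∧ hd j = a
  inj : ∀ i < m, ∀ j < m, tl i = tl j ∧ hd i = hd j ∨ tl i = hd j ∧ hd i = tl j → i = j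
  isLeast : ∀ a b, H.graph.Adj a b → IsLeast (H.label s(a, b)) (lw a b)
  isGreatest : ∀ a b, H.graph.Adj a b → IsGreatest (H.label s(a, b)) (up a b)

namespace Net

variable {H : MultilabelTemporalGraph ℕ} {n m : ℕ} {tl hd : ℕ → ℕ} {lw up : ℕ → ℕ → ℕ}
  (N : Net H n m tl hd lw up)

include N

theorem adj_edge {j : ℕ} (hj : j < m) : H.graph.Adj (tl j) (hd j) :=
  (N.adj_iff _ _).2 ⟨j, hj, Or.inl ⟨rfl, rfl⟩⟩

theorem lt_left {a b : ℕ} (h : H.graph.Adj a b) : a < n := by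
  obtain ⟨j, hj, ⟨rfl, -⟩ | ⟨-, rfl⟩⟩ := (N.adj_iff _ _).1 h
  exacts [N.tl_lt j hj, N.hd_lt j hj]

theorem lt_right {a b : ℕ} (h : H.graph.Adj a b) : b < n := N.lt_left h.symm

theorem lo_eq {a b : ℕ} (h : H.graph.Adj a b) : H.lo a b = lw a b := by
  rw [lo, (N.isLeast a b h).csInf_eq]

theorem hi_eq {a b : ℕ} (h : H.graph.Adj a b) : H.hi a b = up a b := by
  refine le_antisymm (iSup₂_le fun x hx => ?_) ?_
  · exact Nat.cast_le.2 ((N.isGreatest a b h).2 hx)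
  · exact le_iSup₂_of_le (f := fun (y : ℕ) (_ : y ∈ H.label s(a, b)) => (y : ℕ∞)) _
      (N.isGreatest a b h).1 le_rfl

theorem lw_comm {a b : ℕ} (h : H.graph.Adj a b) : lw a b = lw b a := by
  have := lo_comm (G := H) a b
  rwa [N.lo_eq h, N.lo_eq h.symm, Nat.cast_inj] at this

theorem up_comm {a b : ℕ} (h : H.graph.Adj a b) : up a b = up b a := by
  have := hi_comm (G := H) a b
  rwa [N.hi_eq h, N.hi_eq h.symm, Nat.cast_inj] at this

theorem conflict_iff {a b c : ℕ} : H.Conflict a b c ↔ H.graph.Adj a b ∧ H.graph.Adj b c ∧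
    lw a b ≤ up b c ∧ (¬ H.graph.Adj a c ∨ lw a c < up b c) := by
  rw [MultilabelTemporalGraph.conflict_iff]
  refine and_congr_right fun h1 => and_congr_right fun h2 => ?_
  rw [N.lo_eq h1, N.hi_eq h2, Nat.cast_le]
  refine and_congr_right fun _ => ?_
  by_cases h3 : H.graph.Adj a c
  · simp [h3, N.lo_eq h3]
  · simp [h3]

/-- The three edges of the triangle have the same label and no other one. -/
def Mono (H : MultilabelTemporalGraph ℕ) (lw up : ℕ → ℕ → ℕ) (a b c : ℕ) : Prop :=
  (H.graph.Adj a b ∧ H.graph.Adj b c ∧ H.graph.Adj a c) ∧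
    up a b = lw a b ∧ lw b c = lw a b ∧ up b c = lw a b ∧ lw a c = lw a b ∧ up a c = lw a b

theorem isCorrelated_iff {a b c d : ℕ} : H.IsCorrelated a b c d ↔ Mono H lw up a b c ∧
    (H.graph.Adj b d ∧ lw b d ≤ lw a b) ∧ (H.graph.Adj c d ∧ lw a b < lw c d) ∧
    (¬ H.graph.Adj a d ∨ lw a d < lw a b) := by
  rw [MultilabelTemporalGraph.isCorrelated_iff]
  unfold Mono
  constructor
  · rintro ⟨t, ⟨h1, h2, h3⟩, ⟨l1, l2, l3, l4, l5, l6⟩, ⟨h4, l7⟩, ⟨h5, l8⟩, h6⟩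
    rw [N.lo_eq ‹_›] at l1 l3 l5 l7 l8
    rw [N.hi_eq ‹_›] at l2 l4 l6
    subst l1
    rw [Nat.cast_inj] at l2 l3 l4 l5 l6
    rw [Nat.cast_le] at l7
    rw [Nat.cast_lt] at l8
    refine ⟨⟨⟨h1, h2, h3⟩, l2, l3, l4, l5, l6⟩, ⟨h4, l7⟩, ⟨h5, l8⟩, ?_⟩
    by_cases h7 : H.graph.Adj a d
    · simpa [h7, N.lo_eq h7] using h6
    · simp [h7]
  · rintro ⟨⟨⟨h1, h2, h3⟩, l2, l3, l4, l5, l6⟩, ⟨h4, l7⟩, ⟨h5, l8⟩, h6⟩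
    refine ⟨lw a b, ⟨h1, h2, h3⟩, ?_, ⟨h4, ?_⟩, ⟨h5, ?_⟩, ?_⟩
    · simp [N.lo_eq, N.hi_eq, h1, h2, h3, l2, l3, l4, l5, l6]
    · simpa [N.lo_eq h4] using l7
    · simpa [N.lo_eq h5] using l8
    · by_cases h7 : H.graph.Adj a d
      · simpa [h7, N.lo_eq h7] using h6
      · simp [h7]

end Net

/-- There are at most two candidates for each vertex `w`, so the successors of an arc can be listed
in time O(n). -/
theorem exists_of_aug {V : Type*} {G : MultilabelTemporalGraph V} {x y : V} {z : V × V}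
    (h : G.Aug (x, y) z) : ∃ w,
      (z = (w, y) ∧ (G.Conflict x y w ∨ ∃ d, G.IsCorrelated w x y d)) ∨
      (z = (x, w) ∧ (G.Conflict w x y ∨ ∃ d, G.IsCorrelated y w x d)) := by
  rcases h with ⟨h | h⟩ | h | h
  · exact ⟨_, Or.inl ⟨rfl, Or.inl h⟩⟩
  · exact ⟨_, Or.inr ⟨rfl, Or.inl h⟩⟩
  · exact ⟨_, Or.inl ⟨rfl, Or.inr ⟨_, h⟩⟩⟩
  · exact ⟨_, Or.inr ⟨rfl, Or.inr ⟨_, h⟩⟩⟩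

end MultilabelTemporalGraph

namespace RAM

/-! ### The program -/

/-- Array `a` as a square matrix; array `5` holds the positions of the rows. -/
def cell (a : ℕ) (x y : Expr) : Expr := .load a (.add (.load 5 x) y)

/-- Write into array `a` as a square matrix. -/
def storeCell (a : ℕ) (x y e : Expr) : Program := .store a (.add (.load 5 x) y) e

def Test.or (b c : Test) : Test := .not (.and (.not b) (.not c))

def Test.le (e f : Expr) : Test := .not (.lt f e)

/-- Write the multiples of register `r` into array `a`; register `6` ends up with the `n`-fold. -/
def multiples (a r : ℕ) : Program :=
  .seq (.assign 6 (.lit 0))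
    (forLoop 3 0 (.seq (.store a (.reg 3) (.reg 6)) (.assign 6 (.add (.reg 6) (.reg r)))))

/-- Read the endpoints of the edge in register `j`. -/
def readEdge (j x y : ℕ) : Program :=
  .seq (.assign x (.load 0 (.reg j))) (.assign y (.load 1 (.reg j)))

/-- Adjacency, earliest labels and latest labels as matrices in the arrays `7`, `8`, `9`. -/
def matrices : Program :=
  forLoop 3 1 (.seq (readEdge 3 7 8)
    (.seq (.assign 9 (.load 3 (.load 2 (.reg 3))))
    (.seq (.assign 10 (.load 3 (.sub (.load 2 (.add (.reg 3) (.lit 1))) (.lit 1))))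
    (.seq (storeCell 7 (.reg 7) (.reg 8) (.lit 1))
    (.seq (storeCell 7 (.reg 8) (.reg 7) (.lit 1))
    (.seq (storeCell 8 (.reg 7) (.reg 8) (.reg 9))
    (.seq (storeCell 8 (.reg 8) (.reg 7) (.reg 9))
    (.seq (storeCell 9 (.reg 7) (.reg 8) (.reg 10))
      (storeCell 9 (.reg 8) (.reg 7) (.reg 10))))))))))

def setup : Program := .seq (multiples 5 0) (.seq (.assign 11 (.reg 6))
  (.seq (multiples 6 11) matrices))

def adjTest (x y : Expr) : Test := .eq (cell 7 x y) (.lit 1)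

def monoTest (x y z : Expr) : Test :=
  .and (.and (adjTest x y) (.and (adjTest y z) (adjTest x z)))
    (.and (.eq (cell 9 x y) (cell 8 x y)) (.and (.eq (cell 8 y z) (cell 8 x y))
      (.and (.eq (cell 9 y z) (cell 8 x y)) (.and (.eq (cell 8 x z) (cell 8 x y))
        (.eq (cell 9 x z) (cell 8 x y))))))

def corrTest (x y z w : Expr) : Test :=
  .and (monoTest x y z) (.and (.and (adjTest y w) (.le (cell 8 y w) (cell 8 x y)))
    (.and (.and (adjTest z w) (.lt (cell 8 x y) (cell 8 z w)))
      (.or (.not (adjTest x w)) (.lt (cell 8 x w) (cell 8 x y)))))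

def conflictTest (x y z : Expr) : Test :=
  .and (adjTest x y) (.and (adjTest y z) (.and (.le (cell 8 x y) (cell 9 y z))
    (.or (.not (adjTest x z)) (.lt (cell 8 x z) (cell 9 y z)))))

/-- Position of the triple in array `12`. -/
def triple (y z x : Expr) : Expr := .add (.add (.load 6 y) (.load 5 z)) x

def markCorr (x y z w : Expr) : Program :=
  .ite (corrTest x y z w) (.store 12 (triple y z x) (.lit 1)) .skip

def checkCorr : Program :=
  .seq (markCorr (.reg 7) (.reg 8) (.reg 9) (.reg 10)) (markCorr (.reg 8) (.reg 7) (.reg 9) (.reg 10))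

/-- Register `6` ends up with `n` times the number of pairs of an edge and a vertex that form a
monolabel triangle. -/
def countMono : Program :=
  .seq (.assign 6 (.lit 0)) (forLoop 3 1 (.seq (readEdge 3 7 8) (forLoop 9 0
    (.ite (monoTest (.reg 7) (.reg 8) (.reg 9)) (.assign 6 (.add (.reg 6) (.reg 0))) .skip))))

def square : Program :=
  .seq (.assign 11 (.lit 0)) (forLoop 3 1 (.assign 11 (.add (.reg 11) (.reg 1))))

def corrByTriangles : Program :=
  forLoop 3 1 (.seq (readEdge 3 7 8) (forLoop 9 0
    (.ite (monoTest (.reg 7) (.reg 8) (.reg 9)) (forLoop 10 0 checkCorr) .skip)))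

def corrByEdges : Program :=
  forLoop 3 1 (.seq (readEdge 3 7 8) (forLoop 5 1
    (.seq (.seq (readEdge 5 9 10) checkCorr) (.seq (readEdge 5 10 9) checkCorr))))

/-- Mark the correlated monolabel triangles in array `12`. -/
def correlate : Program :=
  .seq countMono (.seq square (.ite (.lt (.reg 11) (.reg 6)) corrByEdges corrByTriangles))

/-- The arrays and registers for a search: a marker matrix `M`, a queue in the arrays `X`, `Y`
between the positions in the registers `h` and `t`. -/
structure Side where
  M : ℕ
  X : ℕ
  Y : ℕ
  h : ℕ
  t : ℕ

/-- Append the arc `xy` to the queue, unless it is there already or in the matrix `O`. -/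
def push (O : ℕ) (S : Side) (x y : Expr) : Program :=
  .ite (.and (.eq (cell O x y) (.lit 0)) (.not (.eq (cell S.M x y) (.reg 15))))
    (.seq (storeCell S.M x y (.reg 15)) (.seq (.store S.X (.reg S.t) x)
      (.seq (.store S.Y (.reg S.t) y) (.assign S.t (.add (.reg S.t) (.lit 1))))))
    .skip

def startQueue (O : ℕ) (S : Side) (x y : Expr) : Program :=
  .seq (.assign S.h (.lit 0)) (.seq (.assign S.t (.lit 0)) (push O S x y))

/-- Remove an arc from the queue and append the arcs that it forces directly. -/
def expand (O : ℕ) (S : Side) : Program :=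
  .seq (.seq (.assign 9 (.load S.X (.reg S.h))) (.seq (.assign 10 (.load S.Y (.reg S.h)))
    (.assign S.h (.add (.reg S.h) (.lit 1)))))
  (forLoop 4 0 (.seq
    (.ite (.or (conflictTest (.reg 9) (.reg 10) (.reg 4))
        (.eq (.load 12 (triple (.reg 9) (.reg 10) (.reg 4))) (.lit 1)))
      (push O S (.reg 4) (.reg 10)) .skip)
    (.ite (.or (conflictTest (.reg 4) (.reg 9) (.reg 10))
        (.eq (.load 12 (triple (.reg 4) (.reg 9) (.reg 10))) (.lit 1)))
      (push O S (.reg 9) (.reg 4)) .skip)))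

/-- Write the arcs of the queue into the matrix `O`. -/
def commit (O : ℕ) (S : Side) : Program :=
  forLoop 5 S.t (storeCell O (.load S.X (.reg 5)) (.load S.Y (.reg 5)) (.lit 1))

def side₁ : Side := ⟨16, 18, 19, 11, 12⟩

def side₂ : Side := ⟨17, 20, 21, 13, 14⟩

def fresh (O : ℕ) : Test :=
  .and (.eq (cell O (.reg 7) (.reg 8)) (.lit 0)) (.eq (cell O (.reg 8) (.reg 7)) (.lit 0))

/-- Search from both orientations of the edge in the registers `7`, `8` simultaneously and accept
the search that is finished first. -/
def race : Program :=
  .seq (.assign 15 (.add (.reg 15) (.lit 1)))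
  (.seq (startQueue 13 side₁ (.reg 7) (.reg 8))
  (.seq (startQueue 13 side₂ (.reg 8) (.reg 7))
  (.seq (.loop (.and (.lt (.reg 11) (.reg 12)) (.lt (.reg 13) (.reg 14)))
    (.seq (expand 13 side₁) (expand 13 side₂)))
  (.ite (.lt (.reg 11) (.reg 12)) (commit 13 side₂) (commit 13 side₁)))))

/-- A closed orientation, if there is one, in the matrix `13`. -/
def orient : Program :=
  forLoop 3 1 (.seq (readEdge 3 7 8) (.ite (fresh 13) race .skip))

/-- Write the arcs of the orientation into the arrays `22`, `23` and mark those in a cyclic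
triangle in array `24`. -/
def flag : Program :=
  forLoop 3 1 (.seq (readEdge 3 7 8)
    (.seq (.ite (.eq (cell 13 (.reg 7) (.reg 8)) (.lit 1)) .skip (readEdge 3 8 7))
    (.seq (.seq (.store 22 (.reg 3) (.reg 7)) (.store 23 (.reg 3) (.reg 8)))
    (forLoop 4 0 (.ite (.and (.eq (cell 13 (.reg 8) (.reg 4)) (.lit 1))
        (.eq (cell 13 (.reg 4) (.reg 7)) (.lit 1))) (.store 24 (.reg 3) (.lit 1)) .skip)))))

def markBad : Program :=
  forLoop 3 1 (.seq (.seq (.assign 7 (.load 22 (.reg 3))) (.assign 8 (.load 23 (.reg 3))))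
    (.ite (.and (.not (.eq (.load 24 (.reg 3)) (.lit 1))) (fresh 14))
      (.store 25 (.reg 8) (.add (.reg 16) (.lit 1))) .skip))

def tryVertex (x : ℕ) : Program :=
  .ite (.not (.eq (.load 25 (.reg x)) (.add (.reg 16) (.lit 1))))
    (.seq (.assign 17 (.reg x)) (.assign 18 (.lit 1))) .skip

def findVertex : Program :=
  .seq (.assign 18 (.lit 0)) (forLoop 3 1 (.seq (readEdge 3 7 8)
    (.ite (fresh 14) (.seq (tryVertex 7) (tryVertex 8)) .skip)))

def side₃ : Side := ⟨26, 18, 19, 11, 12⟩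

/-- Add all arcs forced by the arc in the registers `7`, `8` to the matrix `14`. -/
def saturate : Program :=
  .seq (.assign 15 (.add (.reg 15) (.lit 1)))
  (.seq (startQueue 14 side₃ (.reg 7) (.reg 8))
  (.seq (.loop (.lt (.reg 11) (.reg 12)) (expand 14 side₃)) (commit 14 side₃)))

/-- Orient the remaining edges at the vertex in register `17` away from it. -/
def treatVertex : Program :=
  forLoop 3 1 (.seq (readEdge 3 7 8)
    (.seq (.ite (.eq (.reg 8) (.reg 17)) (readEdge 3 8 7) .skip)
    (.ite (.and (.eq (.reg 7) (.reg 17)) (fresh 14)) saturate .skip)))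

/-- A transitive orientation, if there is one, in the matrix `14`. -/
def refine : Program :=
  forLoop 16 0 (.seq markBad (.seq findVertex (.ite (.eq (.reg 18) (.lit 1)) treatVertex .skip)))

/-- Write the orientation into array `4` and the matrix `27`. -/
def output : Program :=
  forLoop 3 1 (.seq (readEdge 3 7 8) (.ite (.eq (cell 14 (.reg 7) (.reg 8)) (.lit 1))
    (.seq (.store 4 (.reg 3) (.lit 1)) (storeCell 27 (.reg 7) (.reg 8) (.lit 1)))
    (.seq (.store 4 (.reg 3) (.lit 0)) (storeCell 27 (.reg 8) (.reg 7) (.lit 1)))))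

/-- The condition for transitivity at the path `xyz`. -/
def fineTest (x y z : Expr) : Test :=
  .or (.not (.and (.eq (cell 27 y z) (.lit 1)) (.le (cell 8 x y) (cell 9 y z))))
    (.and (.eq (cell 27 x z) (.lit 1)) (.le (cell 9 y z) (cell 8 x z)))

def verify : Program :=
  .seq (.assign 2 (.lit 1)) (forLoop 3 1 (.seq (readEdge 3 7 8)
    (.seq (.ite (.eq (.load 4 (.reg 3)) (.lit 1)) .skip (readEdge 3 8 7))
    (forLoop 4 0 (.ite (fineTest (.reg 7) (.reg 8) (.reg 4)) .skip (.assign 2 (.lit 0)))))))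

def mainProgram : Program :=
  .ite (.eq (.reg 1) (.lit 0)) (.assign 2 (.lit 1))
    (.seq (.seq setup correlate) (.seq (.seq orient flag) (.seq refine (.seq output verify))))

open MultilabelTemporalGraph

/-! ### Tables of positions, adjacency and labels -/

theorem position_inj {n a b c d : ℕ} (hb : b < n) (hd : d < n) :
    a * n + b = c * n + d ↔ a = c ∧ b = d := by
  constructor
  · intro h
    have h1 := congrArg (· / n) h
    have h2 := congrArg (· % n) h
    have hn : 0 < n := by omega
    simp only [Nat.mul_add_mod_self_right, Nat.mod_eq_of_lt hb, Nat.mod_eq_of_lt hd] at h2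
    simp only [mul_comm _ n, Nat.mul_add_div hn, Nat.div_eq_of_lt hb, Nat.div_eq_of_lt hd] at h1
    exact ⟨by omega, h2⟩
  · rintro ⟨rfl, rfl⟩
    rfl

theorem position₃_inj {n a b c a' b' c' : ℕ} (ha : a < n) (hc : c < n) (ha' : a' < n)
    (hc' : c' < n) :
    b * (n * n) + c * n + a = b' * (n * n) + c' * n + a' ↔ b = b' ∧ c = c' ∧ a = a' := by
  rw [← mul_assoc, ← mul_assoc, ← add_mul, ← add_mul, position_inj ha ha', position_inj hc hc',
    and_assoc]

theorem multiples_spec {a r n v : ℕ} {s : State} (h0 : s.reg 0 = n) (hr : s.reg r = v)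
    (h6 : r ≠ 6) (h3 : r ≠ 3) :
    Run (multiples a r) s fun s' t => (∀ i < n, s'.mem a i = i * v) ∧ s'.reg 6 = n * v ∧
      t ≤ 20 * n + 10 := by
  rw [multiples, run_seq, run_assign]
  refine (Run.forLoop_le 8 (fun k s' => (∀ i < k, s'.mem a i = i * v) ∧ s'.reg 6 = k * v ∧
    s'.reg r = v) (N := n) ?_ (by decide) (by simp [Program.regs]) (by simp [Program.regs]) ?_ ?_
      ?_).mono ?_
  · simp [reg_setReg, h0]
  · simp [reg_setReg, Expr.eval, h6, hr]
  · simp [reg_setReg, mem_setReg, h3]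
  · rintro k s' hk hi - ⟨h1, h2, h3⟩
    simp only [run_seq, run_assign, run_store, reg_setReg, reg_setMem, mem_setReg, mem_setMem,
      Expr.eval, Expr.cost, h2, hi, h6, h3]
    refine ⟨⟨fun i hi => ?_, ?_, ?_⟩, by norm_num⟩
    · by_cases hik : i = k
      · simp [hik]
      · simp [hik, h1 i (by omega)]
    · simp [add_mul]
    · simp
  · rintro s' t - ⟨⟨h1, h2, -⟩, h4⟩
    refine ⟨h1, h2, ?_⟩
    simp only [Expr.cost]
    omega

/-- The state holds the edges, and array `5` the positions of the rows of matrices. -/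
structure Base (n m : ℕ) (tl hd : ℕ → ℕ) (s : State) : Prop where
  n_eq : s.reg 0 = n
  m_eq : s.reg 1 = m
  tl_eq : ∀ j < m, s.mem 0 j = tl j
  hd_eq : ∀ j < m, s.mem 1 j = hd j
  row : ∀ a < n, s.mem 5 a = a * n

/-- The state holds the edges, their earliest and latest labels, and tables of positions. -/
structure Tables (H : MultilabelTemporalGraph ℕ) (n m : ℕ) (tl hd : ℕ → ℕ) (lw up : ℕ → ℕ → ℕ)
    (s : State) : Prop extends Base n m tl hd s where
  row₂ : ∀ a < n, s.mem 6 a = a * (n * n)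
  adj : ∀ a < n, ∀ b < n, s.mem 7 (a * n + b) = 1 ↔ H.graph.Adj a b
  lw_eq : ∀ a b, H.graph.Adj a b → s.mem 8 (a * n + b) = lw a b
  up_eq : ∀ a b, H.graph.Adj a b → s.mem 9 (a * n + b) = up a b

section

variable {H : MultilabelTemporalGraph ℕ} {n m : ℕ} {tl hd : ℕ → ℕ} {lw up : ℕ → ℕ → ℕ}

theorem Base.frame {s s' : State} {R A : List ℕ} (h : Base n m tl hd s) (hf : Frame R A s s')
    (hR : 0 ∉ R ∧ 1 ∉ R) (hA : 0 ∉ A ∧ 1 ∉ A ∧ 5 ∉ A) : Base n m tl hd s' := by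
  obtain ⟨h1, h2, h3, h4, h5⟩ := h
  obtain ⟨k1, k2⟩ := hf
  constructor <;> simp_all

theorem Tables.frame {s s' : State} {R A : List ℕ} (h : Tables H n m tl hd lw up s)
    (hf : Frame R A s s') (hR : 0 ∉ R ∧ 1 ∉ R)
    (hA : 0 ∉ A ∧ 1 ∉ A ∧ 5 ∉ A ∧ 6 ∉ A ∧ 7 ∉ A ∧ 8 ∉ A ∧ 9 ∉ A) :
    Tables H n m tl hd lw up s' where
  toBase := h.toBase.frame hf hR ⟨hA.1, hA.2.1, hA.2.2.1⟩
  row₂ := by rw [hf.2 6 (by tauto)]; exact h.row₂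
  adj := by rw [hf.2 7 (by tauto)]; exact h.adj
  lw_eq := by rw [hf.2 8 (by tauto)]; exact h.lw_eq
  up_eq := by rw [hf.2 9 (by tauto)]; exact h.up_eq

theorem Base.cell {s : State} (T : Base n m tl hd s) (a : ℕ) {x y : Expr} (hx : x.eval s < n) :
    (cell a x y).eval s = s.mem a (x.eval s * n + y.eval s) := by
  simp [RAM.cell, Expr.eval, T.row _ hx]

theorem Base.storeCell {s : State} (T : Base n m tl hd s) (a : ℕ) {x y e : Expr}
    (hx : x.eval s < n) {Q : State → ℕ → Prop} : Run (storeCell a x y e) s Q ↔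
      Q (s.setMem a (x.eval s * n + y.eval s) (e.eval s)) (x.cost + y.cost + e.cost + 3) := by
  simp only [RAM.storeCell, run_store, Expr.eval, Expr.cost, T.row _ hx]
  exact iff_of_eq (congrArg _ (by omega))

theorem Base.readEdge {s : State} (T : Base n m tl hd s) {j x y : ℕ} (hj : s.reg j < m)
    (hx : j ≠ x) {Q : State → ℕ → Prop} : Run (readEdge j x y) s Q ↔
      Q ((s.setReg x (tl (s.reg j))).setReg y (hd (s.reg j))) 6 := by
  simp [RAM.readEdge, run_seq, run_assign, Expr.eval, Expr.cost, reg_setReg, mem_setReg, hx,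
    T.tl_eq _ hj, T.hd_eq _ hj]

variable (N : Net H n m tl hd lw up)

include N

theorem matrices_spec {s : State} (B : Base n m tl hd s)
    (hlw : ∀ j < m, s.mem 3 (s.mem 2 j) = lw (tl j) (hd j))
    (hup : ∀ j < m, s.mem 3 (s.mem 2 (j + 1) - 1) = up (tl j) (hd j))
    (hrow₂ : ∀ a < n, s.mem 6 a = a * (n * n)) (hzero : s.mem 7 = 0) :
    Run matrices s fun s' t => Tables H n m tl hd lw up s' ∧ t ≤ 80 * m + 6 := by
  -- The pairs joined by one of the first `k` edges. Cells of other pairs stay `0`, so no time is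
  -- spent on clearing a matrix.
  let E : ℕ → ℕ → ℕ → Prop := fun k a b => ∃ j < k, tl j = a ∧ hd j = b ∨ tl j = b ∧ hd j = a
  have hE : ∀ k ≤ m, ∀ a b, E k a b → H.graph.Adj a b := fun k hk a b ⟨j, hj, h⟩ =>
    (N.adj_iff a b).2 ⟨j, hj.trans_le hk, h⟩
  have hEs : ∀ k a b, E (k + 1) a b ↔ (a = tl k ∧ b = hd k ∨ a = hd k ∧ b = tl k) ∨ E k a b := by
    intro k a b
    constructor
    · rintro ⟨j, hj, h⟩
      by_cases hjk : j = k
      · subst hjk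
        left
        tauto
      · exact Or.inr ⟨j, by omega, h⟩
    · rintro ((⟨rfl, rfl⟩ | ⟨rfl, rfl⟩) | ⟨j, hj, h⟩)
      · exact ⟨k, by omega, by tauto⟩
      · exact ⟨k, by omega, by tauto⟩
      · exact ⟨j, by omega, h⟩
  refine (Run.forLoop_le 72 (fun k s' =>
    (∀ a < n, ∀ b < n, s'.mem 7 (a * n + b) = 1 ↔ E k a b) ∧
    (∀ a b, E k a b → s'.mem 8 (a * n + b) = lw a b) ∧
    (∀ a b, E k a b → s'.mem 9 (a * n + b) = up a b)) B.m_eq (by decide) (by decide) (by decide)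
      ?_ (fun _ _ _ h => h) ?_).mono ?_
  · simp [E, hzero]
  · rintro k s' hk hi hf ⟨h1, h2, h3⟩
    have B' := B.frame hf (by decide) (by decide)
    have hm2 : s'.mem 2 = s.mem 2 := hf.2 2 (by decide)
    have hm3 : s'.mem 3 = s.mem 3 := hf.2 3 (by decide)
    have ht := N.tl_lt k hk
    have hh := N.hd_lt k hk
    have hadj := N.adj_edge hk
    have el := N.lw_comm hadj
    have eu := N.up_comm hadj
    simp only [run_seq, B'.readEdge (hi ▸ hk) (show (3 : ℕ) ≠ 7 by decide), run_assign, storeCell,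
      run_store, Expr.eval, Expr.cost, reg_setReg, mem_setReg, hi, mem_setMem, reg_setMem, hm2, hm3]
    norm_num
    simp only [B'.row _ ht, B'.row _ hh, hlw k hk, hup k hk]
    clear hf
    refine ⟨fun a ha b hb => ?_, fun a b hab => ?_, fun a b hab => ?_⟩
    · rw [hEs, ← h1 a ha b hb]
      simp only [position_inj hb ht, position_inj hb hh]
      by_cases c1 : a = tl k ∧ b = hd k
      · simp [c1]
      · by_cases c2 : a = hd k ∧ b = tl k <;> simp [c1, c2]
    · have hb := N.lt_right (hE _ hk a b hab)
      rw [hEs] at hab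
      simp only [position_inj hb ht, position_inj hb hh]
      by_cases c2 : a = hd k ∧ b = tl k
      · rw [if_pos c2, c2.1, c2.2, el]
      · by_cases c1 : a = tl k ∧ b = hd k
        · rw [if_neg c2, if_pos c1, c1.1, c1.2]
        · rw [if_neg c2, if_neg c1]
          exact h2 a b (hab.resolve_left (not_or.2 ⟨c1, c2⟩))
    · have hb := N.lt_right (hE _ hk a b hab)
      rw [hEs] at hab
      simp only [position_inj hb ht, position_inj hb hh]
      by_cases c2 : a = hd k ∧ b = tl k
      · rw [if_pos c2, c2.1, c2.2, eu]
      · by_cases c1 : a = tl k ∧ b = hd k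
        · rw [if_neg c2, if_pos c1, c1.1, c1.2]
        · rw [if_neg c2, if_neg c1]
          exact h3 a b (hab.resolve_left (not_or.2 ⟨c1, c2⟩))
  · rintro s' t hf ⟨⟨h1, h2, h3⟩, h4⟩
    have hA := N.adj_iff
    refine ⟨⟨B.frame hf (by decide) (by decide), ?_, fun a ha b hb => ?_, fun a b h => ?_,
      fun a b h => ?_⟩, h4⟩
    · rwa [hf.2 6 (by decide)]
    · rw [h1 a ha b hb, hA]
    · exact h2 a b ((hA a b).1 h)
    · exact h3 a b ((hA a b).1 h)

theorem setup_spec {s : State} (h0 : s.reg 0 = n) (h1 : s.reg 1 = m)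
    (htl : ∀ j < m, s.mem 0 j = tl j) (hhd : ∀ j < m, s.mem 1 j = hd j)
    (hlw : ∀ j < m, s.mem 3 (s.mem 2 j) = lw (tl j) (hd j))
    (hup : ∀ j < m, s.mem 3 (s.mem 2 (j + 1) - 1) = up (tl j) (hd j)) (hzero : s.mem 7 = 0) :
    Run setup s fun s' t => Tables H n m tl hd lw up s' ∧ t ≤ 80 * m + 40 * n + 40 := by
  refine (multiples_spec h0 h0 (by decide) (by decide)).seq fun s₁ t₁ f₁ ⟨h5, h6, ht₁⟩ => ?_
  rw [run_seq, run_assign]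
  have e0 : s₁.reg 0 = n := (f₁.1 0 (by decide)).trans h0
  refine (multiples_spec (n := n) (v := n * n) (a := 6) (r := 11) ?_ ?_ (by decide)
    (by decide)).seq fun s₂ t₂ f₂ ⟨h7, _, ht₂⟩ => ?_
  · simpa [reg_setReg] using e0
  · simpa [reg_setReg, Expr.eval] using h6
  have em : ∀ a, a ∉ [5, 6] → s₂.mem a = s.mem a := fun a ha => by
    rw [f₂.2 a (by simp_all [multiples, forLoop, Program.arrs]), mem_setReg,
      f₁.2 a (by simp_all [multiples, forLoop, Program.arrs])]
  have em5 : s₂.mem 5 = s₁.mem 5 := by rw [f₂.2 5 (by decide), mem_setReg]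
  have er : ∀ x, x < 2 → s₂.reg x = s.reg x := fun x hx => by
    rw [f₂.1 x (by simp [multiples, forLoop, Program.regs]; omega), reg_setReg,
      if_neg (by omega), f₁.1 x (by simp [multiples, forLoop, Program.regs]; omega)]
  have B : Base n m tl hd s₂ := by
    refine ⟨(er 0 (by decide)).trans h0, (er 1 (by decide)).trans h1, ?_, ?_, ?_⟩
    · rwa [em 0 (by decide)]
    · rwa [em 1 (by decide)]
    · rwa [em5]
  refine (matrices_spec N B ?_ ?_ h7 ?_).mono fun s₃ t₃ _ ⟨h8, ht₃⟩ => ⟨h8, ?_⟩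
  · rwa [em 2 (by decide), em 3 (by decide)]
  · rwa [em 2 (by decide), em 3 (by decide)]
  · rwa [em 7 (by decide)]
  · simp only [Expr.cost]
    omega

end

/-! ### Marking correlated monolabel triangles -/

section

variable {H : MultilabelTemporalGraph ℕ} {n m : ℕ} {tl hd : ℕ → ℕ} {lw up : ℕ → ℕ → ℕ}

theorem Test.holds_or {s : State} {b c : Test} : (Test.or b c).holds s ↔ b.holds s ∨ c.holds s := by
  simp only [Test.or, Test.holds]
  tauto

theorem Test.holds_le {s : State} {e f : Expr} : (Test.le e f).holds s ↔ e.eval s ≤ f.eval s := by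
  simp [Test.le, Test.holds]

theorem Tables.adjTest {s : State} (T : Tables H n m tl hd lw up s) {x y : Expr} {a b : ℕ}
    (hx : x.eval s = a) (hy : y.eval s = b) (ha : a < n) (hb : b < n) :
    (adjTest x y).holds s ↔ H.graph.Adj a b := by
  rw [RAM.adjTest, Test.holds, T.cell 7 (hx ▸ ha), hx, hy]
  exact T.adj a ha b hb

theorem Tables.conflictTest (N : Net H n m tl hd lw up) {s : State}
    (T : Tables H n m tl hd lw up s) {x y z : Expr} {a b c : ℕ} (hx : x.eval s = a)
    (hy : y.eval s = b) (hz : z.eval s = c) (ha : a < n) (hb : b < n) (hc : c < n) :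
    (conflictTest x y z).holds s ↔ H.Conflict a b c := by
  rw [N.conflict_iff]
  simp only [RAM.conflictTest, Test.holds, Test.holds_or, Test.holds_le, T.adjTest hx hy ha hb,
    T.adjTest hy hz hb hc, T.adjTest hx hz ha hc, T.cell _ (hx ▸ ha : x.eval s < n),
    T.cell _ (hy ▸ hb : y.eval s < n), hx, hy, hz]
  refine and_congr_right fun h1 => and_congr_right fun h2 => ?_
  rw [T.lw_eq _ _ h1, T.up_eq _ _ h2]
  refine and_congr_right fun _ => ?_
  by_cases h3 : H.graph.Adj a c
  · simp [h3, T.lw_eq]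
  · simp [h3]

theorem Tables.monoTest {s : State} (T : Tables H n m tl hd lw up s) {x y z : Expr} {a b c : ℕ}
    (hx : x.eval s = a) (hy : y.eval s = b) (hz : z.eval s = c) (ha : a < n) (hb : b < n)
    (hc : c < n) : (monoTest x y z).holds s ↔ Net.Mono H lw up a b c := by
  simp only [RAM.monoTest, Test.holds, T.adjTest hx hy ha hb, Net.Mono,
    T.adjTest hy hz hb hc, T.adjTest hx hz ha hc, T.cell _ (hx ▸ ha : x.eval s < n),
    T.cell _ (hy ▸ hb : y.eval s < n), hx, hy, hz]
  refine and_congr_right fun ⟨h1, h2, h3⟩ => ?_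
  rw [T.lw_eq _ _ h1, T.lw_eq _ _ h2, T.lw_eq _ _ h3, T.up_eq _ _ h1, T.up_eq _ _ h2,
    T.up_eq _ _ h3]

theorem Tables.corrTest (N : Net H n m tl hd lw up) {s : State} (T : Tables H n m tl hd lw up s)
    {x y z w : Expr} {a b c d : ℕ} (hx : x.eval s = a) (hy : y.eval s = b) (hz : z.eval s = c)
    (hw : w.eval s = d) (ha : a < n) (hb : b < n) (hc : c < n) (hd : d < n) :
    (corrTest x y z w).holds s ↔ H.IsCorrelated a b c d := by
  rw [N.isCorrelated_iff]
  simp only [RAM.corrTest, Test.holds, Test.holds_or, Test.holds_le,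
    T.monoTest hx hy hz ha hb hc, T.adjTest hx hw ha hd,
    T.adjTest hy hw hb hd, T.adjTest hz hw hc hd, T.cell _ (hx ▸ ha : x.eval s < n),
    T.cell _ (hy ▸ hb : y.eval s < n), T.cell _ (hz ▸ hc : z.eval s < n), hx, hy, hz, hw]
  refine and_congr_right fun h1 => and_congr ?_ (and_congr ?_ ?_)
  · refine and_congr_right fun h2 => ?_
    rw [T.lw_eq _ _ h2, T.lw_eq _ _ h1.1.1]
  · refine and_congr_right fun h2 => ?_
    rw [T.lw_eq _ _ h2, T.lw_eq _ _ h1.1.1]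
  · by_cases h3 : H.graph.Adj a d
    · simp [h3, T.lw_eq, h1.1.1]
    · simp [h3]

theorem Tables.triple {s : State} (T : Tables H n m tl hd lw up s) {x y z : Expr}
    {a b c : ℕ} (hx : x.eval s = a) (hy : y.eval s = b) (hz : z.eval s = c) (hb : b < n)
    (hc : c < n) : (triple y z x).eval s = b * (n * n) + c * n + a := by
  simp [RAM.triple, Expr.eval, hx, hy, hz, T.row _ hc, T.row₂ _ hb]

/-- The triple is marked in array `12`. -/
def IsMarked (n : ℕ) (s : State) (a b c : ℕ) : Prop := s.mem 12 (b * (n * n) + c * n + a) = 1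

/-- Between the states `s` and `s'` correlated monolabel triangles are marked, and nothing else. -/
def Marks (H : MultilabelTemporalGraph ℕ) (n : ℕ) (s s' : State) : Prop :=
  (∀ a < n, ∀ b < n, ∀ c < n, IsMarked n s' a b c →
    IsMarked n s a b c ∨ ∃ d, H.IsCorrelated a b c d) ∧
  ∀ a b c, IsMarked n s a b c → IsMarked n s' a b c

theorem Marks.refl (s : State) : Marks H n s s := ⟨fun _ _ _ _ _ _ => Or.inl, fun _ _ _ => id⟩

theorem Marks.trans {s s' s'' : State} (h : Marks H n s s') (h' : Marks H n s' s'') :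
    Marks H n s s'' :=
  ⟨fun a ha b hb c hc h1 => (h'.1 a ha b hb c hc h1).elim (h.1 a ha b hb c hc) Or.inr,
    fun a b c h1 => h'.2 a b c (h.2 a b c h1)⟩

/-- All correlated monolabel triangles `a, b, c, d` with `a, b` the endpoints `p, q` in any order
are marked. -/
def AllMarked (H : MultilabelTemporalGraph ℕ) (n : ℕ) (s : State) (p q c d : ℕ) : Prop :=
  ∀ a b, a = p ∧ b = q ∨ a = q ∧ b = p → H.IsCorrelated a b c d → IsMarked n s a b c

theorem AllMarked.mono {s s' : State} (h : Marks H n s s') {p q c d : ℕ}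
    (h' : AllMarked H n s p q c d) : AllMarked H n s' p q c d :=
  fun a b hab hc => h.2 a b c (h' a b hab hc)

variable (N : Net H n m tl hd lw up)

include N

theorem markCorr_spec {s : State} (T : Tables H n m tl hd lw up s) {x y z w : ℕ}
    {a b c d : ℕ} (hx : s.reg x = a) (hy : s.reg y = b) (hz : s.reg z = c) (hw : s.reg w = d)
    (ha : a < n) (hb : b < n) (hc : c < n) (hd : d < n) :
    Run (markCorr (.reg x) (.reg y) (.reg z) (.reg w)) s fun s' t => s'.reg = s.reg ∧
      Marks H n s s' ∧ (H.IsCorrelated a b c d → IsMarked n s' a b c) ∧ t ≤ 200 := by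
  rw [markCorr, run_ite, T.corrTest N (x := .reg x) (y := .reg y) (z := .reg z) (w := .reg w)
    hx hy hz hw ha hb hc hd]
  constructor
  · intro h
    rw [run_store, T.triple (x := .reg x) (y := .reg y) (z := .reg z) hx hy hz hb hc]
    refine ⟨rfl, ⟨fun a' ha' b' hb' c' hc' h' => ?_, fun a' b' c' h' => ?_⟩, fun _ => ?_, ?_⟩
    · simp only [IsMarked, mem_setMem, position₃_inj ha' hc' ha hc] at h' ⊢
      by_cases h1 : b' = b ∧ c' = c ∧ a' = a
      · obtain ⟨rfl, rfl, rfl⟩ := h1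
        exact Or.inr ⟨d, h⟩
      · rw [if_neg (fun h => h1 h.2)] at h'
        exact Or.inl h'
    · simp only [IsMarked, mem_setMem, Expr.eval] at h' ⊢
      split_ifs <;> simp [h']
    · simp [IsMarked, mem_setMem, Expr.eval]
    · exact Nat.le_of_ble_eq_true rfl
  · intro h
    rw [run_skip]
    exact ⟨rfl, .refl _, fun h' => absurd h' h, Nat.le_of_ble_eq_true rfl⟩

theorem checkCorr_spec {s : State} (T : Tables H n m tl hd lw up s)
    {p q c d : ℕ} (hx : s.reg 7 = p) (hy : s.reg 8 = q) (hz : s.reg 9 = c) (hw : s.reg 10 = d)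
    (ha : p < n) (hb : q < n) (hc : c < n) (hd : d < n) :
    Run checkCorr s fun s' t => Marks H n s s' ∧ AllMarked H n s' p q c d ∧ t ≤ 400 := by
  rw [checkCorr]
  refine (markCorr_spec N T hx hy hz hw ha hb hc hd).seq fun s₁ t₁ f₁ ⟨e₁, h1, h2, h3⟩ => ?_
  have T₁ := T.frame f₁ (by decide) (by decide)
  rw [← e₁] at hx hy hz hw
  refine (markCorr_spec N T₁ hy hx hz hw hb ha hc hd).mono fun s₂ t₂ _ ⟨_, h4, h5, h6⟩ =>
    ⟨h1.trans h4, ?_, by omega⟩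
  rintro a b (⟨rfl, rfl⟩ | ⟨rfl, rfl⟩) h
  · exact h4.2 _ _ _ (h2 h)
  · exact h5 h

open Classical in
omit N in
/-- The number of vertices below `k` that form a monolabel triangle with the edge `j`. -/
noncomputable def monoCount (H : MultilabelTemporalGraph ℕ) (lw up : ℕ → ℕ → ℕ) (tl hd : ℕ → ℕ)
    (j k : ℕ) : ℕ :=
  ∑ w ∈ Finset.range k, if Net.Mono H lw up (tl j) (hd j) w then 1 else 0

theorem countMono_spec {s : State} (T : Tables H n m tl hd lw up s) :
    Run countMono s fun s' t =>
      s'.reg 6 = n * ∑ j ∈ Finset.range m, monoCount H lw up tl hd j n ∧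
      t ≤ 100 * (n * m) + 30 * m + 10 := by
  rw [countMono, run_seq, run_assign]
  refine (Run.forLoop_le (98 * n + 12) (fun k s' =>
    s'.reg 6 = n * ∑ j ∈ Finset.range k, monoCount H lw up tl hd j n) (N := m) ?_ (by decide)
      (by decide) (by decide) ?_ ?_ ?_).mono ?_
  · simp [reg_setReg, T.m_eq]
  · simp [reg_setReg, Expr.eval]
  · simp [reg_setReg]
  · intro k s₁ hk hi f₁ h6
    have T₀ : Tables H n m tl hd lw up (s.setReg 6 ((Expr.lit 0).eval s)) :=
      T.frame ((Frame.refl [6] [] s).setReg (by decide) _) (by decide) (by decide)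
    have T₁ := T₀.frame f₁ (by decide) (by decide)
    rw [run_seq, T₁.readEdge (hi ▸ hk) (by decide), hi]
    refine (Run.forLoop_le 90 (fun l s' => s'.reg 6 = n * (∑ j ∈ Finset.range k,
      monoCount H lw up tl hd j n + monoCount H lw up tl hd k l)) (N := n) ?_ (by decide)
      (by decide) (by decide) ?_ ?_ ?_).mono ?_
    · simp [reg_setReg, T₁.n_eq]
    · simpa [reg_setReg, monoCount] using h6
    · simp [reg_setReg]
    · intro l s₂ hl hi₂ f₂ h6
      have T₂ : Tables H n m tl hd lw up s₂ := (T₁.frame (((Frame.refl [7, 8] [] s₁).setReg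
        (by decide) _).setReg (by decide) _) (by decide) (by decide)).frame f₂ (by decide)
        (by decide)
      have e7 : s₂.reg 7 = tl k := by rw [f₂.1 7 (by decide)]; simp [reg_setReg]
      have e8 : s₂.reg 8 = hd k := by rw [f₂.1 8 (by decide)]; simp [reg_setReg]
      rw [run_ite, T₂.monoTest (x := .reg 7) (y := .reg 8) (z := .reg 9) e7 e8 hi₂
        (N.tl_lt k hk) (N.hd_lt k hk) hl, run_assign, run_skip]
      simp only [monoCount, Finset.sum_range_succ, reg_setReg, Expr.eval, h6, T₂.n_eq]
      exact ⟨fun h => ⟨by simp [h, mul_add, add_assoc], by decide⟩,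
        fun h => ⟨by simp [h], by decide⟩⟩
    · rintro s₂ t₂ f₂ ⟨h1, h2⟩
      refine ⟨by rw [Finset.sum_range_succ]; exact h1, by omega⟩
  · rintro s₁ t₁ - ⟨h1, h2⟩
    refine ⟨h1, ?_⟩
    simp only [Expr.cost]
    linarith

omit N in
theorem square_spec {s : State} (h1 : s.reg 1 = m) :
    Run square s fun s' t => s'.reg 11 = m * m ∧ t ≤ 20 * m + 10 := by
  rw [square, run_seq, run_assign]
  refine (Run.forLoop_le 4 (fun k s' => s'.reg 11 = k * m) (N := m) ?_ (by decide)
    (by decide) (by decide) ?_ ?_ ?_).mono ?_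
  · simp [reg_setReg, h1]
  · simp [reg_setReg, Expr.eval]
  · simp [reg_setReg]
  · intro k s₁ _ _ f₁ h11
    rw [run_assign]
    have : s₁.reg 1 = m := by rw [f₁.1 1 (by decide)]; simp [reg_setReg, h1]
    simp [Expr.eval, Expr.cost, reg_setReg, h11, this, add_mul]
  · rintro s₁ t₁ - ⟨h1, h2⟩
    exact ⟨h1, by simp only [Expr.cost]; omega⟩

/-- In a correlated triangle both `ab` and `cd` are edges, so it suffices to try all pairs of edges,
with both directions of each. -/
theorem corrByEdges_spec {s : State} (T : Tables H n m tl hd lw up s) :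
    Run corrByEdges s fun s' t => Marks H n s s' ∧
      (∀ j < m, ∀ c d, AllMarked H n s' (tl j) (hd j) c d) ∧ t ≤ 830 * (m * m) + 30 * m + 10 := by
  refine (Run.forLoop_le (820 * m + 12) (fun k s' => Marks H n s s' ∧
    ∀ j < k, ∀ c d, AllMarked H n s' (tl j) (hd j) c d) T.m_eq (by decide)
      (by decide) (by decide) ⟨.refl _, by simp⟩ (fun _ _ _ h => h) ?_).mono ?_
  · intro k s₁ hk hi f₁ ⟨g₁, h1⟩
    have T₁ := T.frame f₁ (by decide) (by decide)
    rw [run_seq, T₁.readEdge (hi ▸ hk) (by decide), hi]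
    have T₁' : Tables H n m tl hd lw up ((s₁.setReg 7 (tl k)).setReg 8 (hd k)) :=
      T₁.frame (((Frame.refl [7, 8] [] s₁).setReg (by decide) _).setReg (by decide) _)
        (by decide) (by decide)
    refine (Run.forLoop_le 812 (fun l s' =>
      Marks H n ((s₁.setReg 7 (tl k)).setReg 8 (hd k)) s' ∧ ∀ i < l,
        AllMarked H n s' (tl k) (hd k) (tl i) (hd i) ∧
        AllMarked H n s' (tl k) (hd k) (hd i) (tl i)) T₁'.m_eq (by decide)
      (by decide) (by decide) ⟨.refl _, by simp⟩ (fun _ _ _ h => h) ?_).mono ?_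
    · intro l s₂ hl hi₂ f₂ ⟨g₂, h2⟩
      have T₂ := T₁'.frame f₂ (by decide) (by decide)
      have e7 : s₂.reg 7 = tl k := by rw [f₂.1 7 (by decide)]; simp [reg_setReg]
      have e8 : s₂.reg 8 = hd k := by rw [f₂.1 8 (by decide)]; simp [reg_setReg]
      have ft : ∀ x y, Frame [9, 10] [] s₂ ((s₂.setReg 9 x).setReg 10 y) := fun x y =>
        ((Frame.refl [9, 10] [] s₂).setReg (by decide) _).setReg (by decide) _
      rw [run_seq, run_seq, T₂.readEdge (hi₂ ▸ hl) (by decide), hi₂]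
      refine (checkCorr_spec N (T₂.frame (ft _ _) (by decide) (by decide)) (p := tl k) (q := hd k)
        (c := tl l) (d := hd l) (by simpa [reg_setReg] using e7) (by simpa [reg_setReg] using e8)
        (by simp [reg_setReg]) (by simp [reg_setReg]) (N.tl_lt k hk) (N.hd_lt k hk) (N.tl_lt l hl)
        (N.hd_lt l hl)).mono fun s₃ t₃ f₃ ⟨g₃, h3, ht₃⟩ => ?_
      have T₃ := (T₂.frame (ft _ _) (by decide) (by decide)).frame f₃ (by decide) (by decide)
      have e5 : s₃.reg 5 = l := by rw [f₃.1 5 (by decide)]; simp [reg_setReg, hi₂]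
      have fu : Frame [9, 10] [] s₃ ((s₃.setReg 10 (tl l)).setReg 9 (hd l)) :=
        ((Frame.refl [9, 10] [] s₃).setReg (by decide) _).setReg (by decide) _
      rw [run_seq, T₃.readEdge (e5 ▸ hl) (by decide), e5]
      refine (checkCorr_spec N (T₃.frame fu (by decide) (by decide)) (p := tl k) (q := hd k)
        (c := hd l) (d := tl l) ?_ ?_ (by simp [reg_setReg]) (by simp [reg_setReg])
        (N.tl_lt k hk) (N.hd_lt k hk) (N.hd_lt l hl) (N.tl_lt l hl)).mono
        fun s₄ t₄ _ ⟨g₄, h4, ht₄⟩ => ?_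
      · simpa [reg_setReg, f₃.1 7 (by decide)] using e7
      · simpa [reg_setReg, f₃.1 8 (by decide)] using e8
      have g : Marks H n s₂ s₄ := Marks.trans g₃ g₄
      refine ⟨⟨g₂.trans g, fun i hil => ?_⟩, by omega⟩
      rcases Nat.lt_succ_iff_lt_or_eq.1 hil with hil | rfl
      · exact ⟨(h2 i hil).1.mono g, (h2 i hil).2.mono g⟩
      · exact ⟨h3.mono g₄, h4⟩
    · rintro s₂ t₂ f₂ ⟨⟨g₂, h2⟩, ht₂⟩
      refine ⟨⟨g₁.trans g₂, fun j hj c d => ?_⟩, by omega⟩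
      rcases Nat.lt_succ_iff_lt_or_eq.1 hj with hj | rfl
      · exact (h1 j hj c d).mono g₂
      · intro a b hab hc
        have hcd : H.graph.Adj c d := (N.isCorrelated_iff.1 hc).2.2.1.1
        obtain ⟨i, hi, ⟨rfl, rfl⟩ | ⟨rfl, rfl⟩⟩ := (N.adj_iff c d).1 hcd
        · exact (h2 i hi).1 a b hab hc
        · exact (h2 i hi).2 a b hab hc
  · rintro s₁ t₁ - ⟨⟨h1, h2⟩, h3⟩
    exact ⟨h1, h2, by linarith⟩

omit N in
-- The list of edges provides `ab` in one direction only, and the filter by `monoTest` must not lose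
-- the other.
theorem mono_of_isCorrelated (N : Net H n m tl hd lw up) {a b c d : ℕ}
    (h : H.IsCorrelated a b c d) : Net.Mono H lw up a b c ∧ Net.Mono H lw up b a c := by
  obtain ⟨⟨⟨h1, h2, h3⟩, h4⟩, -⟩ := N.isCorrelated_iff.1 h
  refine ⟨⟨⟨h1, h2, h3⟩, h4⟩, ⟨h1.symm, h3, h2⟩, ?_⟩
  rw [← N.lw_comm h1, ← N.up_comm h1]
  tauto

/-- The loop over `d` runs only after a successful `monoTest`; hence the running time is kept in the
invariant instead of a uniform bound per pass. -/
theorem corrByTriangles_spec {s : State} (T : Tables H n m tl hd lw up s) :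
    Run corrByTriangles s fun s' t => Marks H n s s' ∧
      (∀ j < m, ∀ c d, AllMarked H n s' (tl j) (hd j) c d) ∧
      t ≤ 420 * (n * ∑ j ∈ Finset.range m, monoCount H lw up tl hd j n) +
        110 * (n * m) + 30 * m + 10 := by
  refine (Run.forLoop (fun k s' t => (Marks H n s s' ∧
    ∀ j < k, ∀ c d, AllMarked H n s' (tl j) (hd j) c d) ∧
      t ≤ 420 * (n * ∑ j ∈ Finset.range k, monoCount H lw up tl hd j n) +
        110 * (n * k) + 30 * k) T.m_eq (by decide)
      (by decide) (by decide) ⟨⟨.refl _, by simp⟩, by simp⟩ (fun _ _ _ _ h => h) ?_).mono ?_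
  · intro k s₁ t hk hi f₁ ⟨⟨g₁, h1⟩, ht⟩
    have T₁ := T.frame f₁ (by decide) (by decide)
    rw [run_seq, T₁.readEdge (hi ▸ hk) (by decide), hi]
    have T₁' : Tables H n m tl hd lw up ((s₁.setReg 7 (tl k)).setReg 8 (hd k)) :=
      T₁.frame (((Frame.refl [7, 8] [] s₁).setReg (by decide) _).setReg (by decide) _)
        (by decide) (by decide)
    refine (Run.forLoop (fun l s' t =>
      (Marks H n ((s₁.setReg 7 (tl k)).setReg 8 (hd k)) s' ∧ ∀ c < l, ∀ d,
        AllMarked H n s' (tl k) (hd k) c d) ∧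
        t ≤ 420 * (n * monoCount H lw up tl hd k l) + 110 * l) T₁'.n_eq (by decide)
      (by decide) (by decide) ⟨⟨.refl _, by simp⟩, by simp⟩ (fun _ _ _ _ h => h) ?_).mono ?_
    · intro l s₂ u hl hi₂ f₂ ⟨⟨g₂, h2⟩, hu⟩
      have T₂ := T₁'.frame f₂ (by decide) (by decide)
      have e7 : s₂.reg 7 = tl k := by rw [f₂.1 7 (by decide)]; simp [reg_setReg]
      have e8 : s₂.reg 8 = hd k := by rw [f₂.1 8 (by decide)]; simp [reg_setReg]
      rw [run_ite, T₂.monoTest (x := .reg 7) (y := .reg 8) (z := .reg 9) e7 e8 hi₂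
        (N.tl_lt k hk) (N.hd_lt k hk) hl, run_skip]
      have hcost : (RAM.monoTest (.reg 7) (.reg 8) (.reg 9)).cost = 83 := rfl
      simp only [monoCount, Finset.sum_range_succ, hcost]
      constructor
      · intro hmono
        rw [if_pos hmono]
        refine (Run.forLoop_le 400 (fun i s' => Marks H n s₂ s' ∧ ∀ d < i,
          AllMarked H n s' (tl k) (hd k) l d) T₂.n_eq (by decide)
          (by decide) (by decide) ⟨.refl _, by simp⟩ (fun _ _ _ h => h) ?_).mono ?_
        · intro i s₃ hin hi₃ f₃ ⟨g₃, h3⟩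
          have T₃ := T₂.frame f₃ (by decide) (by decide)
          refine (checkCorr_spec N T₃ (p := tl k) (q := hd k) (c := l) (d := i)
            (by rw [f₃.1 7 (by decide), e7]) (by rw [f₃.1 8 (by decide), e8])
            (by rw [f₃.1 9 (by decide), hi₂]) hi₃ (N.tl_lt k hk) (N.hd_lt k hk) hl hin).mono
            fun s₄ t₄ _ ⟨g₄, h4, ht₄⟩ => ⟨⟨g₃.trans g₄, fun d hdi => ?_⟩, ht₄⟩
          rcases Nat.lt_succ_iff_lt_or_eq.1 hdi with hdi | rfl
          · exact (h3 d hdi).mono g₄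
          · exact h4
        · rintro s₃ t₃ - ⟨⟨g₃, h3⟩, ht₃⟩
          refine ⟨⟨g₂.trans g₃, fun c hcl d => ?_⟩, ?_⟩
          · rcases Nat.lt_succ_iff_lt_or_eq.1 hcl with hcl | rfl
            · exact (h2 c hcl d).mono g₃
            · exact fun a b hab hc => h3 d (N.lt_right (N.isCorrelated_iff.1 hc).2.2.1.1) a b hab hc
          · unfold monoCount at hu
            have : 0 < n := by omega
            rw [mul_add n]
            omega
      · intro hmono
        rw [if_neg hmono]
        refine ⟨⟨g₂, fun c hcl d => ?_⟩, ?_⟩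
        · rcases Nat.lt_succ_iff_lt_or_eq.1 hcl with hcl | rfl
          · exact h2 c hcl d
          · rintro a b (⟨rfl, rfl⟩ | ⟨rfl, rfl⟩) hc
            · exact absurd (mono_of_isCorrelated N hc).1 hmono
            · exact absurd (mono_of_isCorrelated N hc).2 hmono
        · unfold monoCount at hu
          rw [add_zero]
          omega
    · rintro s₂ t₂ f₂ ⟨u, ⟨⟨g₂, h2⟩, hu⟩, rfl⟩
      refine ⟨⟨g₁.trans g₂, fun j hj c d => ?_⟩, ?_⟩
      · rcases Nat.lt_succ_iff_lt_or_eq.1 hj with hj | rfl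
        · exact (h1 j hj c d).mono g₂
        · exact fun a b hab hc => h2 c (N.lt_right (mono_of_isCorrelated N hc).1.1.2.1) d a b hab hc
      · rw [Finset.sum_range_succ, mul_add n, mul_add n, mul_one]
        omega
  · rintro s₁ t₁ - ⟨u, ⟨⟨h1, h2⟩, h3⟩, rfl⟩
    exact ⟨h1, h2, by linarith⟩

/-- Comparing the two estimates in advance costs only O(nm) and selects the method that attains the
minimum. -/
theorem correlate_spec {s : State} (T : Tables H n m tl hd lw up s) (hzero : s.mem 12 = 0) :
    Run correlate s fun s' t =>
      (∀ a < n, ∀ b < n, ∀ c < n, IsMarked n s' a b c ↔ ∃ d, H.IsCorrelated a b c d) ∧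
      t ≤ 830 * min (n * ∑ j ∈ Finset.range m, monoCount H lw up tl hd j n) (m * m) +
        210 * (n * m) + 80 * m + 50 := by
  set K := ∑ j ∈ Finset.range m, monoCount H lw up tl hd j n with hK
  have final : ∀ s', Marks H n s s' → (∀ j < m, ∀ c d, AllMarked H n s' (tl j) (hd j) c d) →
      ∀ a < n, ∀ b < n, ∀ c < n, IsMarked n s' a b c ↔ ∃ d, H.IsCorrelated a b c d := by
    intro s' g h a ha b hb c hc
    constructor
    · refine fun h' => (g.1 a ha b hb c hc h').resolve_left fun h0 => ?_
      simp [IsMarked, hzero] at h0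
    · rintro ⟨d, hd⟩
      obtain ⟨j, hj, h1⟩ := (N.adj_iff a b).1 (mono_of_isCorrelated N hd).1.1.1
      exact h j hj c d a b (by tauto) hd
  rw [correlate]
  refine (countMono_spec N T).seq fun s₁ t₁ f₁ ⟨h1, ht₁⟩ => ?_
  have T₁ := T.frame f₁ (by decide) (by decide)
  refine (square_spec T₁.m_eq).seq fun s₂ t₂ f₂ ⟨h2, ht₂⟩ => ?_
  have T₂ := T₁.frame f₂ (by decide) (by decide)
  have h6 : s₂.reg 6 = n * K := by rw [f₂.1 6 (by decide), h1]
  have hM : ∀ s', Marks H n s₂ s' → Marks H n s s' := fun s' h => by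
    have : s₂.mem 12 = s.mem 12 := by rw [f₂.2 12 (by decide), f₁.2 12 (by decide)]
    simpa only [Marks, IsMarked, this] using h
  rw [run_ite]
  simp only [Test.holds, Expr.eval, h2, h6, Test.cost, Expr.cost]
  constructor
  · intro hlt
    refine (corrByEdges_spec N T₂).mono fun s₃ t₃ _ ⟨g, h3, ht₃⟩ => ⟨final s₃ (hM _ g) h3, ?_⟩
    rw [min_eq_right hlt.le]
    omega
  · intro hle
    refine (corrByTriangles_spec N T₂).mono fun s₃ t₃ _ ⟨g, h3, ht₃⟩ => ⟨final s₃ (hM _ g) h3, ?_⟩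
    rw [min_eq_left (not_lt.1 hle)]
    rw [← hK] at ht₃
    omega

end

/-! ### Searches -/

/-- Array `O` as a matrix represents the set `P`. -/
def Rep (n O : ℕ) (s : State) (P : Finset (ℕ × ℕ)) : Prop :=
  ∀ a < n, ∀ b < n, (s.mem O (a * n + b) = 1 ↔ (a, b) ∈ P) ∧
    (s.mem O (a * n + b) = 0 ↔ (a, b) ∉ P)

theorem Rep.congr {n O : ℕ} {s s' : State} {P : Finset (ℕ × ℕ)} (h : Rep n O s P)
    (h' : s'.mem O = s.mem O) : Rep n O s' P := by
  simpa only [Rep, h'] using h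

theorem Rep.insert {n O : ℕ} {s : State} {P : Finset (ℕ × ℕ)} (h : Rep n O s P) {a b : ℕ}
    (hb : b < n) : Rep n O (s.setMem O (a * n + b) 1) (insert (a, b) P) := by
  intro c hc d hd
  simp only [mem_setMem, position_inj hd hb, true_and, Finset.mem_insert, Prod.mk.injEq]
  by_cases hcd : c = a ∧ d = b
  · simp [hcd]
  · simpa [hcd] using h c hc d hd

/-- The registers and arrays used in a search do not interfere. -/
def Side.Good (S : Side) (O : ℕ) : Prop :=
  (S.h ∉ [0, 1, 4, 5, 9, 10, 15] ∧ S.t ∉ [0, 1, 4, 5, 9, 10, 15] ∧ S.h ≠ S.t) ∧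
    [O, S.M, S.X, S.Y].Nodup ∧ ∀ a ∈ [O, S.M, S.X, S.Y], a ∉ [0, 1, 5, 6, 7, 8, 9, 12]

instance (S : Side) (O : ℕ) : Decidable (S.Good O) := by
  unfold Side.Good
  infer_instance

/-- The queue contains the arcs of the list `L`, which are the marked ones. -/
structure Queue (n : ℕ) (S : Side) (s : State) (L : List (ℕ × ℕ)) : Prop where
  len : s.reg S.t = L.length
  fst : ∀ i (h : i < L.length), s.mem S.X i = L[i].1
  snd : ∀ i (h : i < L.length), s.mem S.Y i = L[i].2
  mark : ∀ a < n, ∀ b < n, s.mem S.M (a * n + b) = s.reg 15 ↔ (a, b) ∈ L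
  le : ∀ i, s.mem S.M i ≤ s.reg 15
  nodup : L.Nodup

theorem Queue.frame {n : ℕ} {S : Side} {s s' : State} {L : List (ℕ × ℕ)} (h : Queue n S s L)
    {R A : List ℕ} (hf : Frame R A s s') (hR : S.t ∉ R ∧ 15 ∉ R)
    (hA : S.M ∉ A ∧ S.X ∉ A ∧ S.Y ∉ A) : Queue n S s' L := by
  obtain ⟨h1, h2, h3, h4, h5, h6⟩ := h
  refine ⟨?_, ?_, ?_, ?_, ?_, h6⟩
  · rwa [hf.1 _ hR.1]
  · rwa [hf.2 _ hA.2.1]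
  · rwa [hf.2 _ hA.2.2]
  · rwa [hf.2 _ hA.1, hf.1 _ hR.2]
  · rwa [hf.2 _ hA.1, hf.1 _ hR.2]

/-- All arcs in the list are new and forced by `x`. -/
def Reach (H : MultilabelTemporalGraph ℕ) (P : Finset (ℕ × ℕ)) (x : ℕ × ℕ)
    (L : List (ℕ × ℕ)) : Prop := ∀ y ∈ L, y ∉ P ∧ H.Forces x y

/-- The arcs forced directly by the first `k` arcs of the list are in `P` or in the list. -/
def Done (H : MultilabelTemporalGraph ℕ) (P : Finset (ℕ × ℕ)) (k : ℕ) (L : List (ℕ × ℕ)) : Prop :=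
  ∀ i (h : i < L.length), i < k → ∀ z, H.Aug L[i] z → z ∈ P ∨ z ∈ L

section

variable {H : MultilabelTemporalGraph ℕ} {n m : ℕ} {tl hd : ℕ → ℕ} {lw up : ℕ → ℕ → ℕ}

/-- A cell of the marker matrix counts as marked only if it holds the current stamp in register
`15`; a new search takes a larger stamp instead of clearing the matrix. -/
theorem push_spec {s : State} (B : Base n m tl hd s) {O : ℕ} {S : Side} (hS : S.Good O)
    {P : Finset (ℕ × ℕ)} (hP : Rep n O s P) {L : List (ℕ × ℕ)} (hL : Queue n S s L)
    {x y a b : ℕ} (hx : s.reg x = a) (hy : s.reg y = b) (ha : a < n) (hb : b < n) :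
    Run (push O S (.reg x) (.reg y)) s fun s' t => ∃ L', L <+: L' ∧ Queue n S s' L' ∧
      ((a, b) ∈ P ∨ (a, b) ∈ L') ∧ (∀ z ∈ L', z ∈ L ∨ z = (a, b) ∧ (a, b) ∉ P) ∧ t ≤ 40 := by
  obtain ⟨⟨-, hS2, -⟩, hS4, hS5⟩ := hS
  simp only [List.nodup_cons, List.mem_cons, List.not_mem_nil, or_false, not_or] at hS2 hS4
  have hxe : (Expr.reg x).eval s = a := hx
  rw [push, run_ite]
  simp only [Test.holds, B.cell _ (hxe ▸ ha : (Expr.reg x).eval s < n), Expr.eval, hx, hy,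
    (hP a ha b hb).2, hL.mark a ha b hb]
  constructor
  · rintro ⟨h1, h2⟩
    rw [run_seq, B.storeCell _ (hxe ▸ ha)]
    simp only [run_seq, run_store, run_assign, Expr.eval, reg_setMem, hx, hy, hL.len]
    refine ⟨L ++ [(a, b)], List.prefix_append _ _, ⟨?_, ?_, ?_, ?_, ?_, ?_⟩, Or.inr (by simp), ?_,
      Nat.le_of_ble_eq_true rfl⟩
    · simp [reg_setReg]
    · intro i hi
      simp only [mem_setReg, mem_setMem]
      rw [if_neg (fun h => hS4.2.2.1 h.1)]
      rcases Nat.lt_succ_iff_lt_or_eq.1 (by simpa using hi) with hi | rfl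
      · rw [if_neg (fun h => by omega), if_neg (fun h => hS4.2.1.1 h.1.symm),
          List.getElem_append_left hi, hL.fst i hi]
      · simp
    · intro i hi
      simp only [mem_setReg, mem_setMem]
      rcases Nat.lt_succ_iff_lt_or_eq.1 (by simpa using hi) with hi | rfl
      · rw [if_neg (fun h => by omega), if_neg (fun h => by omega),
          if_neg (fun h => hS4.2.1.2 h.1.symm), List.getElem_append_left hi, hL.snd i hi]
      · simp
    · intro c hc d hd
      simp only [mem_setReg, mem_setMem, reg_setReg, reg_setMem]
      rw [if_neg (fun h => hS4.2.1.2 h.1), if_neg (fun h => hS4.2.1.1 h.1),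
        if_neg (show ¬ 15 = S.t by omega)]
      simp only [position_inj hd hb, true_and, List.mem_append, List.mem_singleton, Prod.mk.injEq]
      by_cases hcd : c = a ∧ d = b
      · simp [hcd]
      · simpa [hcd] using hL.mark c hc d hd
    · intro i
      simp only [mem_setReg, mem_setMem, reg_setReg, reg_setMem]
      rw [if_neg (fun h => hS4.2.1.2 h.1), if_neg (fun h => hS4.2.1.1 h.1),
        if_neg (show ¬ 15 = S.t by omega)]
      split_ifs
      · exact le_rfl
      · exact hL.le i
    · simp only [List.nodup_append, hL.nodup]
      simp only [List.nodup_cons, List.not_mem_nil, not_false_eq_true, List.nodup_nil, and_self,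
        List.mem_cons, or_false, true_and]
      rintro z hz _ rfl rfl
      exact h2 hz
    · intro z hz
      rcases List.mem_append.1 hz with hz | hz
      · exact Or.inl hz
      · exact Or.inr ⟨by simpa using hz, h1⟩
  · intro h
    rw [run_skip]
    refine ⟨L, List.prefix_rfl, hL, by tauto, fun z hz => Or.inl hz, Nat.le_of_ble_eq_true rfl⟩

/-- The strict inequality `hM` says that the stamp is fresh, so the empty list describes the markers
at first. -/
theorem startQueue_spec {s : State} (B : Base n m tl hd s) {O : ℕ} {S : Side} (hS : S.Good O)
    {P : Finset (ℕ × ℕ)} (hP : Rep n O s P) (hM : ∀ i, s.mem S.M i < s.reg 15)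
    {x y a b : ℕ} (hx : s.reg x = a) (hy : s.reg y = b) (ha : a < n) (hb : b < n)
    (hxS : x ≠ S.h ∧ x ≠ S.t) (hyS : y ≠ S.h ∧ y ≠ S.t) (hab : (a, b) ∉ P) :
    Run (startQueue O S (.reg x) (.reg y)) s fun s' t => s'.reg S.h = 0 ∧ ∃ L, Queue n S s' L ∧
      (a, b) ∈ L ∧ Reach H P (a, b) L ∧ t ≤ 50 := by
  have hS' := hS
  obtain ⟨⟨hS1, hS2, hS3⟩, -, -⟩ := hS'
  simp only [List.mem_cons, List.not_mem_nil, or_false, not_or] at hS1 hS2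
  simp only [startQueue, run_seq, run_assign, Expr.eval, Expr.cost]
  refine (push_spec (L := []) (a := a) (b := b) (P := P) (B.frame (((Frame.refl [S.h, S.t] [] s).setReg
    (by simp) _).setReg (by simp) _) ?_ (by simp)) hS (hP.congr rfl) ?_ ?_ ?_ ha hb).mono
    fun s' t hf ⟨L, _, h2, h3, h4, h5⟩ => ⟨?_, L, h2, h3.resolve_left hab, ?_, by omega⟩
  · simp only [List.mem_cons, List.not_mem_nil, or_false, not_or]
    tauto
  · refine ⟨by simp [reg_setReg], by simp, by simp, fun c hc d hd => ?_, fun i => ?_, by simp⟩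
    · have := hM (c * n + d)
      simp only [mem_setReg, reg_setReg, List.not_mem_nil, iff_false]
      rw [if_neg (by tauto), if_neg (by tauto)]
      omega
    · simp only [mem_setReg, reg_setReg]
      rw [if_neg (by tauto), if_neg (by tauto)]
      exact (hM i).le
  · simpa [reg_setReg, hxS] using hx
  · simpa [reg_setReg, hyS] using hy
  · rw [hf.1 _ (by simpa [push, Program.regs, storeCell] using hS3)]
    simp [reg_setReg, hS3]
  · intro z hz
    obtain ⟨rfl, h⟩ := (h4 z hz).resolve_left (by simp)
    exact ⟨h, .refl⟩

theorem Done.mono {P : Finset (ℕ × ℕ)} {k : ℕ} {L L' : List (ℕ × ℕ)} (h : Done H P k L)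
    (hk : k ≤ L.length) (hL : L <+: L') : Done H P k L' := by
  intro i hi hik z hz
  have hiL : i < L.length := by omega
  rw [← hL.getElem hiL] at hz
  exact (h i hiL hik z hz).imp_right fun h => hL.subset h

/-- For the arc `(x, y)` at the head, each vertex `l` gives the candidates `(l, y)` and `(x, l)`.
The fourth vertex of a correlated triangle need not be searched for, as array `12` records its
existence. -/
theorem expand_spec (N : Net H n m tl hd lw up) {s : State} (T : Tables H n m tl hd lw up s)
    (hmark : ∀ a < n, ∀ b < n, ∀ c < n, IsMarked n s a b c ↔ ∃ d, H.IsCorrelated a b c d)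
    {O : ℕ} {S : Side} (hS : S.Good O) {P : Finset (ℕ × ℕ)} (hP : Rep n O s P)
    {L : List (ℕ × ℕ)} (hL : Queue n S s L) {x₀ : ℕ × ℕ} (hx₀ : H.graph.Adj x₀.1 x₀.2)
    (hR : Reach H P x₀ L) {k : ℕ} (hk : s.reg S.h = k) (hkL : k < L.length) (hD : Done H P k L) :
    Run (expand O S) s fun s' t => s'.reg S.h = k + 1 ∧ ∃ L', L <+: L' ∧ Queue n S s' L' ∧
      Reach H P x₀ L' ∧ Done H P (k + 1) L' ∧ t ≤ 300 * n + 30 := by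
  have hS' := hS
  obtain ⟨⟨hS1, hS2, hS3⟩, hS4, hS5⟩ := hS'
  simp only [List.nodup_cons, List.mem_cons, List.not_mem_nil, or_false, not_or,
    forall_eq_or_imp, forall_eq] at hS1 hS2 hS4 hS5
  have hS1' := hS1
  have hS2' := hS2
  have hS4' := hS4
  have hS5' := hS5
  simp only [eq_comm (a := S.h), eq_comm (a := S.t)] at hS1' hS2'
  simp only [eq_comm (a := S.M), eq_comm (a := S.X), eq_comm (a := S.Y)] at hS5'
  have hS3' : ¬ S.t = S.h := fun h => hS3 h.symm
  obtain ⟨x, y, hxy⟩ : ∃ x y, L[k] = (x, y) := ⟨_, _, rfl⟩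
  have hadj : H.graph.Adj x y := by
    have := (hR _ (List.getElem_mem hkL)).2.adj hx₀
    rwa [hxy] at this
  have hxn := N.lt_left hadj
  have hyn := N.lt_right hadj
  have hfor : H.Forces x₀ (x, y) := hxy ▸ (hR _ (List.getElem_mem hkL)).2
  simp only [expand, run_seq, run_assign, Expr.eval, Expr.cost, reg_setReg, mem_setReg]
  have hh9 : S.h ≠ 9 := hS1.2.2.2.2.1
  have hh10 : S.h ≠ 10 := hS1.2.2.2.2.2.1
  simp only [hh9, hh10, if_false, hk, hL.fst k hkL, hL.snd k hkL, hxy]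
  set s₁ := ((s.setReg 9 x).setReg 10 y).setReg S.h (k + 1) with hs₁
  have f₁ : Frame [9, 10, S.h] [] s s₁ :=
    (((Frame.refl _ _ _).setReg (by simp) _).setReg (by simp) _).setReg (by simp) _
  have T₁ : Tables H n m tl hd lw up s₁ := T.frame f₁ (by simp [hS1']) (by simp)
  have hP₁ : Rep n O s₁ P := hP.congr rfl
  have hL₁ : Queue n S s₁ L := hL.frame f₁ (by simp [hS2, hS1', hS3']) (by simp)
  have hm₁ : ∀ a < n, ∀ b < n, ∀ c < n, IsMarked n s₁ a b c ↔ ∃ d, H.IsCorrelated a b c d := hmark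
  clear_value s₁
  refine (Run.forLoop_le 290 (fun l s' => ∃ L', L <+: L' ∧ Queue n S s' L' ∧ Reach H P x₀ L' ∧
    ∀ w < l, ((H.Conflict x y w ∨ ∃ d, H.IsCorrelated w x y d) → (w, y) ∈ P ∨ (w, y) ∈ L') ∧
      ((H.Conflict w x y ∨ ∃ d, H.IsCorrelated y w x d) → (x, w) ∈ P ∨ (x, w) ∈ L'))
    T₁.n_eq (by decide) ?_ ?_ ⟨L, List.prefix_rfl, hL₁, hR, by simp⟩ ?_ ?_).mono ?_
  · simp [push, storeCell, Program.regs, hS2']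
  · simp [push, storeCell, Program.regs, hS2']
  · rintro l s' v ⟨L', h1, h2, h3⟩
    refine ⟨L', h1, h2.frame ((Frame.refl [4] [] _).setReg (by simp) v) (by simp [hS2]) (by simp), h3⟩
  · rintro l s₂ hl hi₂ f₂ ⟨L₂, p₂, q₂, r₂, d₂⟩
    have hregs : ∀ r, r ≠ 4 → r ≠ S.t → s₂.reg r = s₁.reg r := fun r h4 ht => f₂.1 r (by
      simp [push, storeCell, Program.regs, h4, ht])
    have hmems : ∀ a, a ≠ S.M → a ≠ S.X → a ≠ S.Y → s₂.mem a = s₁.mem a := fun a h1 h2 h3 =>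
      f₂.2 a (by simp [push, storeCell, Program.arrs, h1, h2, h3])
    have fr₂ : Frame [4, S.t] [S.M, S.X, S.Y] s₁ s₂ := by
      refine ⟨fun r hr => ?_, fun a ha => ?_⟩
      · simp only [List.mem_cons, List.not_mem_nil, or_false, not_or] at hr
        exact hregs r hr.1 hr.2
      · simp only [List.mem_cons, List.not_mem_nil, or_false, not_or] at ha
        exact hmems a ha.1 ha.2.1 ha.2.2
    have T₂ : Tables H n m tl hd lw up s₂ := T₁.frame fr₂ (by simp [hS2'])
      (by simp [hS5'])
    have hP₂ : Rep n O s₂ P := hP₁.congr (hmems O hS4.1.1 hS4.1.2.1 hS4.1.2.2)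
    have hm₂ : s₂.mem 12 = s₁.mem 12 := hmems 12 (by simp [hS5']) (by simp [hS5']) (by simp [hS5'])
    have e9 : (Expr.reg 9).eval s₂ = x := by
      rw [Expr.eval, hregs 9 (by decide) (by simp [hS2']), hs₁]
      simp [reg_setReg, Ne.symm hh9]
    have e10 : (Expr.reg 10).eval s₂ = y := by
      rw [Expr.eval, hregs 10 (by decide) (by simp [hS2']), hs₁]
      simp [reg_setReg, Ne.symm hh10]
    have e4 : (Expr.reg 4).eval s₂ = l := hi₂
    have first : Run (.ite (.or (conflictTest (.reg 9) (.reg 10) (.reg 4))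
        (.eq (.load 12 (triple (.reg 9) (.reg 10) (.reg 4))) (.lit 1)))
        (push O S (.reg 4) (.reg 10)) .skip) s₂ fun s' t => Frame [S.t] [S.M, S.X, S.Y] s₂ s' ∧
        ∃ L', L₂ <+: L' ∧ Queue n S s' L' ∧ Reach H P x₀ L' ∧
        ((H.Conflict x y l ∨ ∃ d, H.IsCorrelated l x y d) → (l, y) ∈ P ∨ (l, y) ∈ L') ∧
        t ≤ 140 := by
      have hc : (Test.eq (.load 12 (triple (.reg 9) (.reg 10) (.reg 4))) (.lit 1)).holds s₂ ↔
          ∃ d, H.IsCorrelated l x y d := by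
        rw [← hm₁ l hl x hxn y hyn, IsMarked, ← hm₂, ← T₂.triple e4 e9 e10 hxn hyn]
        rfl
      rw [run_ite, Test.holds_or, T₂.conflictTest N e9 e10 e4 hxn hyn hl, hc, run_skip]
      constructor
      · intro h
        refine (push_spec T₂.toBase hS hP₂ q₂ e4 e10 hl hyn).mono
          fun s₃ t₃ f₃ ⟨L₃, p₃, q₃, h3, h4, h5⟩ =>
            ⟨f₃.mono (by simp [push, storeCell, Program.regs])
              (by simp [push, storeCell, Program.arrs]), L₃, p₃, q₃, fun z hz => ?_, fun _ => h3,
              ?_⟩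
        · rcases h4 z hz with hz | ⟨rfl, hzP⟩
          · exact r₂ z hz
          · exact ⟨hzP, hfor.tail (h.elim (fun h => .imp (.left h)) fun ⟨d, h⟩ => .left h)⟩
        · exact (Nat.add_le_add_left h5 _).trans (Nat.le_of_ble_eq_true rfl)
      · exact fun h => ⟨.refl _ _ _, L₂, List.prefix_rfl, q₂, r₂, fun h' => absurd h' h,
          Nat.le_of_ble_eq_true rfl⟩
    rw [run_seq]
    refine first.mono fun s₃ t₃ _ ⟨f₃, L₃, p₃, q₃, r₃, d₃, ht₃⟩ => ?_
    have T₃ : Tables H n m tl hd lw up s₃ := T₂.frame f₃ (by simp [hS2'])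
      (by simp [hS5'])
    have hmems₃ : ∀ a, a ≠ S.M → a ≠ S.X → a ≠ S.Y → s₃.mem a = s₂.mem a := fun a h1 h2 h3 =>
      f₃.2 a (by simp [h1, h2, h3])
    have hP₃ : Rep n O s₃ P := hP₂.congr (hmems₃ O hS4.1.1 hS4.1.2.1 hS4.1.2.2)
    have hm₃ : s₃.mem 12 = s₁.mem 12 :=
      (hmems₃ 12 (by simp [hS5']) (by simp [hS5']) (by simp [hS5'])).trans hm₂
    have k9 : (Expr.reg 9).eval s₃ = x := (f₃.1 9 (by simp [hS2'])).trans e9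
    have k10 : (Expr.reg 10).eval s₃ = y := (f₃.1 10 (by simp [hS2'])).trans e10
    have k4 : (Expr.reg 4).eval s₃ = l := (f₃.1 4 (by simp [hS2'])).trans e4
    have hc : (Test.eq (.load 12 (triple (.reg 4) (.reg 9) (.reg 10))) (.lit 1)).holds s₃ ↔
        ∃ d, H.IsCorrelated y l x d := by
      rw [← hm₁ y hyn l hl x hxn, IsMarked, ← hm₃, ← T₃.triple k10 k4 k9 hl hxn]
      rfl
    rw [run_ite, Test.holds_or, T₃.conflictTest N k4 k9 k10 hl hxn hyn, hc, run_skip]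
    have hstep : ∀ L', L₃ <+: L' → ((H.Conflict l x y ∨ ∃ d, H.IsCorrelated y l x d) →
        (x, l) ∈ P ∨ (x, l) ∈ L') → ∀ w < l + 1,
        ((H.Conflict x y w ∨ ∃ d, H.IsCorrelated w x y d) → (w, y) ∈ P ∨ (w, y) ∈ L') ∧
        ((H.Conflict w x y ∨ ∃ d, H.IsCorrelated y w x d) → (x, w) ∈ P ∨ (x, w) ∈ L') := by
      intro L' hL' h w hw
      rcases Nat.lt_succ_iff_lt_or_eq.1 hw with hw | rfl
      · exact ⟨fun h => ((d₂ w hw).1 h).imp_right fun h => hL'.subset (p₃.subset h),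
          fun h => ((d₂ w hw).2 h).imp_right fun h => hL'.subset (p₃.subset h)⟩
      · exact ⟨fun h => (d₃ h).imp_right fun h => hL'.subset h, h⟩
    constructor
    · intro h
      refine (push_spec T₃.toBase hS hP₃ q₃ k9 k4 hxn hl).mono
        fun s₄ t₄ f₄ ⟨L₄, p₄, q₄, h3, h4, h5⟩ =>
          ⟨⟨L₄, p₂.trans (p₃.trans p₄), q₄, fun z hz => ?_, hstep L₄ p₄ fun _ => h3⟩, ?_⟩
      · rcases h4 z hz with hz | ⟨rfl, hzP⟩
        · exact r₃ z hz
        · exact ⟨hzP, hfor.tail (h.elim (fun h => .imp (.right h)) fun ⟨d, h⟩ => .right h)⟩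
      · exact (Nat.add_le_add ht₃ (Nat.add_le_add_left h5 _)).trans (Nat.le_of_ble_eq_true rfl)
    · exact fun h => ⟨⟨L₃, p₂.trans p₃, q₃, r₃, hstep L₃ List.prefix_rfl fun h' => absurd h' h⟩,
        (Nat.add_le_add_right ht₃ _).trans (Nat.le_of_ble_eq_true rfl)⟩
  · rintro s₂ t₂ f₂ ⟨⟨L₂, p₂, q₂, r₂, d₂⟩, ht₂⟩
    refine ⟨?_, L₂, p₂, q₂, r₂, ?_, by omega⟩
    · rw [f₂.1 S.h, hs₁]
      · simp [reg_setReg]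
      · simp [forLoop, push, storeCell, Program.regs, hS1, hS3]
    · intro i hi hik z hz
      have hiL : i < L.length := by omega
      rcases Nat.lt_succ_iff_lt_or_eq.1 hik with hik | rfl
      · exact hD.mono hkL.le p₂ i hi hik z hz
      · rw [← p₂.getElem hiL, hxy] at hz
        obtain ⟨w, ⟨rfl, h⟩ | ⟨rfl, h⟩⟩ := exists_of_aug hz
        · have hw : w < n := h.elim (fun h => N.lt_right h.2.1)
            fun ⟨d, h⟩ => N.lt_left (mono_of_isCorrelated N h).1.1.1
          exact (d₂ w hw).1 h
        · have hw : w < n := h.elim (fun h => N.lt_left h.1)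
            fun ⟨d, h⟩ => N.lt_right (mono_of_isCorrelated N h).1.1.1
          exact (d₂ w hw).2 h

theorem commit_spec {s : State} (B : Base n m tl hd s) {O : ℕ} {S : Side} (hS : S.Good O)
    {P : Finset (ℕ × ℕ)} (hP : Rep n O s P) {L : List (ℕ × ℕ)} (hL : Queue n S s L)
    (hLn : ∀ x ∈ L, x.1 < n ∧ x.2 < n) :
    Run (commit O S) s fun s' t => Rep n O s' (P ∪ L.toFinset) ∧ t ≤ 30 * L.length + 6 := by
  obtain ⟨⟨hS1, hS2, hS3⟩, hS4, hS5⟩ := hS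
  simp only [List.nodup_cons, List.mem_cons, List.not_mem_nil, or_false, not_or,
    forall_eq_or_imp, forall_eq] at hS1 hS2 hS4 hS5
  have hS2' := hS2
  have hS5' := hS5
  simp only [eq_comm (a := S.t)] at hS2'
  simp only [eq_comm (a := O)] at hS5'
  refine (Run.forLoop_le 22 (fun k s' => Rep n O s' (P ∪ (L.take k).toFinset)) hL.len (by simp [hS2])
    (by simp [storeCell, Program.regs]) (by simp [storeCell, Program.regs]) (by simpa using hP)
    (fun k s v h => h.congr rfl) ?_).mono ?_
  · intro k s₁ hk hi f₁ h
    have B₁ := B.frame f₁ (by simp [storeCell, Program.regs])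
      (by simp [storeCell, Program.arrs, hS5'])
    have eX : s₁.mem S.X = s.mem S.X := f₁.2 _ (by simp [storeCell, Program.arrs]; tauto)
    have eY : s₁.mem S.Y = s.mem S.Y := f₁.2 _ (by simp [storeCell, Program.arrs]; tauto)
    have e1 : (Expr.load S.X (.reg 5)).eval s₁ = L[k].1 := by
      simp [Expr.eval, hi, eX, hL.fst k hk]
    have e2 : (Expr.load S.Y (.reg 5)).eval s₁ = L[k].2 := by
      simp [Expr.eval, hi, eY, hL.snd k hk]
    have hkn := hLn _ (List.getElem_mem hk)
    rw [B₁.storeCell _ (by rw [e1]; exact hkn.1), e1, e2]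
    refine ⟨?_, Nat.le_of_ble_eq_true rfl⟩
    have := h.insert (a := L[k].1) hkn.2
    have e : P ∪ (L.take (k + 1)).toFinset =
        insert (L[k].1, L[k].2) (P ∪ (L.take k).toFinset) := by
      ext z
      rw [List.take_succ_eq_append_getElem hk]
      simp only [List.toFinset_append, Finset.mem_union, List.mem_toFinset,
        Finset.mem_insert, List.toFinset_cons, List.toFinset_nil, insert_empty_eq,
        Finset.mem_singleton]
      tauto
    rw [e]
    exact this
  · rintro s₁ t₁ - ⟨h1, h2⟩
    rw [List.take_length] at h1
    exact ⟨h1, h2⟩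

end

/-! ### Counting arcs and the invariant of a search -/

section

variable {H : MultilabelTemporalGraph ℕ} {n m : ℕ} {tl hd : ℕ → ℕ} {lw up : ℕ → ℕ → ℕ}

theorem card_le_of_adj (N : Net H n m tl hd lw up) {P : Finset (ℕ × ℕ)}
    (hP : ∀ x ∈ P, H.graph.Adj x.1 x.2) : P.card ≤ 2 * m := by
  have hsub : P ⊆ (Finset.range m).image (fun j => (tl j, hd j)) ∪
      (Finset.range m).image (fun j => (hd j, tl j)) := by
    rintro ⟨a, b⟩ hx
    obtain ⟨j, hj, ⟨rfl, rfl⟩ | ⟨rfl, rfl⟩⟩ := (N.adj_iff a b).1 (hP _ hx)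
    · exact Finset.mem_union_left _ (Finset.mem_image.2 ⟨j, Finset.mem_range.2 hj, rfl⟩)
    · exact Finset.mem_union_right _ (Finset.mem_image.2 ⟨j, Finset.mem_range.2 hj, rfl⟩)
  have h1 := Finset.card_le_card hsub
  have h2 := Finset.card_union_le ((Finset.range m).image (fun j => (tl j, hd j)))
    ((Finset.range m).image (fun j => (hd j, tl j)))
  have h3 : ((Finset.range m).image (fun j => (tl j, hd j))).card ≤ m :=
    Finset.card_image_le.trans (Finset.card_range m).le
  have h4 : ((Finset.range m).image (fun j => (hd j, tl j))).card ≤ m :=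
    Finset.card_image_le.trans (Finset.card_range m).le
  omega

theorem Reach.adj {P : Finset (ℕ × ℕ)} {x : ℕ × ℕ} {L : List (ℕ × ℕ)} (h : Reach H P x L)
    (hx : H.graph.Adj x.1 x.2) : ∀ y ∈ L, H.graph.Adj y.1 y.2 := fun y hy => (h y hy).2.adj hx

/-- The basis of the amortised analysis: every arc of the queue enlarges the committed set by one.
-/
theorem Reach.card_union {P : Finset (ℕ × ℕ)} {x : ℕ × ℕ} {L : List (ℕ × ℕ)} (h : Reach H P x L)
    (hL : L.Nodup) : (P ∪ L.toFinset).card = P.card + L.length := by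
  rw [Finset.card_union_of_disjoint, List.toFinset_card_of_nodup hL]
  rw [Finset.disjoint_right]
  exact fun y hy => (h y (List.mem_toFinset.1 hy)).1

theorem Reach.adj_union {P : Finset (ℕ × ℕ)} {x : ℕ × ℕ} {L : List (ℕ × ℕ)} (h : Reach H P x L)
    (hx : H.graph.Adj x.1 x.2) (hP : ∀ x ∈ P, H.graph.Adj x.1 x.2) :
    ∀ y ∈ P ∪ L.toFinset, H.graph.Adj y.1 y.2 := fun y hy =>
  (Finset.mem_union.1 hy).elim (hP y) fun hy => h.adj hx y (List.mem_toFinset.1 hy)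

/-- Used for the termination of the searches, with the distance of the queue head from `2 * m` as
measure. -/
theorem Reach.length_le (N : Net H n m tl hd lw up) {P : Finset (ℕ × ℕ)} {x : ℕ × ℕ}
    {L : List (ℕ × ℕ)} (h : Reach H P x L) (hL : L.Nodup) (hx : H.graph.Adj x.1 x.2)
    (hP : ∀ x ∈ P, H.graph.Adj x.1 x.2) : L.length ≤ 2 * m := by
  have h1 := card_le_of_adj N (h.adj_union hx hP)
  rw [h.card_union hL] at h1
  omega

theorem Done.mem_of_forces {P : Finset (ℕ × ℕ)} {L : List (ℕ × ℕ)} (h : Done H P L.length L)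
    (hP : ∀ x ∈ P, ∀ y, H.Aug x y → y ∈ P) {x y : ℕ × ℕ} (hx : x ∈ L) (hxy : H.Forces x y) :
    y ∈ P ∨ y ∈ L := by
  induction hxy with
  | refl => exact Or.inr hx
  | tail _ h' ih =>
    rcases ih with ih | ih
    · exact Or.inl (hP _ ih _ h')
    · obtain ⟨i, hi, rfl⟩ := List.getElem_of_mem ih
      exact h i hi hi _ h'

theorem Done.coe_union {P : Finset (ℕ × ℕ)} {L : List (ℕ × ℕ)} (h : Done H P L.length L)
    (hP : ∀ x ∈ P, ∀ y, H.Aug x y → y ∈ P) {x : ℕ × ℕ} (hx : x ∈ L) (hR : Reach H P x L) :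
    ((P ∪ L.toFinset : Finset (ℕ × ℕ)) : Set (ℕ × ℕ)) = ↑P ∪ {y | H.Forces x y} := by
  ext y
  simp only [Finset.coe_union, List.coe_toFinset, Set.mem_union, Finset.mem_coe, Set.mem_ofPred_eq]
  constructor
  · exact fun hy => hy.imp_right fun hy => (hR y hy).2
  · exact fun hy => hy.elim Or.inl fun hy => h.mem_of_forces hP hx hy

/-- The search that is finished first yields a consistent set. -/
theorem Done.not_forces_swap {P : Finset (ℕ × ℕ)} {L L' : List (ℕ × ℕ)}
    (h : Done H P L.length L) (hP : ∀ x ∈ P, ∀ y, H.Aug x y → y ∈ P) {x : ℕ × ℕ} (hx : x ∈ L)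
    (hadj : H.graph.Adj x.1 x.2) (hR' : Reach H P x.swap L') (hL : L.Nodup) (hL' : L'.Nodup)
    (hle : L.length ≤ L'.length) (hO : ∃ O, H.IsAMTTO O) : ¬ H.Forces x x.swap := by
  intro hf
  -- If `x` forced its reverse, everything found from the reverse would be found from `x`. As `L` is
  -- not longer, the lists have the same members.
  have hsub : L' ⊆ L := fun y hy =>
    (h.mem_of_forces hP hx (hf.trans (hR' y hy).2)).resolve_left (hR' y hy).1
  have heq : L'.toFinset = L.toFinset := by
    refine Finset.eq_of_subset_of_card_le (fun y hy => ?_) ?_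
    · exact List.mem_toFinset.2 (hsub (List.mem_toFinset.1 hy))
    · rwa [List.toFinset_card_of_nodup hL, List.toFinset_card_of_nodup hL']
  have hx' : x ∈ L' := by rwa [← List.mem_toFinset, heq, List.mem_toFinset]
  -- Now the reverse of `x` forces `x` too, and no AMTTO can contain either of them.
  have hb := (hR' x hx').2
  obtain ⟨O, hO⟩ := hO
  rcases hO.total hadj with h1 | h1
  · exact hO.asymm h1 (Forces.mem hO.closed hf h1)
  · exact hO.asymm h1 (Forces.mem hO.closed hb h1)

/-- The set `P` with its arcs represented in the matrix `O`. -/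
structure Holds (H : MultilabelTemporalGraph ℕ) (n O : ℕ) (s : State) (P : Finset (ℕ × ℕ)) :
    Prop where
  rep : Rep n O s P
  adj : ∀ x ∈ P, H.graph.Adj x.1 x.2

theorem Holds.congr {O : ℕ} {s s' : State} {P : Finset (ℕ × ℕ)} (h : Holds H n O s P)
    (h' : s'.mem O = s.mem O) : Holds H n O s' P := ⟨h.rep.congr h', h.adj⟩

/-- The tables and the marks for correlated monolabel triangles. -/
structure Ready (H : MultilabelTemporalGraph ℕ) (n m : ℕ) (tl hd : ℕ → ℕ) (lw up : ℕ → ℕ → ℕ)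
    (s : State) : Prop extends Tables H n m tl hd lw up s where
  marked : ∀ a < n, ∀ b < n, ∀ c < n, IsMarked n s a b c ↔ ∃ d, H.IsCorrelated a b c d

theorem Ready.frame {s s' : State} {R A : List ℕ} (h : Ready H n m tl hd lw up s)
    (hf : Frame R A s s') (hR : 0 ∉ R ∧ 1 ∉ R)
    (hA : 0 ∉ A ∧ 1 ∉ A ∧ 5 ∉ A ∧ 6 ∉ A ∧ 7 ∉ A ∧ 8 ∉ A ∧ 9 ∉ A ∧ 12 ∉ A) :
    Ready H n m tl hd lw up s' where
  toTables := h.toTables.frame hf hR (by tauto)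
  marked := by
    have := h.marked
    simpa only [IsMarked, hf.2 12 (by tauto)] using this

/-- An unfinished search from `x`. -/
structure Search (H : MultilabelTemporalGraph ℕ) (n : ℕ) (S : Side) (P : Finset (ℕ × ℕ))
    (x : ℕ × ℕ) (s : State) (k : ℕ) (L : List (ℕ × ℕ)) : Prop where
  head : s.reg S.h = k
  queue : Queue n S s L
  reach : Reach H P x L
  mem : x ∈ L
  done : Done H P k L
  le : k ≤ L.length

theorem Search.frame {S : Side} {P : Finset (ℕ × ℕ)} {x : ℕ × ℕ} {s s' : State} {k : ℕ}
    {L : List (ℕ × ℕ)} (h : Search H n S P x s k L) {R A : List ℕ} (hf : Frame R A s s')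
    (hR : S.h ∉ R ∧ S.t ∉ R ∧ 15 ∉ R) (hA : S.M ∉ A ∧ S.X ∉ A ∧ S.Y ∉ A) :
    Search H n S P x s' k L :=
  ⟨(hf.1 _ hR.1).trans h.head, h.queue.frame hf hR.2 hA, h.reach, h.mem, h.done, h.le⟩

theorem start_spec {s : State} (B : Base n m tl hd s) {O : ℕ} {S : Side} (hS : S.Good O)
    {P : Finset (ℕ × ℕ)} (hP : Rep n O s P) (hM : ∀ i, s.mem S.M i < s.reg 15)
    {x y a b : ℕ} (hx : s.reg x = a) (hy : s.reg y = b) (ha : a < n) (hb : b < n)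
    (hxS : x ≠ S.h ∧ x ≠ S.t) (hyS : y ≠ S.h ∧ y ≠ S.t) (hab : (a, b) ∉ P) :
    Run (startQueue O S (.reg x) (.reg y)) s fun s' t =>
      (∃ L, Search H n S P (a, b) s' 0 L) ∧ t ≤ 50 :=
  (startQueue_spec B hS hP hM hx hy ha hb hxS hyS hab).mono
    fun _ _ _ ⟨h0, L, h1, h2, h3, h4⟩ =>
      ⟨⟨L, h0, h1, h3, h2, fun i _ hi => absurd hi (by omega), by omega⟩, h4⟩

theorem Search.expand (N : Net H n m tl hd lw up) {s : State} (T : Ready H n m tl hd lw up s)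
    {O : ℕ} {S : Side} (hS : S.Good O) {P : Finset (ℕ × ℕ)} (hP : Rep n O s P)
    {x : ℕ × ℕ} (hx : H.graph.Adj x.1 x.2) {k : ℕ} {L : List (ℕ × ℕ)}
    (h : Search H n S P x s k L) (hk : k < L.length) :
    Run (expand O S) s fun s' t => (∃ L', Search H n S P x s' (k + 1) L') ∧ t ≤ 300 * n + 30 :=
  (expand_spec N T.toTables T.marked hS hP h.queue hx h.reach h.head hk h.done).mono
    fun _ _ _ ⟨h1, L', h2, h3, h4, h5, h6⟩ =>
      ⟨⟨L', h1, h3, h4, h2.subset h.mem, h5, hk.trans_le h2.length_le⟩, h6⟩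

end

/-! ### Two competing searches -/

section

variable {H : MultilabelTemporalGraph ℕ} {n m : ℕ} {tl hd : ℕ → ℕ} {lw up : ℕ → ℕ → ℕ}

/-- The set of arcs that a search has found is added to the matrix `O`. -/
theorem Search.commit (N : Net H n m tl hd lw up) {s : State} (T : Ready H n m tl hd lw up s)
    {O : ℕ} {S : Side} (hS : S.Good O) {P : Finset (ℕ × ℕ)} (hP : Holds H n O s P)
    {x : ℕ × ℕ} (hx : H.graph.Adj x.1 x.2) {k : ℕ} {L : List (ℕ × ℕ)}
    (h : Search H n S P x s k L) :
    Run (commit O S) s fun s' t => Holds H n O s' (P ∪ L.toFinset) ∧ t ≤ 30 * L.length + 6 :=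
  (commit_spec T.toBase hS hP.rep h.queue fun y hy =>
    ⟨N.lt_left (h.reach.adj hx y hy), N.lt_right (h.reach.adj hx y hy)⟩).mono
    fun _ _ _ ⟨h1, h2⟩ => ⟨⟨h1, h.reach.adj_union hx hP.adj⟩, h2⟩

/-- As both searches expand one arc per pass, the abandoned one has cost no more than a constant
times `n` per committed arc. So the time is at most the growth of the potential `1000 * (n *
P.card)`. Time and growth are bounded unconditionally; only consistency needs the existence of an
AMTTO. -/
theorem race_spec (N : Net H n m tl hd lw up) {s : State} (T : Ready H n m tl hd lw up s)
    {P : Finset (ℕ × ℕ)} (hP : Holds H n 13 s P) {p q : ℕ} (h7 : s.reg 7 = p) (h8 : s.reg 8 = q)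
    (hpq : H.graph.Adj p q) (hp : (p, q) ∉ P) (hq : (q, p) ∉ P)
    (hM : ∀ i, s.mem 16 i ≤ s.reg 15 ∧ s.mem 17 i ≤ s.reg 15) :
    Run race s fun s' t => ∃ P', P ⊆ P' ∧ Holds H n 13 s' P' ∧ ((p, q) ∈ P' ∨ (q, p) ∈ P') ∧
      (∀ i, s'.mem 16 i ≤ s'.reg 15 ∧ s'.mem 17 i ≤ s'.reg 15) ∧
      t + 1000 * (n * P.card) ≤ 1000 * (n * P'.card) ∧
      ((∃ O, H.IsAMTTO O) → H.IsPartial P → H.IsPartial P') := by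
  have hpn := N.lt_left hpq
  have hqn := N.lt_right hpq
  have hG₁ : side₁.Good 13 := by decide
  have hG₂ : side₂.Good 13 := by decide
  rw [race, run_seq, run_assign]
  set s₁ := s.setReg 15 ((Expr.add (.reg 15) (.lit 1)).eval s) with hs₁
  have f₁ : Frame [15] [] s s₁ := (Frame.refl _ _ _).setReg (by simp) _
  have T₁ := T.frame f₁ (by decide) (by decide)
  have h15 : s₁.reg 15 = s.reg 15 + 1 := by simp [hs₁, reg_setReg, Expr.eval]
  have hm₁ : s₁.mem = s.mem := rfl
  have hP₁ : Holds H n 13 s₁ P := hP.congr rfl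
  have h7₁ : s₁.reg 7 = p := by rw [f₁.1 7 (by decide), h7]
  have h8₁ : s₁.reg 8 = q := by rw [f₁.1 8 (by decide), h8]
  clear_value s₁
  refine (start_spec (H := H) T₁.toBase hG₁ hP₁.rep (fun i => ?_) h7₁ h8₁ hpn hqn (by decide) (by decide)
    hp).seq fun s₂ t₂ f₂ ⟨⟨L₁, S₁⟩, ht₂⟩ => ?_
  · have := (hM i).1
    simp only [hm₁, h15, side₁]
    omega
  have T₂ := T₁.frame f₂ (by decide) (by decide)
  have hP₂ := hP₁.congr (f₂.2 13 (by decide))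
  have h7₂ : s₂.reg 7 = p := by rw [f₂.1 7 (by decide), h7₁]
  have h8₂ : s₂.reg 8 = q := by rw [f₂.1 8 (by decide), h8₁]
  refine (start_spec (H := H) T₂.toBase hG₂ hP₂.rep (fun i => ?_) h8₂ h7₂ hqn hpn (by decide) (by decide)
    hq).seq fun s₃ t₃ f₃ ⟨⟨L₂, S₂⟩, ht₃⟩ => ?_
  · have := (hM i).2
    have e1 : s₂.mem 17 = s.mem 17 := by rw [f₂.2 17 (by decide), hm₁]
    have e2 : s₂.reg 15 = s.reg 15 + 1 := by rw [f₂.1 15 (by decide), h15]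
    simp only [side₂, e1, e2]
    omega
  have T₃ := T₂.frame f₃ (by decide) (by decide)
  have hP₃ := hP₂.congr (f₃.2 13 (by decide))
  have S₁' := S₁.frame f₃ (by decide) (by decide)
  have hloop := Run.loop (b := .and (.lt (.reg 11) (.reg 12)) (.lt (.reg 13) (.reg 14)))
    (p := .seq (expand 13 side₁) (expand 13 side₂)) (s₀ := s₃)
    (fun s' T => ∃ r L₁ L₂, Search H n side₁ P (p, q) s' r L₁ ∧ Search H n side₂ P (q, p) s' r L₂ ∧
      T ≤ r * (600 * n + 68)) (fun s' => 2 * m - s'.reg 11) ⟨0, L₁, L₂, S₁', S₂, by simp⟩ ?_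
  · refine hloop.seq fun s₄ t₄ f₄ ⟨hnot, _, ⟨r, L₁, L₂, S₁, S₂, hr⟩, ht₄⟩ => ?_
    have T₄ := T₃.frame f₄ (by decide) (by decide)
    have hP₄ := hP₃.congr (f₄.2 13 (by decide))
    have l₁ : s₄.reg 12 = L₁.length := S₁.queue.len
    have l₂ : s₄.reg 14 = L₂.length := S₂.queue.len
    have r₁ : s₄.reg 11 = r := S₁.head
    have r₂ : s₄.reg 13 = r := S₂.head
    have le₁ := S₁.le
    have le₂ := S₂.le
    have pos₁ := List.length_pos_of_mem S₁.mem
    have pos₂ := List.length_pos_of_mem S₂.mem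
    -- With `r` positive, this absorbs all lower-order costs into a multiple of `n * r`.
    have hn : r ≤ n * r := Nat.le_mul_of_pos_left r (by omega)
    have hr' : r * (600 * n + 68) = 600 * (n * r) + 68 * r := by ring
    simp only [Test.holds, Expr.eval, l₁, l₂, r₁, r₂, not_and, not_lt] at hnot
    rw [run_ite]
    simp only [Test.holds, Expr.eval, Test.cost, Expr.cost, l₁, r₁] at ht₄ ⊢
    refine ⟨fun hlt => ?_, fun hlt => ?_⟩
    -- The second search is finished while the first has an unexpanded arc, so `L₂` is the shorter
    -- list, as `not_forces_swap` requires.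
    · have hL : L₂.length = r := by have := hnot hlt; omega
      refine (S₂.commit N T₄ hG₂ hP₄ hpq.symm).mono fun s₅ t₅ f₅ ⟨h, ht₅⟩ =>
        ⟨_, Finset.subset_union_left, h, Or.inr ?_, fun i => ⟨?_, ?_⟩, ?_, fun hO hpart => ?_⟩
      · exact Finset.mem_union_right _ (List.mem_toFinset.2 S₂.mem)
      · rw [f₅.2 16 (by decide), f₅.1 15 (by decide)]
        exact S₁.queue.le i
      · rw [f₅.2 17 (by decide), f₅.1 15 (by decide)]
        exact S₂.queue.le i
      · rw [S₂.reach.card_union S₂.queue.nodup, hL, mul_add]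
        simp only [hL] at *
        omega
      · rw [(hL ▸ S₂.done : Done H P L₂.length L₂).coe_union hpart.closed S₂.mem S₂.reach]
        exact hpart.extend hpq.symm hp ((hL ▸ S₂.done : Done H P L₂.length L₂).not_forces_swap
          hpart.closed S₂.mem hpq.symm S₁.reach S₂.queue.nodup S₁.queue.nodup (by omega) hO)
    · have hL : L₁.length = r := by omega
      refine (S₁.commit N T₄ hG₁ hP₄ hpq).mono fun s₅ t₅ f₅ ⟨h, ht₅⟩ =>
        ⟨_, Finset.subset_union_left, h, Or.inl ?_, fun i => ⟨?_, ?_⟩, ?_, fun hO hpart => ?_⟩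
      · exact Finset.mem_union_right _ (List.mem_toFinset.2 S₁.mem)
      · rw [f₅.2 16 (by decide), f₅.1 15 (by decide)]
        exact S₁.queue.le i
      · rw [f₅.2 17 (by decide), f₅.1 15 (by decide)]
        exact S₂.queue.le i
      · rw [S₁.reach.card_union S₁.queue.nodup, hL, mul_add]
        simp only [hL] at *
        omega
      · rw [(hL ▸ S₁.done : Done H P L₁.length L₁).coe_union hpart.closed S₁.mem S₁.reach]
        exact hpart.extend hpq hq ((hL ▸ S₁.done : Done H P L₁.length L₁).not_forces_swap
          hpart.closed S₁.mem hpq S₂.reach S₁.queue.nodup S₂.queue.nodup (by omega) hO)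
  · rintro s₄ t₄ f₄ hb ⟨r, L₁, L₂, S₁, S₂, hr⟩
    have l₁ : s₄.reg 12 = L₁.length := S₁.queue.len
    have l₂ : s₄.reg 14 = L₂.length := S₂.queue.len
    have r₁ : s₄.reg 11 = r := S₁.head
    have r₂ : s₄.reg 13 = r := S₂.head
    simp only [Test.holds, Expr.eval, l₁, l₂, r₁, r₂] at hb
    have T₄ := T₃.frame f₄ (by decide) (by decide)
    have hP₄ := hP₃.congr (f₄.2 13 (by decide))
    refine (S₁.expand N T₄ hG₁ hP₄.rep hpq hb.1).seq fun s₅ t₅ f₅ ⟨⟨L₁', S₁'⟩, ht₅⟩ => ?_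
    have T₅ := T₄.frame f₅ (by decide) (by decide)
    have hP₅ := hP₄.congr (f₅.2 13 (by decide))
    refine ((S₂.frame f₅ (by decide) (by decide)).expand N T₅ hG₂ hP₅.rep hpq.symm hb.2).mono
      fun s₆ t₆ f₆ ⟨⟨L₂', S₂'⟩, ht₆⟩ => ⟨⟨r + 1, L₁', L₂', S₁'.frame f₆ (by decide) (by decide), S₂',
        ?_⟩, ?_⟩
    · simp only [Test.cost, Expr.cost, add_mul]
      omega
    · have := S₁.reach.length_le N S₁.queue.nodup hpq hP.adj
      have e : s₆.reg 11 = r + 1 := (S₁'.frame f₆ (by decide) (by decide)).head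
      omega

end

/-! ### Finding an AMTTO, and saturation from one arc -/

section

variable {H : MultilabelTemporalGraph ℕ} {n m : ℕ} {tl hd : ℕ → ℕ} {lw up : ℕ → ℕ → ℕ}

theorem Rep.of_zero {O : ℕ} {s : State} (h : s.mem O = 0) : Rep n O s ∅ := by
  simp [Rep, h]

theorem Rep.fresh {O : ℕ} {s : State} {P : Finset (ℕ × ℕ)} (h : Rep n O s P)
    (B : Base n m tl hd s) {p q : ℕ} (h7 : s.reg 7 = p) (h8 : s.reg 8 = q) (hp : p < n)
    (hq : q < n) : (fresh O).holds s ↔ (p, q) ∉ P ∧ (q, p) ∉ P := by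
  have e7 : (Expr.reg 7).eval s = p := h7
  have e8 : (Expr.reg 8).eval s = q := h8
  simp only [RAM.fresh, Test.holds, B.cell _ (e7 ▸ hp : (Expr.reg 7).eval s < n),
    B.cell _ (e8 ▸ hq : (Expr.reg 8).eval s < n), e7, e8]
  exact and_congr (h p hp q hq).2 (h q hq p hp).2

theorem Rep.holds_cell {O : ℕ} {s : State} {P : Finset (ℕ × ℕ)} (h : Rep n O s P)
    (B : Base n m tl hd s) {x y : Expr} {p q : ℕ} (hx : x.eval s = p) (hy : y.eval s = q)
    (hp : p < n) (hq : q < n) : (Test.eq (cell O x y) (.lit 1)).holds s ↔ (p, q) ∈ P := by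
  simp only [Test.holds, B.cell _ (hx ▸ hp : x.eval s < n), hx, hy]
  exact (h p hp q hq).1

variable (N : Net H n m tl hd lw up)

include N

/-- Summing the potentials of the races gives at most `1000 * n` times the final number of arcs,
which is at most `2 * m`, whether or not the arcs are consistent. -/
theorem orient_spec {s : State} (T : Ready H n m tl hd lw up s)
    (h13 : s.mem 13 = 0) (h16 : s.mem 16 = 0) (h17 : s.mem 17 = 0) :
    Run orient s fun s' t => ∃ P, Holds H n 13 s' P ∧
      (∀ a b, H.graph.Adj a b → (a, b) ∈ P ∨ (b, a) ∈ P) ∧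
      ((∃ O, H.IsAMTTO O) → H.IsAMTTO P) ∧ t ≤ 2000 * (n * m) + 40 * m + 6 := by
  refine (Run.forLoop (fun k s' T => ∃ P, Holds H n 13 s' P ∧
    (∀ j < k, (tl j, hd j) ∈ P ∨ (hd j, tl j) ∈ P) ∧
    (∀ i, s'.mem 16 i ≤ s'.reg 15 ∧ s'.mem 17 i ≤ s'.reg 15) ∧
    T ≤ 1000 * (n * P.card) + 40 * k ∧ ((∃ O, H.IsAMTTO O) → H.IsPartial P)) T.m_eq (by decide)
    (by decide) (by decide) ?_ ?_ ?_).mono ?_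
  · exact ⟨∅, ⟨.of_zero h13, by simp⟩, by simp, by simp [h16, h17], by simp,
      fun _ => ⟨by simp, by simp, by simp⟩⟩
  · rintro k s₁ t₁ v ⟨P, h1, h2, h3, h4, h5⟩
    exact ⟨P, h1.congr rfl, h2, by simpa [reg_setReg, mem_setReg] using h3, h4, h5⟩
  · rintro k s₁ t₁ hk hi f₁ ⟨P, h1, h2, h3, h4, h5⟩
    have T₁ := T.frame f₁ (by decide) (by decide)
    have hadj := N.adj_edge hk
    rw [run_seq, T₁.toBase.readEdge (hi.trans_lt hk) (by decide), hi]
    set s₂ := (s₁.setReg 7 (tl k)).setReg 8 (hd k) with hs₂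
    have f₂ : Frame [7, 8] [] s₁ s₂ :=
      ((Frame.refl _ _ _).setReg (by decide) _).setReg (by decide) _
    have T₂ := T₁.frame f₂ (by decide) (by decide)
    have hP₂ : Holds H n 13 s₂ P := h1.congr rfl
    have h7 : s₂.reg 7 = tl k := by simp [hs₂, reg_setReg]
    have h8 : s₂.reg 8 = hd k := by simp [hs₂, reg_setReg]
    have h3₂ : ∀ i, s₂.mem 16 i ≤ s₂.reg 15 ∧ s₂.mem 17 i ≤ s₂.reg 15 := by
      simpa [hs₂, reg_setReg, mem_setReg] using h3
    rw [run_ite, hP₂.rep.fresh T₂.toBase h7 h8 (N.tl_lt k hk) (N.hd_lt k hk), run_skip]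
    constructor
    · rintro ⟨hp, hq⟩
      refine (race_spec N T₂ hP₂ h7 h8 hadj hp hq h3₂).mono
        fun s₃ t₃ _ ⟨P', h6, h7, h8, h9, h10, h11⟩ => ⟨P', h7, fun j hj => ?_, h9, ?_,
          fun hO => h11 hO (h5 hO)⟩
      · rcases Nat.lt_succ_iff_lt_or_eq.1 hj with hj | rfl
        · exact (h2 j hj).imp (fun h => h6 h) fun h => h6 h
        · exact h8
      · have e : (RAM.fresh 13).cost = 15 := rfl
        rw [e]
        omega
    · intro h
      refine ⟨P, hP₂, fun j hj => ?_, h3₂, ?_, h5⟩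
      · rcases Nat.lt_succ_iff_lt_or_eq.1 hj with hj | rfl
        · exact h2 j hj
        · tauto
      · have e : (RAM.fresh 13).cost = 15 := rfl
        rw [e]
        omega
  · rintro s₁ t₁ f₁ ⟨t, ⟨P, h1, h2, h3, h4, h5⟩, rfl⟩
    have hfull : ∀ a b, H.graph.Adj a b → (a, b) ∈ P ∨ (b, a) ∈ P := by
      intro a b hab
      obtain ⟨j, hj, ⟨rfl, rfl⟩ | ⟨rfl, rfl⟩⟩ := (N.adj_iff a b).1 hab
      · exact h2 j hj
      · exact (h2 j hj).symm
    refine ⟨P, h1, hfull, fun hO => (h5 hO).isAMTTO hfull, ?_⟩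
    have h6 : n * P.card ≤ n * (2 * m) := Nat.mul_le_mul_left n (card_le_of_adj N h1.adj)
    have h7 : n * (2 * m) = 2 * (n * m) := by ring
    omega

/-- A single search is enough here: that the arc does not force its reverse is ensured by the choice
of the vertex. -/
theorem saturate_spec {s : State} (T : Ready H n m tl hd lw up s)
    {P : Finset (ℕ × ℕ)} (hP : Holds H n 14 s P) {p q : ℕ} (h7 : s.reg 7 = p) (h8 : s.reg 8 = q)
    (hpq : H.graph.Adj p q) (hp : (p, q) ∉ P) (hM : ∀ i, s.mem 26 i ≤ s.reg 15) :
    Run saturate s fun s' t => ∃ P', P ⊆ P' ∧ Holds H n 14 s' P' ∧ (p, q) ∈ P' ∧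
      (∀ i, s'.mem 26 i ≤ s'.reg 15) ∧ t + 1000 * (n * P.card) ≤ 1000 * (n * P'.card) ∧
      (∀ x ∈ P', x ∈ P ∨ H.Forces (p, q) x) ∧
      ((q, p) ∉ P → ¬ H.Forces (p, q) (q, p) → H.IsPartial P → H.IsPartial P') := by
  have hpn := N.lt_left hpq
  have hqn := N.lt_right hpq
  have hG : side₃.Good 14 := by decide
  rw [saturate, run_seq, run_assign]
  set s₁ := s.setReg 15 ((Expr.add (.reg 15) (.lit 1)).eval s) with hs₁
  have f₁ : Frame [15] [] s s₁ := (Frame.refl _ _ _).setReg (by simp) _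
  have T₁ := T.frame f₁ (by decide) (by decide)
  have h15 : s₁.reg 15 = s.reg 15 + 1 := by simp [hs₁, reg_setReg, Expr.eval]
  have hm₁ : s₁.mem = s.mem := rfl
  have hP₁ : Holds H n 14 s₁ P := hP.congr rfl
  have h7₁ : s₁.reg 7 = p := by rw [f₁.1 7 (by decide), h7]
  have h8₁ : s₁.reg 8 = q := by rw [f₁.1 8 (by decide), h8]
  clear_value s₁
  refine (start_spec (H := H) T₁.toBase hG hP₁.rep (fun i => ?_) h7₁ h8₁ hpn hqn (by decide)
    (by decide) hp).seq fun s₂ t₂ f₂ ⟨⟨L, S⟩, ht₂⟩ => ?_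
  · have := hM i
    simp only [hm₁, h15, side₃]
    omega
  have T₂ := T₁.frame f₂ (by decide) (by decide)
  have hP₂ := hP₁.congr (f₂.2 14 (by decide))
  have hloop := Run.loop (b := .lt (.reg 11) (.reg 12)) (p := expand 14 side₃) (s₀ := s₂)
    (fun s' T => ∃ r L, Search H n side₃ P (p, q) s' r L ∧ T ≤ r * (300 * n + 34))
    (fun s' => 2 * m - s'.reg 11) ⟨0, L, S, by simp⟩ ?_
  · refine hloop.seq fun s₃ t₃ f₃ ⟨hnot, _, ⟨r, L, S, hr⟩, ht₃⟩ => ?_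
    have T₃ := T₂.frame f₃ (by decide) (by decide)
    have hP₃ := hP₂.congr (f₃.2 14 (by decide))
    have l₁ : s₃.reg 12 = L.length := S.queue.len
    have r₁ : s₃.reg 11 = r := S.head
    have le₁ := S.le
    have pos₁ := List.length_pos_of_mem S.mem
    have hn : r ≤ n * r := Nat.le_mul_of_pos_left r (by omega)
    have hr' : r * (300 * n + 34) = 300 * (n * r) + 34 * r := by ring
    simp only [Test.holds, Expr.eval, l₁, r₁, not_lt] at hnot
    have hL : L.length = r := by omega
    simp only [Test.cost, Expr.cost] at ht₃ ⊢
    refine (S.commit N T₃ hG hP₃ hpq).mono fun s₄ t₄ f₄ ⟨h, ht₄⟩ =>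
      ⟨_, Finset.subset_union_left, h, ?_, fun i => ?_, ?_, fun x hx => ?_, fun hq hn hpart => ?_⟩
    · exact Finset.mem_union_right _ (List.mem_toFinset.2 S.mem)
    · rw [f₄.2 26 (by decide), f₄.1 15 (by decide)]
      exact S.queue.le i
    · rw [S.reach.card_union S.queue.nodup, hL, mul_add]
      simp only [hL] at *
      omega
    · exact (Finset.mem_union.1 hx).imp_right fun hx => (S.reach x (List.mem_toFinset.1 hx)).2
    · rw [(hL ▸ S.done : Done H P L.length L).coe_union hpart.closed S.mem S.reach]
      exact hpart.extend hpq hq hn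
  · rintro s₃ t₃ f₃ hb ⟨r, L, S, hr⟩
    have l₁ : s₃.reg 12 = L.length := S.queue.len
    have r₁ : s₃.reg 11 = r := S.head
    simp only [Test.holds, Expr.eval, l₁, r₁] at hb
    have T₃ := T₂.frame f₃ (by decide) (by decide)
    have hP₃ := hP₂.congr (f₃.2 14 (by decide))
    refine (S.expand N T₃ hG hP₃.rep hpq hb).mono fun s₄ t₄ f₄ ⟨⟨L', S'⟩, ht₄⟩ =>
      ⟨⟨r + 1, L', S', ?_⟩, ?_⟩
    · simp only [Test.cost, Expr.cost, add_mul]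
      omega
    · have := S.reach.length_le N S.queue.nodup hpq hP.adj
      have e : s₄.reg 11 = r + 1 := S'.head
      omega

end

/-! ### Steady arcs and the choice of a vertex -/

/-- The `j`-th edge, oriented as in the set `P`. -/
def arc (tl hd : ℕ → ℕ) (P : Finset (ℕ × ℕ)) (j : ℕ) : ℕ × ℕ :=
  if (tl j, hd j) ∈ P then (tl j, hd j) else (hd j, tl j)

/-- The `j`-th arc of the orientation is not contained in a cyclic triangle. -/
def IsCalm (n : ℕ) (tl hd : ℕ → ℕ) (P : Finset (ℕ × ℕ)) (j : ℕ) : Prop :=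
  ∀ w < n, ¬ (((arc tl hd P j).2, w) ∈ P ∧ (w, (arc tl hd P j).1) ∈ P)

/-- The arrays `22`, `23` and `24` hold the first `k` arcs of the orientation and marks for those in
cyclic triangles. -/
def Arcs (n : ℕ) (tl hd : ℕ → ℕ) (P : Finset (ℕ × ℕ)) (k : ℕ) (s : State) : Prop :=
  ∀ j < k, s.mem 22 j = (arc tl hd P j).1 ∧ s.mem 23 j = (arc tl hd P j).2 ∧
    (s.mem 24 j ≠ 1 ↔ IsCalm n tl hd P j)

theorem Arcs.frame {n k : ℕ} {tl hd : ℕ → ℕ} {P : Finset (ℕ × ℕ)} {s s' : State}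
    (h : Arcs n tl hd P k s) {R A : List ℕ} (hf : Frame R A s s')
    (hA : 22 ∉ A ∧ 23 ∉ A ∧ 24 ∉ A) : Arcs n tl hd P k s' := by
  unfold Arcs
  rw [hf.2 _ hA.1, hf.2 _ hA.2.1, hf.2 _ hA.2.2]
  exact h

section

variable {H : MultilabelTemporalGraph ℕ} {n m : ℕ} {tl hd : ℕ → ℕ} {lw up : ℕ → ℕ → ℕ}

theorem arc_eq_or (P : Finset (ℕ × ℕ)) (j : ℕ) :
    arc tl hd P j = (tl j, hd j) ∨ arc tl hd P j = (hd j, tl j) := by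
  unfold arc
  split_ifs <;> simp

variable (N : Net H n m tl hd lw up)

include N

theorem arc_lt {P : Finset (ℕ × ℕ)} {j : ℕ} (hj : j < m) :
    (arc tl hd P j).1 < n ∧ (arc tl hd P j).2 < n := by
  rcases arc_eq_or (tl := tl) (hd := hd) P j with h | h <;> rw [h]
  · exact ⟨N.tl_lt j hj, N.hd_lt j hj⟩
  · exact ⟨N.hd_lt j hj, N.tl_lt j hj⟩

theorem flag_spec {s : State} (T : Ready H n m tl hd lw up s) {P : Finset (ℕ × ℕ)}
    (hP : Holds H n 13 s P) (h24 : s.mem 24 = 0) :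
    Run flag s fun s' t => Arcs n tl hd P m s' ∧ t ≤ 30 * (n * m) + 60 * m + 6 := by
  refine (Run.forLoop_le (30 * n + 50) (fun k s' => Arcs n tl hd P k s' ∧
    ∀ j, k ≤ j → s'.mem 24 j = 0) T.m_eq (by decide)
    (by decide) (by decide) ⟨by simp [Arcs], by simp [h24]⟩ (fun k s v h => h) ?_).mono ?_
  · rintro k s₁ hk hi f₁ ⟨h1, h2⟩
    have T₁ := T.frame f₁ (by decide) (by decide)
    have hP₁ := hP.congr (f₁.2 13 (by decide))
    have hadj := N.adj_edge hk
    have hlt := arc_lt N (P := P) hk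
    rw [run_seq, T₁.toBase.readEdge (hi.trans_lt hk) (by decide), hi]
    set s₂ := (s₁.setReg 7 (tl k)).setReg 8 (hd k) with hs₂
    have f₂ : Frame [7, 8] [] s₁ s₂ :=
      ((Frame.refl _ _ _).setReg (by decide) _).setReg (by decide) _
    have T₂ := T₁.frame f₂ (by decide) (by decide)
    have hP₂ : Holds H n 13 s₂ P := hP₁.congr rfl
    have h3 : s₂.reg 3 = k := by rw [f₂.1 3 (by decide), hi]
    have h7 : (Expr.reg 7).eval s₂ = tl k := by simp [hs₂, reg_setReg, Expr.eval]
    have h8 : (Expr.reg 8).eval s₂ = hd k := by simp [hs₂, reg_setReg, Expr.eval]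
    have horient : Run (.ite (.eq (cell 13 (.reg 7) (.reg 8)) (.lit 1)) .skip (readEdge 3 8 7)) s₂
        fun s' t => s'.reg 7 = (arc tl hd P k).1 ∧ s'.reg 8 = (arc tl hd P k).2 ∧
          s'.reg 3 = k ∧ t ≤ 14 := by
      rw [run_ite, hP₂.rep.holds_cell T₂.toBase h7 h8 (N.tl_lt k hk) (N.hd_lt k hk), run_skip,
        T₂.toBase.readEdge (h3.trans_lt hk) (by decide), h3]
      refine ⟨fun h => ⟨?_, ?_, rfl, Nat.le_of_ble_eq_true rfl⟩, fun h => ⟨?_, ?_, ?_,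
        Nat.le_of_ble_eq_true rfl⟩⟩
      · simpa [arc, h, Expr.eval] using h7
      · simpa [arc, h, Expr.eval] using h8
      · simp [arc, h, reg_setReg]
      · simp [arc, h, reg_setReg]
      · simp [reg_setReg, h3]
    refine horient.seq fun s₃ t₃ f₃ ⟨h7₃, h8₃, h3₃, ht₃⟩ => ?_
    have T₃ := T₂.frame f₃ (by decide) (by decide)
    have hP₃ := hP₂.congr (f₃.2 13 (by decide))
    have hm₃ : s₃.mem = s₁.mem := by
      funext a
      rw [f₃.2 a (by simp [readEdge, Program.arrs])]
      rfl
    clear_value s₂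
    simp only [run_seq, run_store, Expr.eval, Expr.cost, h3₃, h7₃, h8₃, reg_setMem]
    set s₄ := (s₃.setMem 22 k (arc tl hd P k).1).setMem 23 k (arc tl hd P k).2 with hs₄
    have f₄ : Frame [] [22, 23] s₃ s₄ :=
      ⟨fun _ _ => rfl, fun a ha => by
        funext i
        simp only [List.mem_cons, List.not_mem_nil, or_false, not_or] at ha
        simp [hs₄, mem_setMem, ha.1, ha.2]⟩
    have T₄ := T₃.frame f₄ (by decide) (by decide)
    have hP₄ := hP₃.congr (f₄.2 13 (by decide))
    have h24₄ : s₄.mem 24 = s₁.mem 24 := by rw [f₄.2 24 (by decide), hm₃]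
    have hreg₄ : s₄.reg = s₃.reg := rfl
    refine (Run.forLoop_le 20 (fun l s' => (∀ j, j ≠ k → s'.mem 24 j = s₁.mem 24 j) ∧
      (s'.mem 24 k ≠ 1 ↔ ∀ w < l, ¬ (((arc tl hd P k).2, w) ∈ P ∧ (w, (arc tl hd P k).1) ∈ P)))
      T₄.n_eq (by decide) (by decide) (by decide) ⟨by simp [h24₄], ?_⟩
      (fun k s v h => h) ?_).mono ?_
    · simp [h24₄, h2 k le_rfl]
    · rintro l s₅ hl hi₅ f₅ ⟨h5, h6⟩
      have T₅ := T₄.frame f₅ (by decide) (by decide)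
      have hP₅ := hP₄.congr (f₅.2 13 (by decide))
      have e7 : (Expr.reg 7).eval s₅ = (arc tl hd P k).1 := by
        rw [Expr.eval, f₅.1 7 (by decide), hreg₄, h7₃]
      have e8 : (Expr.reg 8).eval s₅ = (arc tl hd P k).2 := by
        rw [Expr.eval, f₅.1 8 (by decide), hreg₄, h8₃]
      have e3 : s₅.reg 3 = k := by rw [f₅.1 3 (by decide), hreg₄, h3₃]
      have e4 : (Expr.reg 4).eval s₅ = l := hi₅
      rw [run_ite, Test.holds, hP₅.rep.holds_cell T₅.toBase e8 e4 hlt.2 hl,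
        hP₅.rep.holds_cell T₅.toBase e4 e7 hl hlt.1, run_skip, run_store]
      simp only [Expr.eval, e3]
      refine ⟨fun h => ⟨⟨fun j hj => ?_, ?_⟩, Nat.le_of_ble_eq_true rfl⟩,
        fun h => ⟨⟨h5, ?_⟩, Nat.le_of_ble_eq_true rfl⟩⟩
      · simp [mem_setMem, hj, h5 j hj]
      · simp only [mem_setMem, and_self, if_true, ne_eq, not_true_eq_false, false_iff]
        exact fun h' => h' l (by omega) h
      · rw [h6]
        constructor
        · intro h7 w hw
          rcases Nat.lt_succ_iff_lt_or_eq.1 hw with hw | rfl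
          · exact h7 w hw
          · exact h
        · exact fun h7 w hw => h7 w (by omega)
    · rintro s₅ t₅ f₅ ⟨⟨h5, h6⟩, ht₅⟩
      refine ⟨⟨fun j hj => ?_, fun j hj => ?_⟩, by omega⟩
      · have e22 : s₅.mem 22 j = s₄.mem 22 j := congrFun (f₅.2 22 (by decide)) j
        have e23 : s₅.mem 23 j = s₄.mem 23 j := congrFun (f₅.2 23 (by decide)) j
        rw [e22, e23]
        by_cases hjk : j = k
        · subst hjk
          exact ⟨by simp [hs₄, mem_setMem], by simp [hs₄, mem_setMem], h6⟩
        · rw [h5 j hjk]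
          simp only [hs₄, mem_setMem, hjk, and_false, if_false, hm₃]
          exact h1 j (by omega)
      · rw [h5 j (by omega)]
        exact h2 j (by omega)
  · rintro s₁ t₁ - ⟨⟨h1, -⟩, h2⟩
    have e : (30 * n + 50 + 8) * m = 30 * (n * m) + 58 * m := by ring
    exact ⟨h1, by omega⟩

/-- Vertices entered by an undecided calm arc receive the stamp `r + 1` in round `r`. Older stamps
are at most `r`, so array `25` is never cleared. -/
theorem markBad_spec {s : State} (T : Ready H n m tl hd lw up s) {P Q : Finset (ℕ × ℕ)}
    (hQ : Holds H n 14 s Q) (hA : Arcs n tl hd P m s) {r : ℕ} (hr : s.reg 16 = r)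
    (h25 : ∀ v, s.mem 25 v ≤ r) :
    Run markBad s fun s' t => (∀ v, s'.mem 25 v ≤ r + 1) ∧
      (∀ v, s'.mem 25 v = r + 1 ↔ ∃ j < m, IsCalm n tl hd P j ∧ (arc tl hd P j).2 = v ∧
        (arc tl hd P j).swap ∉ Q ∧ arc tl hd P j ∉ Q) ∧ t ≤ 60 * m + 6 := by
  refine (Run.forLoop_le 50 (fun k s' => (∀ v, s'.mem 25 v ≤ r + 1) ∧
      (∀ v, s'.mem 25 v = r + 1 ↔ ∃ j < k, IsCalm n tl hd P j ∧ (arc tl hd P j).2 = v ∧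
        (arc tl hd P j).swap ∉ Q ∧ arc tl hd P j ∉ Q)) T.m_eq (by decide)
    (by decide) (by decide) ⟨fun v => (h25 v).trans (Nat.le_succ r), fun v => ?_⟩
    (fun k s v h => h) ?_).mono fun s' t _ ⟨⟨h1, h2⟩, h3⟩ => ⟨h1, h2, by omega⟩
  · have := h25 v
    simp
    omega
  · rintro k s₁ hk hi f₁ ⟨h1, h2⟩
    have T₁ := T.frame f₁ (by decide) (by decide)
    have hA₁ := hA.frame f₁ (by decide) k hk
    have hQ₁ := hQ.congr (f₁.2 14 (by decide))
    have hlt := arc_lt N (P := P) hk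
    have h16 : s₁.reg 16 = r := by rw [f₁.1 16 (by decide), hr]
    simp only [run_seq, run_assign, Expr.eval, Expr.cost, hi, hA₁.1, reg_setReg, mem_setReg]
    simp only [show ¬ (3 = 7) by decide, if_false, hA₁.2.1]
    set s₂ := (s₁.setReg 7 (arc tl hd P k).1).setReg 8 (arc tl hd P k).2 with hs₂
    have f₂ : Frame [7, 8] [] s₁ s₂ :=
      ((Frame.refl _ _ _).setReg (by decide) _).setReg (by decide) _
    have T₂ := T₁.frame f₂ (by decide) (by decide)
    have hQ₂ : Holds H n 14 s₂ Q := hQ₁.congr rfl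
    have h7 : s₂.reg 7 = (arc tl hd P k).1 := by simp [hs₂, reg_setReg]
    have h8 : s₂.reg 8 = (arc tl hd P k).2 := by simp [hs₂, reg_setReg]
    have h3 : s₂.reg 3 = k := by rw [f₂.1 3 (by decide), hi]
    have h16₂ : s₂.reg 16 = r := by rw [f₂.1 16 (by decide), h16]
    have hm₂ : s₂.mem = s₁.mem := rfl
    have hcalm : (Test.not (.eq (.load 24 (.reg 3)) (.lit 1))).holds s₂ ↔ IsCalm n tl hd P k := by
      rw [← hA₁.2.2, ← hm₂, ← h3]
      rfl
    rw [run_ite, Test.holds, hcalm, hQ₂.rep.fresh T₂.toBase h7 h8 hlt.1 hlt.2, run_skip, run_store]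
    simp only [Expr.eval, h8, h16₂]
    refine ⟨fun h => ⟨⟨fun v => ?_, fun v => ?_⟩, Nat.le_of_ble_eq_true rfl⟩,
      fun h => ⟨⟨h1, fun v => ?_⟩, Nat.le_of_ble_eq_true rfl⟩⟩
    · simp only [mem_setMem, hm₂]
      split_ifs
      · exact le_rfl
      · exact h1 v
    · simp only [mem_setMem, hm₂, true_and]
      split_ifs with hv
      · subst hv
        simp only [true_iff]
        exact ⟨k, by omega, h.1, rfl, h.2.2, h.2.1⟩
      · rw [h2 v]
        refine exists_congr fun j => ⟨fun ⟨h3, h4⟩ => ⟨by omega, h4⟩, fun ⟨h3, h4⟩ => ⟨?_, h4⟩⟩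
        refine (Nat.lt_succ_iff_lt_or_eq.1 h3).resolve_right ?_
        rintro rfl
        exact hv h4.2.1.symm
    · rw [hm₂, h2 v]
      refine exists_congr fun j => ⟨fun ⟨h3, h4⟩ => ⟨by omega, h4⟩, fun ⟨h3, h4⟩ => ⟨?_, h4⟩⟩
      refine (Nat.lt_succ_iff_lt_or_eq.1 h3).resolve_right ?_
      rintro rfl
      exact h ⟨h4.1, h4.2.2.2, h4.2.2.1⟩

/-- Scanning the undecided edges instead of the vertices meets every candidate, in time O(m). -/
theorem findVertex_spec {s : State} (T : Ready H n m tl hd lw up s) {Q : Finset (ℕ × ℕ)}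
    (hQ : Holds H n 14 s Q) {r : ℕ} (hr : s.reg 16 = r) :
    Run findVertex s fun s' t =>
      (s'.reg 18 = 1 → s.mem 25 (s'.reg 17) ≠ r + 1 ∧
        ∃ v, H.graph.Adj (s'.reg 17) v ∧ (s'.reg 17, v) ∉ Q ∧ (v, s'.reg 17) ∉ Q) ∧
      (s'.reg 18 ≠ 1 → ∀ u v, H.graph.Adj u v → (u, v) ∉ Q → (v, u) ∉ Q → s.mem 25 u = r + 1) ∧
      t ≤ 70 * m + 10 := by
  rw [findVertex, run_seq, run_assign]
  set s₀ := s.setReg 18 ((Expr.lit 0).eval s) with hs₀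
  have f₀ : Frame [18] [] s s₀ := (Frame.refl _ _ _).setReg (by decide) _
  have T₀ := T.frame f₀ (by decide) (by decide)
  refine (Run.forLoop_le 60 (fun k s' =>
      (s'.reg 18 = 1 → s.mem 25 (s'.reg 17) ≠ r + 1 ∧
        ∃ v, H.graph.Adj (s'.reg 17) v ∧ (s'.reg 17, v) ∉ Q ∧ (v, s'.reg 17) ∉ Q) ∧
      (s'.reg 18 ≠ 1 → ∀ j < k, (tl j, hd j) ∉ Q → (hd j, tl j) ∉ Q →
        s.mem 25 (tl j) = r + 1 ∧ s.mem 25 (hd j) = r + 1)) T₀.m_eq (by decide)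
    (by decide) (by decide) ⟨?_, by simp⟩ ?_ ?_).mono ?_
  · simp [hs₀, reg_setReg, Expr.eval]
  · rintro k s₁ v h
    simpa [reg_setReg] using h
  · rintro k s₁ hk hi f₁ ⟨h1, h2⟩
    have T₁ := T₀.frame f₁ (by decide) (by decide)
    have hQ₁ : Holds H n 14 s₁ Q := (hQ.congr (f₀.2 14 (by decide))).congr (f₁.2 14 (by decide))
    have hm₁ : s₁.mem 25 = s.mem 25 := by rw [f₁.2 25 (by decide), f₀.2 25 (by decide)]
    have h16 : s₁.reg 16 = r := by rw [f₁.1 16 (by decide), f₀.1 16 (by decide), hr]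
    have hadj := N.adj_edge hk
    rw [run_seq, T₁.toBase.readEdge (hi.trans_lt hk) (by decide), hi]
    set s₂ := (s₁.setReg 7 (tl k)).setReg 8 (hd k) with hs₂
    have f₂ : Frame [7, 8] [] s₁ s₂ :=
      ((Frame.refl _ _ _).setReg (by decide) _).setReg (by decide) _
    have T₂ := T₁.frame f₂ (by decide) (by decide)
    have hQ₂ : Holds H n 14 s₂ Q := hQ₁.congr rfl
    have h7 : s₂.reg 7 = tl k := by simp [hs₂, reg_setReg]
    have h8 : s₂.reg 8 = hd k := by simp [hs₂, reg_setReg]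
    have h16₂ : s₂.reg 16 = r := by rw [f₂.1 16 (by decide), h16]
    have h17 : s₂.reg 17 = s₁.reg 17 := f₂.1 17 (by decide)
    have h18 : s₂.reg 18 = s₁.reg 18 := f₂.1 18 (by decide)
    have hm₂ : s₂.mem 25 = s.mem 25 := hm₁
    rw [← h17, ← h18] at h1
    rw [← h18] at h2
    rw [run_ite, hQ₂.rep.fresh T₂.toBase h7 h8 (N.tl_lt k hk) (N.hd_lt k hk), run_skip]
    clear_value s₂
    constructor
    · rintro ⟨hp, hq⟩
      simp only [tryVertex, run_seq, run_ite, run_assign, run_skip, Test.holds, Expr.eval,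
        reg_setReg, mem_setReg, h7, h8, h16₂, hm₂, Expr.cost, Test.cost]
      have ef : (RAM.fresh 14).cost = 15 := rfl
      rw [ef]
      norm_num [h7, h8, h16₂]
      refine ⟨fun ht => ⟨fun hh => ⟨hh, _, hadj.symm, hq, hp⟩, fun _ => ⟨ht, _, hadj, hp, hq⟩⟩,
        fun ht => ⟨fun hh => ⟨hh, _, hadj.symm, hq, hp⟩, fun hh => ⟨h1, fun h18 j hj => ?_⟩⟩⟩
      rcases Nat.lt_or_eq_of_le hj with hj | rfl
      · exact h2 h18 j hj
      · exact fun _ _ => ⟨ht, hh⟩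
    · intro h
      refine ⟨⟨h1, fun h18 j hj hp hq => ?_⟩, Nat.le_of_ble_eq_true rfl⟩
      rcases Nat.lt_succ_iff_lt_or_eq.1 hj with hj | rfl
      · exact h2 h18 j hj hp hq
      · exact absurd ⟨hp, hq⟩ h
  · rintro s₁ t₁ - ⟨⟨h1, h2⟩, h3⟩
    refine ⟨h1, fun h18 u v huv hp hq => ?_, by simp only [Expr.cost]; omega⟩
    obtain ⟨j, hj, ⟨rfl, rfl⟩ | ⟨rfl, rfl⟩⟩ := (N.adj_iff u v).1 huv
    · exact (h2 h18 j hj hp hq).1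
    · exact (h2 h18 j hj hq hp).2

end

/-! ### One round: orienting the edges at a vertex -/

section

variable {H : MultilabelTemporalGraph ℕ} {n m : ℕ} {tl hd : ℕ → ℕ} {lw up : ℕ → ℕ → ℕ}

/-- Provides the hypotheses of `IsSolid.round`. Edges at `u` that have been decided in the meantime
by forcing are left alone. -/
theorem treatVertex_spec (N : Net H n m tl hd lw up) {s : State} (T : Ready H n m tl hd lw up s)
    {P : Finset (ℕ × ℕ)} (hP : Holds H n 14 s P) {u : ℕ} (hu : s.reg 17 = u)
    (hM : ∀ i, s.mem 26 i ≤ s.reg 15) :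
    Run treatVertex s fun s' t => ∃ Q, P ⊆ Q ∧ Holds H n 14 s' Q ∧
      (∀ i, s'.mem 26 i ≤ s'.reg 15) ∧
      t + 1000 * (n * P.card) ≤ 1000 * (n * Q.card) + 60 * m + 6 ∧
      (∀ x ∈ Q, x ∈ P ∨ ∃ v, (u, v) ∈ Q ∧ H.Forces (u, v) x) ∧
      (∀ v, H.graph.Adj u v → (u, v) ∈ Q ∨ (v, u) ∈ Q) ∧
      ((∀ v, H.graph.Adj u v → (u, v) ∉ P → (v, u) ∉ P → ¬ H.Forces (u, v) (v, u)) →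
        H.IsPartial P → H.IsPartial Q) := by
  refine (Run.forLoop (fun k s' T => ∃ Q, P ⊆ Q ∧ Holds H n 14 s' Q ∧
      (∀ i, s'.mem 26 i ≤ s'.reg 15) ∧
      T + 1000 * (n * P.card) ≤ 1000 * (n * Q.card) + 60 * k ∧
      (∀ x ∈ Q, x ∈ P ∨ ∃ v, (u, v) ∈ Q ∧ H.Forces (u, v) x) ∧
      (∀ j < k, tl j = u ∨ hd j = u → (tl j, hd j) ∈ Q ∨ (hd j, tl j) ∈ Q) ∧
      ((∀ v, H.graph.Adj u v → (u, v) ∉ P → (v, u) ∉ P → ¬ H.Forces (u, v) (v, u)) →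
        H.IsPartial P → H.IsPartial Q)) T.m_eq (by decide)
    (by decide) (by decide) ?_ ?_ ?_).mono ?_
  · exact ⟨P, subset_rfl, hP, hM, by simp, fun x hx => Or.inl hx, by simp, fun _ h => h⟩
  · rintro k s₁ t₁ v ⟨Q, h0, h1, h2, h3⟩
    exact ⟨Q, h0, h1.congr rfl, by simpa [reg_setReg, mem_setReg] using h2, h3⟩
  · rintro k s₁ t₁ hk hi f₁ ⟨Q, h1, h2, h3, h4, h5, h6, h7⟩
    have T₁ := T.frame f₁ (by decide) (by decide)
    have hadj := N.adj_edge hk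
    have hu₁ : s₁.reg 17 = u := by rw [f₁.1 17 (by decide), hu]
    rw [run_seq, T₁.toBase.readEdge (hi.trans_lt hk) (by decide), hi]
    set s₂ := (s₁.setReg 7 (tl k)).setReg 8 (hd k) with hs₂
    have f₂ : Frame [7, 8] [] s₁ s₂ :=
      ((Frame.refl _ _ _).setReg (by decide) _).setReg (by decide) _
    have T₂ := T₁.frame f₂ (by decide) (by decide)
    have e3 : s₂.reg 3 = k := by rw [f₂.1 3 (by decide), hi]
    have e7 : s₂.reg 7 = tl k := by simp [hs₂, reg_setReg]
    have e8 : s₂.reg 8 = hd k := by simp [hs₂, reg_setReg]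
    have e17 : s₂.reg 17 = u := by rw [f₂.1 17 (by decide), hu₁]
    have horient : Run (.ite (.eq (.reg 8) (.reg 17)) (readEdge 3 8 7) .skip) s₂
        fun s' t => (∃ a b, s'.reg 7 = a ∧ s'.reg 8 = b ∧ (a = tl k ∧ b = hd k ∧ hd k ≠ u ∨
          a = hd k ∧ b = tl k ∧ hd k = u)) ∧ t ≤ 10 := by
      rw [run_ite, run_skip, T₂.toBase.readEdge (e3.trans_lt hk) (by decide), e3]
      simp only [Test.holds, Expr.eval, e8, e17, Test.cost, Expr.cost]
      refine ⟨fun h => ⟨⟨hd k, tl k, by simp [reg_setReg], by simp [reg_setReg], ?_⟩, by omega⟩,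
        fun h => ⟨⟨tl k, hd k, e7, rfl, ?_⟩, by omega⟩⟩
      · exact Or.inr ⟨rfl, rfl, h⟩
      · exact Or.inl ⟨rfl, rfl, h⟩
    refine horient.seq fun s₃ t₃ f₃ ⟨⟨a, b, ha, hb, hab⟩, ht₃⟩ => ?_
    have T₃ := T₂.frame f₃ (by decide) (by decide)
    have hm₃ : s₃.mem = s₁.mem := by
      funext i
      rw [f₃.2 i (by simp [readEdge, Program.arrs])]
      rfl
    have hQ₃ : Holds H n 14 s₃ Q := h2.congr (by rw [hm₃])
    have h3₃ : ∀ i, s₃.mem 26 i ≤ s₃.reg 15 := by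
      rw [hm₃, f₃.1 15 (by decide), f₂.1 15 (by decide)]
      exact h3
    have e17₃ : s₃.reg 17 = u := by rw [f₃.1 17 (by decide), e17]
    have hadj' : H.graph.Adj a b := by
      rcases hab with ⟨rfl, rfl, -⟩ | ⟨rfl, rfl, -⟩
      exacts [hadj, hadj.symm]
    have hau : a = u ↔ tl k = u ∨ hd k = u := by
      rcases hab with ⟨rfl, rfl, h⟩ | ⟨rfl, rfl, h⟩ <;> tauto
    have hedge : ∀ R : Finset (ℕ × ℕ), (a, b) ∈ R ∨ (b, a) ∈ R ↔
        (tl k, hd k) ∈ R ∨ (hd k, tl k) ∈ R := fun R => by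
      rcases hab with ⟨rfl, rfl, -⟩ | ⟨rfl, rfl, -⟩
      · rfl
      · exact or_comm
    have ef : (RAM.fresh 14).cost = 15 := rfl
    rw [run_ite, Test.holds, hQ₃.rep.fresh T₃.toBase ha hb (N.lt_left hadj') (N.lt_right hadj'),
      run_skip]
    simp only [Test.holds, Expr.eval, ha, e17₃, Test.cost, Expr.cost, ef]
    constructor
    · rintro ⟨rfl, hp, hq⟩
      refine (saturate_spec N T₃ hQ₃ ha hb hadj' hp h3₃).mono
        fun s₄ t₄ f₄ ⟨Q', k1, k2, k3, k4, k5, k6, k7⟩ => ⟨Q', h1.trans k1, k2, k4, by omega,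
          fun x hx => ?_, fun j hj hj' => ?_, fun hF hpart => ?_⟩
      · rcases k6 x hx with hx | hx
        · exact (h5 x hx).imp_right fun ⟨v, hv⟩ => ⟨v, k1 hv.1, hv.2⟩
        · exact Or.inr ⟨b, k3, hx⟩
      · rcases Nat.lt_succ_iff_lt_or_eq.1 hj with hj | rfl
        · exact (h6 j hj hj').imp (fun h => k1 h) fun h => k1 h
        · exact (hedge Q').1 (Or.inl k3)
      · exact k7 hq (hF b hadj' (fun h => hp (h1 h)) fun h => hq (h1 h)) (h7 hF hpart)
    · intro h
      refine ⟨Q, h1, hQ₃, h3₃, by omega, h5, fun j hj hj' => ?_, h7⟩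
      rcases Nat.lt_succ_iff_lt_or_eq.1 hj with hj | rfl
      · exact h6 j hj hj'
      · rw [← hedge Q]
        have := hau.2 hj'
        tauto
  · rintro s₁ t₁ f₁ ⟨t, ⟨Q, h1, h2, h3, h4, h5, h6, h7⟩, rfl⟩
    refine ⟨Q, h1, h2, h3, by omega, h5, fun v huv => ?_, h7⟩
    obtain ⟨j, hj, ⟨rfl, rfl⟩ | ⟨rfl, rfl⟩⟩ := (N.adj_iff u v).1 huv
    · exact h6 j hj (Or.inl rfl)
    · exact (h6 j hj (Or.inr rfl)).symm

end

/-! ### All rounds together -/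

section

variable {H : MultilabelTemporalGraph ℕ} {n m : ℕ} {tl hd : ℕ → ℕ} {lw up : ℕ → ℕ → ℕ}

theorem steady_iff_isCalm (N : Net H n m tl hd lw up) {P : Finset (ℕ × ℕ)} (hP : H.IsAMTTO P)
    {x : ℕ × ℕ} : x ∈ steady (P : Set (ℕ × ℕ)) ↔
      ∃ j < m, IsCalm n tl hd P j ∧ arc tl hd P j = x := by
  have key : ∀ j < m, arc tl hd P j ∈ P := fun j hj => by
    have h := hP.total (N.adj_edge hj)
    unfold arc
    split_ifs with h'
    · exact h'
    · exact h.resolve_left h'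
  have hcalm : ∀ j, IsCalm n tl hd P j ↔ ∀ c, ¬ Closes (P : Set (ℕ × ℕ)) (arc tl hd P j) c :=
    fun j => ⟨fun h c hc => h c (N.lt_right (hP.orientation.adj _ _ hc.1)) hc,
      fun h c _ hc => h c hc⟩
  constructor
  · rintro ⟨h1, h2⟩
    obtain ⟨j, hj, h⟩ := (N.adj_iff _ _).1 (hP.orientation.adj x.1 x.2 h1)
    have hx : arc tl hd P j = x := by
      rcases h with ⟨h3, h4⟩ | ⟨h3, h4⟩
      · rw [arc, h3, h4]
        exact if_pos h1
      · rw [arc, h3, h4]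
        exact if_neg fun h => hP.asymm h1 h
    exact ⟨j, hj, (hcalm j).2 (hx ▸ h2), hx⟩
  · rintro ⟨j, hj, h1, rfl⟩
    exact ⟨key j hj, (hcalm j).1 h1⟩

open Classical in
/-- The vertices at which some edge has no orientation in `Q`. -/
noncomputable def openVertices (H : MultilabelTemporalGraph ℕ) (n : ℕ) (Q : Finset (ℕ × ℕ)) :
    Finset ℕ :=
  (Finset.range n).filter fun u => ∃ v, H.graph.Adj u v ∧ (u, v) ∉ Q ∧ (v, u) ∉ Q

theorem mem_openVertices (N : Net H n m tl hd lw up) {Q : Finset (ℕ × ℕ)} {u : ℕ} :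
    u ∈ openVertices H n Q ↔ ∃ v, H.graph.Adj u v ∧ (u, v) ∉ Q ∧ (v, u) ∉ Q := by
  simp only [openVertices, Finset.mem_filter, Finset.mem_range, and_iff_right_iff_imp]
  exact fun ⟨v, h, _⟩ => N.lt_left h

theorem finite_adj (N : Net H n m tl hd lw up) : {p : ℕ × ℕ | H.graph.Adj p.1 p.2}.Finite :=
  ((Finset.range n ×ˢ Finset.range n).finite_toSet).subset fun p hp => by
    simpa using ⟨N.lt_left hp, N.lt_right hp⟩

/-- Among the vertices with unoriented edges, one is not entered by a steady such edge. -/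
theorem exists_source (N : Net H n m tl hd lw up) {P Q : Finset (ℕ × ℕ)} (hP : H.IsAMTTO P)
    (hne : (openVertices H n Q).Nonempty) : ∃ u ∈ openVertices H n Q,
      ∀ v, (v, u) ∈ steady (P : Set (ℕ × ℕ)) → v ∉ openVertices H n Q := by
  -- Acyclicity makes the transitive closure a strict order on a finite set, and a minimal element
  -- is the desired vertex.
  let r : {x // x ∈ openVertices H n Q} → {x // x ∈ openVertices H n Q} → Prop :=
    fun x y => Relation.TransGen (fun x y => (x, y) ∈ steady (P : Set (ℕ × ℕ))) x y
  have : IsTrans _ r := ⟨fun _ _ _ h h' => Relation.TransGen.trans h h'⟩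
  have : Std.Irrefl r := ⟨fun x => hP.steady_acyclic (finite_adj N) x⟩
  obtain ⟨u, -, hu⟩ := (Finite.wellFounded_of_trans_of_irrefl r).has_min Set.univ
    ⟨⟨_, hne.choose_spec⟩, trivial⟩
  exact ⟨u, u.2, fun v hv hv' => hu ⟨v, hv'⟩ trivial (.single hv)⟩

variable (N : Net H n m tl hd lw up)

include N

/-- Each round fully decides at least one more vertex as long as any is open, so `n` rounds suffice.
A round costs O(m) besides what is charged to new arcs. -/
theorem refine_spec {s : State} (T : Ready H n m tl hd lw up s) {P : Finset (ℕ × ℕ)}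
    (hA : Arcs n tl hd P m s) (hP : (∃ O, H.IsAMTTO O) → H.IsAMTTO P)
    (h14 : s.mem 14 = 0) (h25 : s.mem 25 = 0) (h26 : s.mem 26 = 0) :
    Run refine s fun s' t => ∃ Q, Holds H n 14 s' Q ∧ (H.IsTComparability → H.IsMTTO Q) ∧
      t ≤ 2200 * (n * m) + 60 * n + 6 := by
  refine (Run.forLoop (fun r s' T => ∃ Q, Holds H n 14 s' Q ∧ (∀ v, s'.mem 25 v ≤ r) ∧
      (∀ i, s'.mem 26 i ≤ s'.reg 15) ∧ T ≤ 1000 * (n * Q.card) + 200 * (r * m) + 60 * r ∧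
      (H.IsTComparability → H.IsSolid Q ∧ (openVertices H n Q).card ≤ n - r)) T.n_eq (by decide)
    (by decide) (by decide) ?_ ?_ ?_).mono ?_
  -- The rounds start from the empty set, which is trivially solid; the choice of the vertex makes
  -- up for not starting with `Ness`.
  · refine ⟨∅, ⟨.of_zero h14, by simp⟩, by simp [h25], by simp [h26], by simp, fun _ =>
      ⟨⟨⟨by simp, by simp, by simp⟩, by simp⟩, ?_⟩⟩
    classical
    exact (Finset.card_le_card (Finset.filter_subset _ _)).trans (by simp)
  · rintro k s₁ t₁ v ⟨Q, h1, h2, h3, h4⟩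
    exact ⟨Q, h1.congr rfl, h2, by simpa [reg_setReg, mem_setReg] using h3, h4⟩
  · rintro r s₁ t₁ hr hi f₁ ⟨Q, h1, h2, h3, h4, h5⟩
    have T₁ := T.frame f₁ (by decide) (by decide)
    have hA₁ := hA.frame f₁ (by decide)
    refine (markBad_spec N T₁ h1 hA₁ hi h2).seq fun s₂ t₂ f₂ ⟨k1, k2, ht₂⟩ => ?_
    have T₂ := T₁.frame f₂ (by decide) (by decide)
    have hQ₂ := h1.congr (f₂.2 14 (by decide))
    have h3₂ : ∀ i, s₂.mem 26 i ≤ s₂.reg 15 := by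
      rw [f₂.2 26 (by decide), f₂.1 15 (by decide)]
      exact h3
    have hi₂ : s₂.reg 16 = r := by rw [f₂.1 16 (by decide), hi]
    refine (findVertex_spec N T₂ hQ₂ hi₂).seq fun s₃ t₃ f₃ ⟨k3, k4, ht₃⟩ => ?_
    have T₃ := T₂.frame f₃ (by decide) (by decide)
    have hQ₃ := hQ₂.congr (f₃.2 14 (by decide))
    have h3₃ : ∀ i, s₃.mem 26 i ≤ s₃.reg 15 := by
      rw [f₃.2 26 (by decide), f₃.1 15 (by decide)]
      exact h3₂
    have k1₃ : ∀ v, s₃.mem 25 v ≤ r + 1 := by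
      rw [f₃.2 25 (by decide)]
      exact k1
    have hbad : H.IsAMTTO P → ∀ a b, (a, b) ∈ steady (P : Set (ℕ × ℕ)) → (a, b) ∉ Q → (b, a) ∉ Q →
        s₂.mem 25 b = r + 1 := by
      intro hP a b hab hp hq
      obtain ⟨j, hj, h6, h7⟩ := (steady_iff_isCalm N hP).1 hab
      exact (k2 b).2 ⟨j, hj, h6, by rw [h7], by rwa [h7], by rwa [h7]⟩
    have hcomp : (r + 1) * m = r * m + m := by ring
    rw [run_ite, run_skip]
    simp only [Test.holds, Expr.eval, Test.cost, Expr.cost]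
    constructor
    · intro h18
      obtain ⟨hnb, v₀, hv₀⟩ := k3 h18
      refine (treatVertex_spec N T₃ hQ₃ rfl h3₃).mono fun s₄ t₄ f₄
        ⟨Q', l1, l2, l3, l4, l5, l6, l7⟩ => ⟨Q', l2, ?_, l3, by rw [hcomp]; omega, fun hT => ?_⟩
      · rw [f₄.2 25 (by decide)]
        exact k1₃
      · obtain ⟨hS, hcard⟩ := h5 hT
        have hPP := hP (hT.imp fun O hO => hO.isAMTTO)
        -- If `(u, v)` forced its reverse, `(v, u)` would be necessary, hence steady in `P`, and `u`
        -- would bear the stamp `r + 1`.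
        have hQ' : H.IsPartial Q' := l7 (fun v huv hp hq hf => hnb <|
          hbad hPP v _ (hPP.ness_subset_steady ⟨huv.symm, hf⟩) hq hp) hS.toIsPartial
        refine ⟨hS.round hQ' l1 l5 l6, ?_⟩
        have hlt : openVertices H n Q' ⊂ openVertices H n Q := by
          rw [Finset.ssubset_iff_of_subset]
          · refine ⟨s₃.reg 17, (mem_openVertices N).2 ⟨v₀, hv₀⟩, fun h => ?_⟩
            obtain ⟨v, h8, h9, h10⟩ := (mem_openVertices N).1 h
            exact (l6 v h8).elim h9 h10
          · intro w hw
            obtain ⟨v, h8, h9, h10⟩ := (mem_openVertices N).1 hw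
            exact (mem_openVertices N).2 ⟨v, h8, fun h => h9 (l1 h), fun h => h10 (l1 h)⟩
        have := Finset.card_lt_card hlt
        omega
    · intro h18
      refine ⟨Q, hQ₃, k1₃, h3₃, by rw [hcomp]; omega, fun hT => ⟨(h5 hT).1, ?_⟩⟩
      have hPP := hP (hT.imp fun O hO => hO.isAMTTO)
      -- If no vertex is found, every open vertex is entered by an undecided steady arc from another
      -- open one, contrary to `exists_source`.
      suffices h : openVertices H n Q = ∅ by simp [h]
      by_contra hne
      obtain ⟨u, hu, hsrc⟩ := exists_source N hPP (Finset.nonempty_iff_ne_empty.2 hne)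
      obtain ⟨v, hv⟩ := (mem_openVertices N).1 hu
      obtain ⟨j, hj, h6, h7, h8, h9⟩ := (k2 u).1 (k4 h18 u v hv.1 hv.2.1 hv.2.2)
      have hst := (steady_iff_isCalm N hPP).2 ⟨j, hj, h6, rfl⟩
      have hx : arc tl hd P j = ((arc tl hd P j).1, u) := Prod.ext rfl h7
      rw [hx] at hst h8 h9
      exact hsrc _ hst ((mem_openVertices N).2
        ⟨u, hPP.orientation.adj _ _ hst.1, h9, h8⟩)
  · rintro s₁ t₁ f₁ ⟨t, ⟨Q, h1, h2, h3, h4, h5⟩, rfl⟩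
    refine ⟨Q, h1, fun hT => (h5 hT).1.isMTTO fun a b hab => ?_, ?_⟩
    · by_contra hcon
      have h6 := (h5 hT).2
      rw [not_or] at hcon
      have h7 := Finset.card_pos.2 ⟨a, (mem_openVertices N).2 ⟨b, hab, hcon⟩⟩
      omega
    · have h6 : n * Q.card ≤ n * (2 * m) := Nat.mul_le_mul_left n (card_le_of_adj N h1.adj)
      have h7 : n * (2 * m) = 2 * (n * m) := by ring
      omega

end

/-! ### Output and verification -/

/-- All edges, oriented as in the set `Q`. -/
def arcs (m : ℕ) (tl hd : ℕ → ℕ) (Q : Finset (ℕ × ℕ)) : Finset (ℕ × ℕ) :=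
  (Finset.range m).image (arc tl hd Q)

/-- The condition for transitivity at the path `abw`. -/
def IsFine (lw up : ℕ → ℕ → ℕ) (F : Finset (ℕ × ℕ)) (x : ℕ × ℕ) (w : ℕ) : Prop :=
  (x.2, w) ∈ F → lw x.1 x.2 ≤ up x.2 w → (x.1, w) ∈ F ∧ ¬ lw x.1 w < up x.2 w

section

variable {H : MultilabelTemporalGraph ℕ} {n m : ℕ} {tl hd : ℕ → ℕ} {lw up : ℕ → ℕ → ℕ}

theorem arc_mem_arcs {Q : Finset (ℕ × ℕ)} {j : ℕ} (hj : j < m) :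
    arc tl hd Q j ∈ arcs m tl hd Q := Finset.mem_image.2 ⟨j, Finset.mem_range.2 hj, rfl⟩

theorem Tables.fineTest {s : State} (T : Tables H n m tl hd lw up s) {F : Finset (ℕ × ℕ)}
    (hR : Rep n 27 s F) (hF : ∀ a b, (a, b) ∈ F → H.graph.Adj a b) {x y z : Expr} {a b c : ℕ}
    (hx : x.eval s = a) (hy : y.eval s = b) (hz : z.eval s = c) (hab : H.graph.Adj a b)
    (ha : a < n) (hb : b < n) (hc : c < n) :
    (fineTest x y z).holds s ↔ IsFine lw up F (a, b) c := by
  have c1 := hR.holds_cell T.toBase hy hz hb hc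
  have c2 := hR.holds_cell T.toBase hx hz ha hc
  simp only [RAM.fineTest, Test.holds, Test.holds_or, Test.holds_le] at c1 c2 ⊢
  rw [c1, c2, T.toBase.cell _ (hx ▸ ha : x.eval s < n), T.toBase.cell _ (hy ▸ hb : y.eval s < n),
    T.toBase.cell _ (hx ▸ ha : x.eval s < n), hx, hy, hz, T.lw_eq _ _ hab, IsFine, not_lt]
  by_cases k1 : (b, c) ∈ F
  · rw [T.up_eq _ _ (hF _ _ k1)]
    by_cases k2 : (a, c) ∈ F
    · rw [T.lw_eq _ _ (hF _ _ k2)]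
      tauto
    · tauto
  · tauto

variable (N : Net H n m tl hd lw up)

include N

theorem arc_adj (Q : Finset (ℕ × ℕ)) {j : ℕ} (hj : j < m) :
    H.graph.Adj (arc tl hd Q j).1 (arc tl hd Q j).2 := by
  rcases arc_eq_or (tl := tl) (hd := hd) Q j with h | h <;> rw [h]
  exacts [N.adj_edge hj, (N.adj_edge hj).symm]

/-- This holds for arbitrary `Q`, in particular when the earlier stages ran on a graph without an
MTTO, so only transitivity remains to be checked. -/
theorem isOrientation_arcs (Q : Finset (ℕ × ℕ)) :
    H.IsOrientation (arcs m tl hd Q : Set (ℕ × ℕ)) where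
  adj a b h := by
    obtain ⟨j, hj, h⟩ := Finset.mem_image.1 h
    have := arc_adj N Q (Finset.mem_range.1 hj)
    rwa [h] at this
  exactly_one a b hab := by
    have hnot : ¬ ((a, b) ∈ arcs m tl hd Q ∧ (b, a) ∈ arcs m tl hd Q) := by
      rintro ⟨h, h'⟩
      obtain ⟨i, hi, h⟩ := Finset.mem_image.1 h
      obtain ⟨j, hj, h'⟩ := Finset.mem_image.1 h'
      have hij : i = j := by
        refine N.inj i (Finset.mem_range.1 hi) j (Finset.mem_range.1 hj) ?_
        rcases arc_eq_or (tl := tl) (hd := hd) Q i with k | k <;>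
          rcases arc_eq_or (tl := tl) (hd := hd) Q j with k' | k' <;>
          rw [k, Prod.mk.injEq] at h <;> rw [k', Prod.mk.injEq] at h' <;> omega
      subst hij
      rw [h, Prod.mk.injEq] at h'
      exact hab.ne h'.1
    have hor : (a, b) ∈ arcs m tl hd Q ∨ (b, a) ∈ arcs m tl hd Q := by
      obtain ⟨j, hj, ⟨rfl, rfl⟩ | ⟨rfl, rfl⟩⟩ := (N.adj_iff a b).1 hab <;>
        have h := arc_mem_arcs (tl := tl) (hd := hd) (Q := Q) hj <;>
        rcases arc_eq_or (tl := tl) (hd := hd) Q j with k | k <;> rw [k] at h <;> tauto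
    exact hor.elim (fun h => Or.inl ⟨h, fun h' => hnot ⟨h, h'⟩⟩)
      fun h => Or.inr ⟨h, fun h' => hnot ⟨h', h⟩⟩

theorem arcs_eq {Q : Finset (ℕ × ℕ)} (hQ : H.IsOrientation (Q : Set (ℕ × ℕ))) :
    arcs m tl hd Q = Q := by
  have hsub : arcs m tl hd Q ⊆ Q := by
    intro x hx
    obtain ⟨j, hj, rfl⟩ := Finset.mem_image.1 hx
    unfold arc
    split_ifs with h
    · exact h
    · rcases hQ.exactly_one _ _ (N.adj_edge (Finset.mem_range.1 hj)) with h' | h'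
      · exact absurd h'.1 h
      · exact h'.1
  refine hsub.antisymm ?_
  rintro ⟨a, b⟩ hx
  have hab := hQ.adj a b hx
  rcases (isOrientation_arcs N Q).exactly_one a b hab with h | h
  · exact h.1
  · rcases hQ.exactly_one a b hab with h' | h'
    · exact absurd (hsub h.1) h'.2
    · exact absurd hx h'.2

/-- The first arc of a path runs over the `m` edges and its last vertex over `n` values, so
transitivity can be tested in time O(nm). -/
theorem isMTTO_arcs_iff {Q : Finset (ℕ × ℕ)} : H.IsMTTO (arcs m tl hd Q : Set (ℕ × ℕ)) ↔
    ∀ j < m, ∀ w < n, IsFine lw up (arcs m tl hd Q) (arc tl hd Q j) w := by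
  have hO := isOrientation_arcs N Q
  constructor
  · rintro h j hj w hw h1 h2
    have hab := arc_adj N Q hj
    have hbw := hO.adj _ _ h1
    have h3 := h.transitive (arc tl hd Q j).1 (arc tl hd Q j).2 w (arc_mem_arcs (Q := Q) hj) h1 (by
      rw [labelLE_iff hab hbw, N.lo_eq hab, N.hi_eq hbw]
      exact Nat.cast_le.2 h2)
    refine ⟨h3.1, fun h4 => h3.2 ?_⟩
    have haw := hO.adj _ _ h3.1
    rw [labelLT_iff haw, N.lo_eq haw, N.hi_eq hbw]
    exact Nat.cast_lt.2 h4
  · refine fun h => ⟨hO, fun a b c hab hbc hle => ?_⟩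
    obtain ⟨j, hj, hx⟩ := Finset.mem_image.1 hab
    have hab' := hO.adj _ _ hab
    have hbc' := hO.adj _ _ hbc
    have h1 := h j (Finset.mem_range.1 hj) c (N.lt_right hbc')
    rw [hx] at h1
    rw [labelLE_iff hab' hbc', N.lo_eq hab', N.hi_eq hbc', Nat.cast_le] at hle
    have h2 := h1 hbc hle
    refine ⟨h2.1, fun h4 => h2.2 ?_⟩
    have haw := hO.adj _ _ h2.1
    rwa [labelLT_iff haw, N.lo_eq haw, N.hi_eq hbc', Nat.cast_lt] at h4

theorem output_spec {s : State} (T : Ready H n m tl hd lw up s) {Q : Finset (ℕ × ℕ)}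
    (hQ : Holds H n 14 s Q) (h27 : s.mem 27 = 0) :
    Run output s fun s' t => (∀ j < m, s'.mem 4 j = 1 ↔ (tl j, hd j) ∈ Q) ∧
      Rep n 27 s' (arcs m tl hd Q) ∧ t ≤ 60 * m + 6 := by
  refine (Run.forLoop_le 50 (fun k s' => (∀ j < k, s'.mem 4 j = 1 ↔ (tl j, hd j) ∈ Q) ∧
    Rep n 27 s' (arcs k tl hd Q)) T.m_eq (by decide)
    (by decide) (by decide) ⟨by simp, .of_zero h27⟩ (fun k s v h => h) ?_).mono
    fun s' t _ ⟨⟨h1, h2⟩, h3⟩ => ⟨h1, h2, by omega⟩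
  rintro k s₁ hk hi f₁ ⟨h1, h2⟩
  have T₁ := T.frame f₁ (by decide) (by decide)
  have hQ₁ := hQ.congr (f₁.2 14 (by decide))
  rw [run_seq, T₁.toBase.readEdge (hi.trans_lt hk) (by decide), hi]
  set s₂ := (s₁.setReg 7 (tl k)).setReg 8 (hd k) with hs₂
  have f₂ : Frame [7, 8] [] s₁ s₂ :=
    ((Frame.refl _ _ _).setReg (by decide) _).setReg (by decide) _
  have T₂ := T₁.frame f₂ (by decide) (by decide)
  have hQ₂ : Holds H n 14 s₂ Q := hQ₁.congr rfl
  have h2₂ : Rep n 27 s₂ (arcs k tl hd Q) := h2.congr rfl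
  have e3 : s₂.reg 3 = k := by rw [f₂.1 3 (by decide), hi]
  have e7 : (Expr.reg 7).eval s₂ = tl k := by simp [hs₂, reg_setReg, Expr.eval]
  have e8 : (Expr.reg 8).eval s₂ = hd k := by simp [hs₂, reg_setReg, Expr.eval]
  have h1₂ : ∀ j < k, s₂.mem 4 j = 1 ↔ (tl j, hd j) ∈ Q := h1
  clear_value s₂
  have harcs : arcs (k + 1) tl hd Q = insert (arc tl hd Q k) (arcs k tl hd Q) := by
    rw [arcs, Finset.range_add_one, Finset.image_insert, arcs]
  have h1' : ∀ v, (v = 1 ↔ (tl k, hd k) ∈ Q) → ∀ j < k + 1,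
      (s₂.setMem 4 k v).mem 4 j = 1 ↔ (tl j, hd j) ∈ Q := by
    intro v hv j hj
    rcases Nat.lt_succ_iff_lt_or_eq.1 hj with hj | rfl
    · simp [mem_setMem, hj.ne, h1₂ j hj]
    · simp [mem_setMem, hv]
  have key : ∀ v, ∀ x y : Expr, (v = 1 ↔ (tl k, hd k) ∈ Q) →
      x.eval (s₂.setMem 4 k v) = (arc tl hd Q k).1 → y.eval (s₂.setMem 4 k v) = (arc tl hd Q k).2 →
      x.cost = 1 → y.cost = 1 →
      Run (storeCell 27 x y (.lit 1)) (s₂.setMem 4 k v) fun s' t =>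
        ((∀ j < k + 1, s'.mem 4 j = 1 ↔ (tl j, hd j) ∈ Q) ∧ Rep n 27 s' (arcs (k + 1) tl hd Q)) ∧
        t ≤ 6 := by
    intro v x y hv hx hy cx cy
    have hlt := arc_lt N (P := Q) hk
    have f₃ : Frame [] [4] s₂ (s₂.setMem 4 k v) := ⟨fun _ _ => rfl, fun a ha => by
      funext i
      simp only [List.mem_singleton] at ha
      simp [mem_setMem, ha]⟩
    have T₃ := T₂.frame f₃ (by decide) (by decide)
    rw [T₃.toBase.storeCell _ (by rw [hx]; exact hlt.1), hx, hy, cx, cy]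
    refine ⟨⟨fun j hj => ?_, ?_⟩, le_rfl⟩
    · rw [← h1' v hv j hj]
      simp [mem_setMem]
    · rw [harcs]
      exact (h2₂.congr (f₃.2 27 (by decide))).insert hlt.2
  rw [run_ite, hQ₂.rep.holds_cell T₂.toBase e7 e8 (N.tl_lt k hk) (N.hd_lt k hk)]
  simp only [run_seq, run_store, Expr.eval, e3]
  constructor
  · intro h
    refine (key 1 (.reg 7) (.reg 8) (by simp [h]) ?_ ?_ rfl rfl).mono fun s' t _ ⟨h3, h4⟩ =>
      ⟨h3, (Nat.add_le_add_left (Nat.add_le_add_left (Nat.add_le_add_left h4 _) _) _).trans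
        (Nat.le_of_ble_eq_true rfl)⟩
    · simpa [arc, h, Expr.eval, reg_setMem] using e7
    · simpa [arc, h, Expr.eval, reg_setMem] using e8
  · intro h
    refine (key 0 (.reg 8) (.reg 7) (by simp [h]) ?_ ?_ rfl rfl).mono fun s' t _ ⟨h3, h4⟩ =>
      ⟨h3, (Nat.add_le_add_left (Nat.add_le_add_left (Nat.add_le_add_left h4 _) _) _).trans
        (Nat.le_of_ble_eq_true rfl)⟩
    · simpa [arc, h, Expr.eval, reg_setMem] using e8
    · simpa [arc, h, Expr.eval, reg_setMem] using e7

theorem verify_spec {s : State} (T : Ready H n m tl hd lw up s) {Q : Finset (ℕ × ℕ)}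
    (h4 : ∀ j < m, s.mem 4 j = 1 ↔ (tl j, hd j) ∈ Q) (h27 : Rep n 27 s (arcs m tl hd Q)) :
    Run verify s fun s' t => (s'.reg 2 = 0 ∨ s'.reg 2 = 1) ∧
      (s'.reg 2 = 1 ↔ H.IsMTTO (arcs m tl hd Q : Set (ℕ × ℕ))) ∧
      t ≤ 60 * (n * m) + 50 * m + 10 := by
  set F := arcs m tl hd Q with hF
  have hFadj : ∀ a b, (a, b) ∈ F → H.graph.Adj a b := (isOrientation_arcs N Q).adj
  rw [verify, run_seq, run_assign]
  set s₀ := s.setReg 2 ((Expr.lit 1).eval s) with hs₀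
  have f₀ : Frame [2] [] s s₀ := (Frame.refl _ _ _).setReg (by decide) _
  have T₀ := T.frame f₀ (by decide) (by decide)
  refine (Run.forLoop_le (60 * n + 40) (fun k s' => (s'.reg 2 = 0 ∨ s'.reg 2 = 1) ∧
      (s'.reg 2 = 1 ↔ ∀ j < k, ∀ w < n, IsFine lw up F (arc tl hd Q j) w)) T₀.m_eq (by decide)
    (by decide) (by decide) ?_ ?_ ?_).mono ?_
  · simp [hs₀, reg_setReg, Expr.eval]
  · intro k s' v h
    simpa [reg_setReg] using h
  · rintro k s₁ hk hi f₁ ⟨h1, h2⟩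
    have T₁ := T₀.frame f₁ (by decide) (by decide)
    have hadj := arc_adj N Q hk
    have hlt := arc_lt N (P := Q) hk
    rw [run_seq, T₁.toBase.readEdge (hi.trans_lt hk) (by decide), hi]
    set s₂ := (s₁.setReg 7 (tl k)).setReg 8 (hd k) with hs₂
    have f₂ : Frame [7, 8] [] s₁ s₂ :=
      ((Frame.refl _ _ _).setReg (by decide) _).setReg (by decide) _
    have T₂ := T₁.frame f₂ (by decide) (by decide)
    have e2 : s₂.reg 2 = s₁.reg 2 := f₂.1 2 (by decide)
    have e3 : s₂.reg 3 = k := by rw [f₂.1 3 (by decide), hi]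
    have e7 : s₂.reg 7 = tl k := by simp [hs₂, reg_setReg]
    have e8 : s₂.reg 8 = hd k := by simp [hs₂, reg_setReg]
    have hm₂ : s₂.mem = s.mem := by
      funext a
      rw [f₂.2 a (by simp), f₁.2 a (by simp [readEdge, Program.arrs, RAM.forLoop]), f₀.2 a (by simp)]
    have horient : Run (.ite (.eq (.load 4 (.reg 3)) (.lit 1)) .skip (readEdge 3 8 7)) s₂
        fun s' t => s'.reg 7 = (arc tl hd Q k).1 ∧ s'.reg 8 = (arc tl hd Q k).2 ∧ t ≤ 14 := by
      rw [run_ite, run_skip, T₂.toBase.readEdge (e3.trans_lt hk) (by decide), e3]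
      simp only [Test.holds, Expr.eval, e3, hm₂, h4 k hk]
      refine ⟨fun h => ⟨?_, ?_, Nat.le_of_ble_eq_true rfl⟩, fun h => ⟨?_, ?_,
        Nat.le_of_ble_eq_true rfl⟩⟩
      · simpa [arc, h] using e7
      · simpa [arc, h] using e8
      · simp [arc, h, reg_setReg]
      · simp [arc, h, reg_setReg]
    refine horient.seq fun s₃ t₃ f₃ ⟨h7₃, h8₃, ht₃⟩ => ?_
    have T₃ := T₂.frame f₃ (by decide) (by decide)
    have hm₃ : s₃.mem = s.mem := by
      funext a
      rw [f₃.2 a (by simp [readEdge, Program.arrs]), hm₂]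
    have e2₃ : s₃.reg 2 = s₁.reg 2 := by rw [f₃.1 2 (by decide), e2]
    clear_value s₂ s₀
    generalize hx : arc tl hd Q k = x at *
    refine (Run.forLoop_le 50 (fun l s' => (s'.reg 2 = 0 ∨ s'.reg 2 = 1) ∧
      (s'.reg 2 = 1 ↔ (∀ j < k, ∀ w < n, IsFine lw up F (arc tl hd Q j) w) ∧
        ∀ w < l, IsFine lw up F x w)) T₃.n_eq (by decide) (by decide)
      (by decide) ?_ ?_ ?_).mono ?_
    · rw [e2₃]
      simpa using ⟨h1, h2⟩
    · intro k s' v h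
      simpa [reg_setReg] using h
    · rintro l s₄ hl hi₄ f₄ ⟨h5, h6⟩
      have T₄ := T₃.frame f₄ (by decide) (by decide)
      have hR : Rep n 27 s₄ F := h27.congr (by rw [f₄.2 27 (by decide), hm₃])
      have e7 : (Expr.reg 7).eval s₄ = x.1 := by
        rw [Expr.eval, f₄.1 7 (by decide), h7₃]
      have e8 : (Expr.reg 8).eval s₄ = x.2 := by
        rw [Expr.eval, f₄.1 8 (by decide), h8₃]
      have e4 : (Expr.reg 4).eval s₄ = l := hi₄
      have htest := T₄.fineTest hR hFadj e7 e8 e4 hadj hlt.1 hlt.2 hl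
      rw [run_ite, htest, run_assign, run_skip]
      refine ⟨fun h => ⟨⟨h5, ?_⟩, Nat.le_of_ble_eq_true rfl⟩,
        fun h => ⟨⟨?_, ?_⟩, Nat.le_of_ble_eq_true rfl⟩⟩
      · rw [h6]
        refine and_congr_right fun _ => ⟨fun h7 w hw => ?_, fun h7 w hw => h7 w (by omega)⟩
        rcases Nat.lt_succ_iff_lt_or_eq.1 hw with hw | rfl
        · exact h7 w hw
        · exact h
      · simp [reg_setReg, Expr.eval]
      · simp only [reg_setReg, Expr.eval, if_true]
        exact ⟨fun h' => absurd h' (by decide), fun h' => absurd (h'.2 l (by omega)) h⟩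
    · rintro s₄ t₄ f₄ ⟨⟨h5, h6⟩, ht₄⟩
      refine ⟨⟨h5, h6.trans ⟨fun h j hj => ?_, fun h => ⟨fun j hj => h j (by omega), ?_⟩⟩⟩,
        by omega⟩
      · rcases Nat.lt_succ_iff_lt_or_eq.1 hj with hj | rfl
        · exact h.1 j hj
        · rw [hx]
          exact h.2
      · rw [← hx]
        exact h k (by omega)
  · rintro s₁ t₁ - ⟨⟨h1, h2⟩, h3⟩
    have e : (60 * n + 40 + 8) * m = 60 * (n * m) + 48 * m := by ring
    refine ⟨h1, h2.trans (isMTTO_arcs_iff N).symm, ?_⟩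
    simp only [Expr.cost]
    omega

end

/-! ### The whole program -/

theorem mainProgram_spec {H : MultilabelTemporalGraph ℕ} {n m : ℕ} {tl hd : ℕ → ℕ}
    {lw up : ℕ → ℕ → ℕ} (N : Net H n m tl hd lw up) (hm : m ≠ 0) {s : State}
    (h0 : s.reg 0 = n) (h1 : s.reg 1 = m) (htl : ∀ j < m, s.mem 0 j = tl j)
    (hhd : ∀ j < m, s.mem 1 j = hd j)
    (hlw : ∀ j < m, s.mem 3 (s.mem 2 j) = lw (tl j) (hd j))
    (hup : ∀ j < m, s.mem 3 (s.mem 2 (j + 1) - 1) = up (tl j) (hd j))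
    (hzero : ∀ a, 4 ≤ a → s.mem a = 0) :
    Run mainProgram s fun s' t => ∃ Q, (∀ j < m, s'.mem 4 j = 1 ↔ (tl j, hd j) ∈ Q) ∧
      (H.IsTComparability ∧ s'.reg 2 = 1 ∧ H.IsMTTO (arcs m tl hd Q : Set (ℕ × ℕ)) ∨
        ¬ H.IsTComparability ∧ s'.reg 2 = 0) ∧
      t ≤ 830 * min (n * ∑ j ∈ Finset.range m, monoCount H lw up tl hd j n) (m * m) +
        6000 * (n * m) := by
  have hn : n ≠ 0 := by
    have := N.tl_lt 0 (Nat.pos_of_ne_zero hm)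
    omega
  rw [mainProgram, run_ite]
  refine ⟨fun h => absurd h (by simpa [Test.holds, Expr.eval, h1] using hm), fun _ => ?_⟩
  simp only [run_seq]
  refine (setup_spec N h0 h1 htl hhd hlw hup (hzero 7 (by decide))).mono
    fun s₁ t₁ f₁ ⟨T₁, ht₁⟩ => ?_
  refine (correlate_spec N T₁ (by rw [f₁.2 12 (by decide), hzero 12 (by decide)])).mono
    fun s₂ t₂ f₂ ⟨k₂, ht₂⟩ => ?_
  have T₂ : Ready H n m tl hd lw up s₂ := ⟨T₁.frame f₂ (by decide) (by decide), k₂⟩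
  have z₂ : ∀ a ∈ [13, 14, 16, 17, 24, 25, 26, 27], s₂.mem a = 0 := by
    intro a ha
    have h1 : a ∉ correlate.arrs := by revert a; decide
    have h2 : a ∉ setup.arrs := by revert a; decide
    have h3 : 4 ≤ a := by revert a; decide
    rw [f₂.2 a h1, f₁.2 a h2, hzero a h3]
  refine (orient_spec N T₂ (z₂ _ (by decide)) (z₂ _ (by decide)) (z₂ _ (by decide))).mono
    fun s₃ t₃ f₃ ⟨P, hP, _, hPO, ht₃⟩ => ?_
  have T₃ := T₂.frame f₃ (by decide) (by decide)
  refine (flag_spec N T₃ hP (by rw [f₃.2 24 (by decide), z₂ _ (by decide)])).mono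
    fun s₄ t₄ f₄ ⟨hA, ht₄⟩ => ?_
  have T₄ := T₃.frame f₄ (by decide) (by decide)
  refine (refine_spec N T₄ hA hPO (by rw [f₄.2 14 (by decide), f₃.2 14 (by decide),
    z₂ _ (by decide)]) (by rw [f₄.2 25 (by decide), f₃.2 25 (by decide), z₂ _ (by decide)])
    (by rw [f₄.2 26 (by decide), f₃.2 26 (by decide), z₂ _ (by decide)])).mono
    fun s₅ t₅ f₅ ⟨Q, hQ, hQO, ht₅⟩ => ?_
  have T₅ := T₄.frame f₅ (by decide) (by decide)
  refine (output_spec N T₅ hQ (by rw [f₅.2 27 (by decide), f₄.2 27 (by decide),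
    f₃.2 27 (by decide), z₂ _ (by decide)])).mono fun s₆ t₆ f₆ ⟨h4, h27, ht₆⟩ => ?_
  have T₆ := T₅.frame f₆ (by decide) (by decide)
  refine (verify_spec N T₆ h4 h27).mono fun s₇ t₇ f₇ ⟨h8, h9, ht₇⟩ => ⟨Q, ?_, ?_, ?_⟩
  · rw [f₇.2 4 (by decide)]
    exact h4
  -- On comparability graphs the rounds yield an MTTO, which passes the verification; otherwise the
  -- verification must fail, as success would exhibit an MTTO.
  · by_cases hT : H.IsTComparability
    · have hmt := hQO hT
      rw [← arcs_eq N hmt.orientation] at hmt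
      exact Or.inl ⟨hT, h9.2 hmt, hmt⟩
    · exact Or.inr ⟨hT, h8.resolve_right fun h => hT ⟨_, h9.1 h⟩⟩
  -- As there is an edge, the linear terms in `n` and `m` are covered by `n * m`.
  · have l1 : m ≤ n * m := Nat.le_mul_of_pos_left m (Nat.pos_of_ne_zero hn)
    have l2 : n ≤ n * m := Nat.le_mul_of_pos_right n (Nat.pos_of_ne_zero hm)
    simp only [Test.cost, Expr.cost]
    omega

end RAM

namespace MultilabelTemporalGraph

/-! ### Relabelling vertices -/

section

variable {V W : Type*} (G : MultilabelTemporalGraph V) (f : V ↪ W)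

/-- The graph with the vertices renamed by `f`. -/
def map : MultilabelTemporalGraph W where
  graph := G.graph.map f
  label e := {t | ∃ e', e'.map f = e ∧ t ∈ G.label e'}
  label_nonempty e he := by
    rw [SimpleGraph.edgeSet_map] at he
    obtain ⟨e', he', rfl⟩ := he
    obtain ⟨t, ht⟩ := G.label_nonempty e' he'
    exact ⟨t, e', rfl, ht⟩

variable {G f}

theorem map_adj {a b : V} : (G.map f).graph.Adj (f a) (f b) ↔ G.graph.Adj a b :=
  SimpleGraph.map_adj_apply

theorem exists_of_map_adj {x y : W} (h : (G.map f).graph.Adj x y) :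
    ∃ a b, f a = x ∧ f b = y ∧ G.graph.Adj a b := by
  obtain ⟨a, b, hab, rfl, rfl⟩ := (SimpleGraph.map_adj _ _ _ _).1 h
  exact ⟨a, b, rfl, rfl, hab⟩

theorem map_label (a b : V) : (G.map f).label s(f a, f b) = G.label s(a, b) := by
  ext t
  constructor
  · rintro ⟨e, he, ht⟩
    rw [← Sym2.map_mk] at he
    rwa [← Sym2.map.injective f.injective he]
  · exact fun h => ⟨s(a, b), rfl, h⟩

theorem mem_image_map {O : Set (V × V)} {a b : V} : (f a, f b) ∈ Prod.map f f '' O ↔ (a, b) ∈ O := by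
  constructor
  · rintro ⟨⟨c, d⟩, h, h'⟩
    rw [Prod.map_apply, Prod.mk.injEq, f.apply_eq_iff_eq, f.apply_eq_iff_eq] at h'
    rwa [← h'.1, ← h'.2]
  · exact fun h => ⟨(a, b), h, rfl⟩

theorem isMTTO_map_iff {O : Set (V × V)} : (G.map f).IsMTTO (Prod.map f f '' O) ↔ G.IsMTTO O := by
  constructor
  · refine fun h => ⟨⟨fun a b hab => ?_, fun a b hab => ?_⟩, fun a b c hab hbc hle => ?_⟩
    · exact map_adj.1 (h.orientation.adj _ _ (mem_image_map.2 hab))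
    · simpa only [mem_image_map] using h.orientation.exactly_one _ _ (map_adj.2 hab)
    · simpa only [map_label, mem_image_map] using h.transitive _ _ _ (mem_image_map.2 hab)
        (mem_image_map.2 hbc) (by simpa only [map_label] using hle)
  · refine fun h => ⟨⟨?_, fun x y hxy => ?_⟩, ?_⟩
    · rintro _ _ ⟨⟨a, b⟩, hab, h'⟩
      rw [Prod.map_apply, Prod.mk.injEq] at h'
      rw [← h'.1, ← h'.2]
      exact map_adj.2 (h.orientation.adj _ _ hab)
    · obtain ⟨a, b, rfl, rfl, hab⟩ := exists_of_map_adj hxy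
      simpa only [mem_image_map] using h.orientation.exactly_one _ _ hab
    · rintro _ _ z ⟨⟨a, b⟩, hab, h'⟩ hbc hle
      rw [Prod.map_apply, Prod.mk.injEq] at h'
      rw [← h'.1, ← h'.2] at *
      obtain ⟨⟨b', c⟩, hbc', h'⟩ := hbc
      rw [Prod.map_apply, Prod.mk.injEq, f.apply_eq_iff_eq] at h'
      obtain ⟨rfl, rfl⟩ := h'
      rw [map_label, map_label] at *
      rw [mem_image_map]
      exact h.transitive a b' c hab hbc' hle

theorem isTComparability_map_iff : (G.map f).IsTComparability ↔ G.IsTComparability := by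
  constructor
  · rintro ⟨O, hO⟩
    refine ⟨Prod.map f f ⁻¹' O, (isMTTO_map_iff (f := f)).1 ?_⟩
    rwa [Set.image_preimage_eq_of_subset]
    rintro ⟨x, y⟩ h
    obtain ⟨a, b, rfl, rfl, -⟩ := exists_of_map_adj (hO.orientation.adj _ _ h)
    exact ⟨(a, b), rfl⟩
  · exact fun ⟨O, hO⟩ => ⟨_, isMTTO_map_iff.2 hO⟩

end

/-! ### Descriptions -/

theorem getD_flatten {α : Type*} (L : List (List α)) (d : α) {j i : ℕ} (hj : j < L.length)
    (hi : i < L[j].length) : L.flatten.getD ((L.take j).flatten.length + i) d = L[j][i] := by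
  have h : L = L.take j ++ L[j] :: L.drop (j + 1) := by simp
  have h' : L.flatten = (L.take j).flatten ++ (L[j] ++ (L.drop (j + 1)).flatten) := by
    conv_lhs => rw [h]
    simp only [List.flatten_append, List.flatten_cons]
  rw [h', List.getD_append_right _ _ _ _ (Nat.le_add_right _ _), Nat.add_sub_cancel_left,
    List.getD_append _ _ _ _ hi, List.getD_eq_getElem _ _ hi]

namespace Description

variable {n : ℕ} {G : MultilabelTemporalGraph (Fin n)} (D : G.Description)

/-- The first endpoint of the `j`-th edge. -/
noncomputable def tl (j : ℕ) : ℕ := if h : j < G.numEdges then D.tail ⟨j, h⟩ else 0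

/-- The second endpoint of the `j`-th edge. -/
noncomputable def hd (j : ℕ) : ℕ := if h : j < G.numEdges then D.head ⟨j, h⟩ else 0

/-- The graph on the natural numbers. -/
def net (G : MultilabelTemporalGraph (Fin n)) : MultilabelTemporalGraph ℕ := G.map Fin.valEmbedding

theorem adj_iff (a b : Fin n) : G.graph.Adj a b ↔
    ∃ j, D.tail j = a ∧ D.head j = b ∨ D.tail j = b ∧ D.head j = a := by
  rw [← SimpleGraph.mem_edgeSet, ← D.range_eq]
  simp [Set.mem_range]

theorem isLeast_label {a b : ℕ} (h : (net G).graph.Adj a b) :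
    IsLeast ((net G).label s(a, b)) (sInf ((net G).label s(a, b))) :=
  ⟨Nat.sInf_mem (label_nonempty' h), fun _ => Nat.sInf_le⟩

include D in
theorem finite_label {a b : ℕ} (h : (net G).graph.Adj a b) : ((net G).label s(a, b)).Finite := by
  obtain ⟨a, b, rfl, rfl, hab⟩ := exists_of_map_adj h
  have : s(a, b) ∈ Set.range fun j => s(D.tail j, D.head j) := by
    rw [D.range_eq]
    exact hab
  obtain ⟨j, hj⟩ := this
  have e : (net G).label s(Fin.valEmbedding a, Fin.valEmbedding b) = {t | t ∈ D.times j} := by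
    rw [net, map_label, ← hj]
    ext t
    exact (D.mem_times j t).symm
  rw [e]
  exact List.finite_toSet _

include D in
theorem isGreatest_label {a b : ℕ} (h : (net G).graph.Adj a b) :
    IsGreatest ((net G).label s(a, b)) (sSup ((net G).label s(a, b))) :=
  ⟨Nat.sSup_mem (label_nonempty' h) (D.finite_label h).bddAbove,
    fun _ hx => le_csSup (D.finite_label h).bddAbove hx⟩

theorem isNet : Net (net G) n G.numEdges D.tl D.hd (fun a b => sInf ((net G).label s(a, b)))
    (fun a b => sSup ((net G).label s(a, b))) where
  tl_lt j hj := by simp [tl, hj]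
  hd_lt j hj := by simp [hd, hj]
  adj_iff a b := by
    constructor
    · intro h
      obtain ⟨a, b, rfl, rfl, hab⟩ := exists_of_map_adj h
      obtain ⟨j, hj⟩ := (D.adj_iff a b).1 hab
      refine ⟨j, j.2, ?_⟩
      simp only [tl, hd, j.2, dif_pos, Fin.valEmbedding_apply, Fin.val_inj]
      exact hj
    · rintro ⟨j, hj, h⟩
      simp only [tl, hd, hj, dif_pos] at h
      have := (D.adj_iff _ _).2 ⟨⟨j, hj⟩, Or.inl ⟨rfl, rfl⟩⟩
      rcases h with ⟨rfl, rfl⟩ | ⟨rfl, rfl⟩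
      · exact map_adj.2 this
      · exact map_adj.2 this.symm
  inj i hi j hj h := by
    simp only [tl, hd, hi, hj, dif_pos, Fin.val_inj] at h
    have := D.injective (a₁ := ⟨i, hi⟩) (a₂ := ⟨j, hj⟩) (Sym2.eq_iff.2 h)
    simpa using this
  isLeast _ _ := isLeast_label
  isGreatest _ _ := D.isGreatest_label

theorem label_eq {j : ℕ} (hj : j < G.numEdges) :
    (net G).label s(D.tl j, D.hd j) = {t | t ∈ D.times ⟨j, hj⟩} := by
  have e : s(D.tl j, D.hd j) =
      s(Fin.valEmbedding (D.tail ⟨j, hj⟩), Fin.valEmbedding (D.head ⟨j, hj⟩)) := by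
    simp [tl, hd, hj]
  rw [e, net, map_label]
  ext t
  exact (D.mem_times _ t).symm

theorem getD_allTimes {j i : ℕ} (hj : j < G.numEdges) (hi : i < (D.times ⟨j, hj⟩).length) :
    D.allTimes.getD (D.start j + i) 0 = (D.times ⟨j, hj⟩)[i] := by
  have := getD_flatten (List.ofFn D.times) 0 (j := j) (i := i) (by simpa using hj) (by simpa using hi)
  simp only [List.getElem_ofFn] at this
  exact this

theorem start_succ {j : ℕ} (hj : j < G.numEdges) :
    D.start (j + 1) = D.start j + (D.times ⟨j, hj⟩).length := by
  rw [start, start, List.take_succ_eq_append_getElem (by simpa using hj)]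
  simp

theorem length_pos {j : ℕ} (hj : j < G.numEdges) : 0 < (D.times ⟨j, hj⟩).length := by
  have h := label_nonempty' (D.isNet.adj_edge hj)
  rw [D.label_eq hj] at h
  obtain ⟨t, ht⟩ := h
  exact List.length_pos_of_mem ht

theorem first_label {j : ℕ} (hj : j < G.numEdges) :
    D.allTimes.getD (D.start j) 0 = sInf ((net G).label s(D.tl j, D.hd j)) := by
  have hp := D.length_pos hj
  have h1 := D.getD_allTimes hj hp
  rw [add_zero] at h1
  rw [h1]
  refine IsLeast.unique ?_ (isLeast_label (D.isNet.adj_edge hj))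
  rw [D.label_eq hj]
  refine ⟨List.getElem_mem hp, fun t ht => ?_⟩
  obtain ⟨i, hi, rfl⟩ := List.getElem_of_mem ht
  rcases Nat.eq_zero_or_pos i with rfl | h
  · exact le_rfl
  · exact (List.pairwise_iff_getElem.1 (D.times_increasing _) 0 i hp hi h).le

theorem last_label {j : ℕ} (hj : j < G.numEdges) :
    D.allTimes.getD (D.start (j + 1) - 1) 0 = sSup ((net G).label s(D.tl j, D.hd j)) := by
  have hp := D.length_pos hj
  -- Every edge has a label, so the cell before the start of the next block still belongs to edge
  -- `j`.
  rw [D.start_succ hj, Nat.add_sub_assoc (k := 1) hp, D.getD_allTimes hj (Nat.sub_lt hp one_pos)]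
  refine IsGreatest.unique ?_ (D.isGreatest_label (D.isNet.adj_edge hj))
  rw [D.label_eq hj]
  refine ⟨List.getElem_mem _, fun t ht => ?_⟩
  obtain ⟨i, hi, rfl⟩ := List.getElem_of_mem ht
  rcases (Nat.le_sub_one_of_lt hi).eq_or_lt with rfl | h
  · exact le_rfl
  · exact (List.pairwise_iff_getElem.1 (D.times_increasing _) i _ hi _ h).le

open RAM

include D in
theorem isMonolabelTriangle_of_mono {a b c : Fin n} (h : Net.Mono (net G)
    (fun a b => sInf ((net G).label s(a, b))) (fun a b => sSup ((net G).label s(a, b))) a b c) :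
    ∃ t, G.IsMonolabelTriangle t a b c := by
  obtain ⟨⟨h1, h2, h3⟩, l1, l2, l3, l4, l5⟩ := h
  have key : ∀ a b : Fin n, ∀ t, (net G).graph.Adj a b → sInf ((net G).label s((a : ℕ), (b : ℕ))) = t →
      sSup ((net G).label s((a : ℕ), (b : ℕ))) = t → G.graph.Adj a b ∧ G.label s(a, b) = {t} := by
    intro a b t hab hi hs
    refine ⟨map_adj.1 hab, ?_⟩
    have e : (net G).label s((a : ℕ), (b : ℕ)) = G.label s(a, b) := map_label a b
    have k1 := isLeast_label hab
    have k2 := D.isGreatest_label hab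
    rw [hi, e] at k1
    rw [hs, e] at k2
    ext x
    refine ⟨fun hx => le_antisymm (k2.2 hx) (k1.2 hx), ?_⟩
    rintro rfl
    exact k1.1
  exact ⟨_, (key a b _ h1 rfl l1).1, (key b c _ h2 l2 l3).1, (key a c _ h3 l4 l5).1,
    (key a b _ h1 rfl l1).2, (key b c _ h2 l2 l3).2, (key a c _ h3 l4 l5).2⟩

/-- A monolabel triangle is counted once for each of its three edges, paired with the opposite
vertex. -/
theorem sum_monoCount_le : ∑ j ∈ Finset.range G.numEdges, monoCount (net G)
    (fun a b => sInf ((net G).label s(a, b))) (fun a b => sSup ((net G).label s(a, b))) D.tl D.hd j n ≤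
      3 * G.numMonolabelTriangles := by
  classical
  set lw := fun a b => sInf ((net G).label s(a, b)) with hlw
  set up := fun a b => sSup ((net G).label s(a, b)) with hup
  set A := (Finset.range G.numEdges ×ˢ Finset.range n).filter
    (fun p => Net.Mono (net G) lw up (D.tl p.1) (D.hd p.1) p.2) with hA
  have hsum : ∑ j ∈ Finset.range G.numEdges, monoCount (net G) lw up D.tl D.hd j n = A.card := by
    rw [hA, Finset.card_filter, Finset.sum_product]
    refine Finset.sum_congr rfl fun j _ => ?_
    unfold monoCount
    exact Finset.sum_congr rfl fun w _ => by congr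
  rw [hsum]
  let g : ℕ × ℕ → Finset ℕ := fun p => {D.tl p.1, D.hd p.1, p.2}
  have hN := D.isNet
  have hdist : ∀ p ∈ A, D.tl p.1 ≠ p.2 ∧ D.hd p.1 ≠ p.2 := by
    intro p hp
    have h := (Finset.mem_filter.1 hp).2.1
    exact ⟨h.2.2.ne, h.2.1.ne⟩
  -- Within a fibre, the vertex `p.2` determines the edge as the other two vertices of `T`, so there
  -- are at most as many pairs as vertices in `T`.
  have hfib : ∀ T ∈ A.image g, (A.filter fun p => g p = T).card ≤ 3 := by
    intro T hT
    obtain ⟨p₀, -, rfl⟩ := Finset.mem_image.1 hT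
    refine le_trans ?_ (Finset.card_le_three (a := D.tl p₀.1) (b := D.hd p₀.1) (c := p₀.2))
    refine Finset.card_le_card_of_injOn Prod.snd (fun p hp => ?_) ?_
    · have h := (Finset.mem_filter.1 (Finset.mem_coe.1 hp)).2
      have h' : p.2 ∈ g p₀ := by
        rw [← h]
        simp [g]
      exact h'
    · rintro ⟨i, w⟩ hp ⟨j, w'⟩ hq (rfl : w = w')
      obtain ⟨hp, hp'⟩ := Finset.mem_filter.1 (Finset.mem_coe.1 hp)
      obtain ⟨hq, hq'⟩ := Finset.mem_filter.1 (Finset.mem_coe.1 hq)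
      have d1 := hdist _ hp
      have d2 := hdist _ hq
      have hi := Finset.mem_range.1 (Finset.mem_product.1 (Finset.mem_filter.1 hp).1).1
      have hj := Finset.mem_range.1 (Finset.mem_product.1 (Finset.mem_filter.1 hq).1).1
      simp only at d1 d2 hi hj
      have hne := (hN.adj_edge hi).ne
      have hne' := (hN.adj_edge hj).ne
      have e : g (i, w) = g (j, w) := hp'.trans hq'.symm
      simp only [g] at e
      have e1 : D.tl i ∈ ({D.tl j, D.hd j, w} : Finset ℕ) := e ▸ by simp
      have e2 : D.hd i ∈ ({D.tl j, D.hd j, w} : Finset ℕ) := e ▸ by simp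
      simp only [Finset.mem_insert, Finset.mem_singleton, d1.1, d1.2, or_false] at e1 e2
      have : i = j := by
        refine hN.inj i hi j hj ?_
        omega
      rw [this]
  have h1 := Finset.card_le_mul_card_image A 3 hfib
  refine h1.trans (Nat.mul_le_mul_left 3 ?_)
  rw [numMonolabelTriangles, Set.ncard_eq_toFinset_card']
  refine Finset.card_le_card_of_injOn (fun T => {v : Fin n | (v : ℕ) ∈ T}) (fun T hT => ?_) ?_
  · obtain ⟨⟨j, w⟩, hp, rfl⟩ := Finset.mem_image.1 (Finset.mem_coe.1 hT)
    obtain ⟨hr, hmono⟩ := Finset.mem_filter.1 hp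
    obtain ⟨hj, hw⟩ := Finset.mem_product.1 hr
    simp only [Finset.mem_range] at hj hw
    obtain ⟨t, ht⟩ := D.isMonolabelTriangle_of_mono (a := ⟨_, hN.tl_lt j hj⟩)
      (b := ⟨_, hN.hd_lt j hj⟩) (c := ⟨w, hw⟩) hmono
    simp only [Set.coe_toFinset, Set.mem_ofPred_eq]
    refine ⟨t, _, _, _, ht, ?_⟩
    ext v
    simp [g, Fin.ext_iff]
  · intro T hT T' hT' h
    have hlt : ∀ T ∈ A.image g, ∀ v ∈ T, v < n := by
      intro T hT v hv
      obtain ⟨⟨j, w⟩, hp, rfl⟩ := Finset.mem_image.1 hT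
      obtain ⟨hj, hw⟩ := Finset.mem_product.1 (Finset.mem_filter.1 hp).1
      simp only [Finset.mem_range] at hj hw
      simp only [g, Finset.mem_insert, Finset.mem_singleton] at hv
      rcases hv with rfl | rfl | rfl
      exacts [hN.tl_lt j hj, hN.hd_lt j hj, hw]
    ext v
    constructor
    · intro hv
      exact (Set.ext_iff.1 h ⟨v, hlt T hT v hv⟩).1 hv
    · intro hv
      exact (Set.ext_iff.1 h ⟨v, hlt T' hT' v hv⟩).2 hv

theorem outputOrientation_image {s : State} {Q : Finset (ℕ × ℕ)}
    (h : ∀ j < G.numEdges, s.mem 4 j = 1 ↔ (D.tl j, D.hd j) ∈ Q) :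
    Prod.map Fin.valEmbedding Fin.valEmbedding '' D.outputOrientation s =
      (arcs G.numEdges D.tl D.hd Q : Set (ℕ × ℕ)) := by
  have key : ∀ j : Fin G.numEdges, Prod.map Fin.valEmbedding Fin.valEmbedding
      (if s.mem 4 j = 1 then (D.tail j, D.head j) else (D.head j, D.tail j)) =
        arc D.tl D.hd Q j := by
    intro j
    have h' := h j j.2
    unfold arc
    simp only [← h', apply_ite (Prod.map _ _)]
    simp [tl, hd]
  ext x
  simp only [arcs, Finset.coe_image, Set.mem_image, Finset.coe_range, Set.mem_Iio]
  constructor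
  · rintro ⟨_, ⟨j, rfl⟩, rfl⟩
    exact ⟨j, j.2, (key j).symm⟩
  · rintro ⟨j, hj, rfl⟩
    exact ⟨_, ⟨⟨j, hj⟩, rfl⟩, key ⟨j, hj⟩⟩

/-- The algorithm is correct and runs in the stated time. -/
theorem exists_exec (D : G.Description) : ∃ (s : State) (t : ℕ),
    Exec mainProgram D.initialState s t ∧
    t ≤ 10000 * (max (n * G.numEdges)
      (min (G.numMonolabelTriangles * n) (G.numEdges ^ 2)) + 1) ∧ D.IsCorrectOutput s := by
  -- Without edges the time bound is constant although `n` may be large, so the program has to stop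
  -- before it builds the tables.
  by_cases hm : G.numEdges = 0
  · suffices h : Run mainProgram D.initialState fun s t => t ≤ 10000 ∧ D.IsCorrectOutput s by
      obtain ⟨s, t, h1, h2, h3⟩ := h
      exact ⟨s, t, h1, by omega, h3⟩
    rw [mainProgram, run_ite]
    refine ⟨fun _ => ?_, fun h => absurd h ?_⟩
    · rw [run_assign]
      refine ⟨Nat.le_of_ble_eq_true rfl, ?_⟩
      have hnot : ∀ a b, ¬ G.graph.Adj a b := by
        intro a b hab
        obtain ⟨j, -⟩ := (D.adj_iff a b).1 hab
        exact absurd j.2 (by omega)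
      have hO : ∀ O : Set (Fin n × Fin n), O = ∅ → G.IsMTTO O := by
        rintro _ rfl
        exact ⟨⟨by simp, fun a b h => absurd h (hnot a b)⟩, by simp⟩
      refine Or.inl ⟨⟨∅, hO _ rfl⟩, by simp [reg_setReg, Expr.eval], hO _ ?_⟩
      ext x
      simp only [outputOrientation, Set.mem_ofPred_eq, Set.mem_empty_iff_false, iff_false,
        not_exists]
      exact fun j => absurd j.2 (by omega)
    · simp [Test.holds, Expr.eval, initialState, hm]
  · have hspec := mainProgram_spec D.isNet hm (s := D.initialState) rfl rfl (fun j _ => rfl)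
      (fun j _ => rfl) (fun j hj => ?_) (fun j hj => ?_) (fun a ha => ?_)
    · obtain ⟨s, t, hexec, Q, h4, hcor, ht⟩ := hspec
      refine ⟨s, t, hexec, ?_, ?_⟩
      -- The factor 3 turns 830 into 2490, and with the 6000 for the `n * m` term the total stays
      -- below 10000.
      · have h1 := Nat.mul_le_mul_left n D.sum_monoCount_le
        refine ht.trans ?_
        have h2 : n * (3 * G.numMonolabelTriangles) = 3 * (G.numMonolabelTriangles * n) := by ring
        rw [h2] at h1
        rw [pow_two]
        omega
      · rw [← D.outputOrientation_image h4, net, isMTTO_map_iff, isTComparability_map_iff] at hcor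
        exact hcor
    · simp only [initialState]
      norm_num
      rw [if_pos hj.le]
      exact D.first_label hj
    · simp only [initialState]
      norm_num
      rw [if_pos (by omega)]
      exact D.last_label hj
    · funext i
      simp only [initialState]
      rw [if_neg (by omega), if_neg (by omega), if_neg (by omega), if_neg (by omega)]
      rfl

end Description

end MultilabelTemporalGraph

theorem mainTheorem6 :
    (∀ (V : Type*) [Finite V] (G : MultilabelTemporalGraph V),
      List.TFAE [G.IsTComparability, ∃ O : Set (V × V), G.IsAMTTO O, G.NessAcyclic]) ∧
    ∃ (P : RAM.Program) (C : ℕ), ∀ (n : ℕ) (G : MultilabelTemporalGraph (Fin n))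
      (D : G.Description), ∃ (s : RAM.State) (t : ℕ),
        RAM.Exec P D.initialState s t ∧
        t ≤ C * (max (n * G.numEdges)
          (min (G.numMonolabelTriangles * n) (G.numEdges ^ 2)) + 1) ∧
        D.IsCorrectOutput s :=
  ⟨fun _ _ G => MultilabelTemporalGraph.tfae_isTComparability G, RAM.mainProgram, 10000,
    fun _ _ D => D.exists_exec⟩
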